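/- Let $(G_{ij})_{i,j\ge 1}$ be an infinite table of i.i.d. complex random variables, defined on a common probability space, with law $\mathcal{N}(0,\tfrac12 I_2)$ on $\mathbb{C}\equiv\mathbb{R}^2$ (real and imaginary parts are independent centred Gaussians of variance $\tfrac12$). For each $n\ge 1$ let $G=(G_{ij})_{1\le i,j\le n}$, an $n\times n$ matrix of the complex Ginibre ensemble. For $A\in\mathcal{M}_n(\mathbb{C})$ let $\mu_A:=\frac1n\sum_{k=1}^n\delta_{\lambda_k(A)}$, where $\lambda_1(A),\dots,\lambda_n(A)$ are the eigenvalues of $A$, i.e. the roots of its characteristic polynomial counted with multiplicity. Then, almost surely, the probability measures $\mu_{n^{-1/2}G}$ converge weakly (against bounded continuous functions), as $n\to\infty$, to the circular law $\mathcal{C}_1$, i.e. the uniform law on the unit disc of $\mathbb{C}$, with density $z\mapsto\pi^{-1}\mathbf{1}_{\{|z|\le 1\}}$. -/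

import Mathlib

open MeasureTheory ProbabilityTheory Filter Topology

/-- The Gaussian law `N(0, (1/2) I₂)` on `ℂ ≃ ℝ²`: the real and imaginary parts are independent
centred real Gaussians of variance `1/2`. -/
noncomputable def complexGaussian : Measure ℂ :=
  ((gaussianReal 0 (1 / 2)).prod (gaussianReal 0 (1 / 2))).map Complex.measurableEquivRealProd.symm

/-- The `n × n` top-left corner, evaluated at `ω`, of an infinite table of complex random
variables (indices start at `0`). -/
def cornerMatrix {Ω : Type*} (X : ℕ → ℕ → Ω → ℂ) (n : ℕ) (ω : Ω) : Matrix (Fin n) (Fin n) ℂ :=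
  Matrix.of fun i j => X i j ω

/-- The counting measure of the eigenvalues of `A`, i.e. `∑ₖ δ_{λₖ(A)}`, where the `λₖ(A)` are the
roots of the characteristic polynomial repeated according to algebraic multiplicity. -/
noncomputable def eigenvalueCount {n : ℕ} (A : Matrix (Fin n) (Fin n) ℂ) : Measure ℂ :=
  (A.charpoly.roots.map Measure.dirac).sum

theorem eigenvalueCount_univ {n : ℕ} (A : Matrix (Fin n) (Fin n) ℂ) :
    eigenvalueCount A Set.univ = n := by
  have key : ∀ s : Multiset ℂ, (s.map Measure.dirac).sum Set.univ = (s.card : ENNReal) := by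
    intro s
    induction s using Multiset.induction_on with
    | empty => simp
    | cons a s ih => simp [ih, add_comm]
  have hcard : A.charpoly.roots.card = n := by
    rw [← (IsAlgClosed.splits A.charpoly).natDegree_eq_card_roots,
      Matrix.charpoly_natDegree_eq_dim, Fintype.card_fin]
  rw [eigenvalueCount, key, hcard]

/-- The empirical spectral distribution `μ_A = (1/n) ∑ₖ δ_{λₖ(A)}` of an `n × n` complex matrix,
`n ≥ 1`. -/
noncomputable def empiricalSpectralDistribution {n : ℕ} [NeZero n]
    (A : Matrix (Fin n) (Fin n) ℂ) : ProbabilityMeasure ℂ :=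
  ⟨(n : ENNReal)⁻¹ • eigenvalueCount A, ⟨by
    rw [Measure.smul_apply, eigenvalueCount_univ, smul_eq_mul]
    exact ENNReal.inv_mul_cancel (by exact_mod_cast NeZero.ne n) (ENNReal.natCast_ne_top n)⟩⟩

/-- The circular law: the uniform law on the closed unit disc of `ℂ`, with Lebesgue density
`z ↦ π⁻¹ 1_{|z| ≤ 1}`. -/
noncomputable def circularLaw : ProbabilityMeasure ℂ :=
  ⟨volume.withDensity ({z : ℂ | ‖z‖ ≤ 1}.indicator fun _ => ENNReal.ofReal Real.pi⁻¹), ⟨by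
    have hset : {z : ℂ | ‖z‖ ≤ 1} = Metric.closedBall 0 1 := by
      ext z; simp
    rw [hset, withDensity_apply _ MeasurableSet.univ, Measure.restrict_univ,
      lintegral_indicator_const measurableSet_closedBall, Complex.volume_closedBall,
      ENNReal.ofReal_inv_of_pos Real.pi_pos, ENNReal.ofReal_one, one_pow, one_mul,
      ← NNReal.coe_real_pi, ENNReal.ofReal_coe_nnreal]
    exact ENNReal.inv_mul_cancel (by simpa using NNReal.pi_ne_zero) ENNReal.coe_ne_top⟩⟩

/-! Up to a constant depending only on n, (1/n) log|det(G - √n z)| is the logarithmic potential at z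
of the spectrum of n^{-1/2} G. In the unit disc the potential of the circular law is |z|²/2 plus a
constant, and a potential determines its measure. So it suffices that (1/n) log|det(G - √n z)| be
close to (log n! + n|z|²)/(2n) inside the disc; nothing is needed outside, since the limit already
has full mass in the disc.

Concentration. Given the other rows, det(G - z) is affine in each row, so replacing a row by an
independent copy changes log|det| by an increment of log|ag + b|. Its fourth moment is bounded
uniformly in a and b (`log_norm_affine_osc`). A martingale argument (`fourth_moment_pi`) makes the
fourth central moment of log|det| O(n²), and division by n⁴ leaves a summable sequence.

Mean. Above, Jensen's inequality is applied to E|det(G - z)|² = n! Σ_{k ≤ n} |z|^{2k}/k! ≤ n!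
e^{|z|²}. Below, consider the mean log-norm of the first-row cofactors. By unitary invariance,
passing from m to m + 1 adds at least the mean log-norm of a Gaussian vector of ℂ^{m+1}, about log(m
+ 1)/2 (`cofactorLogMean_succ_ge`). The recursion starts at m = ⌊|z|²⌋ from the bound m log|z|,
which comes from subharmonicity. Both bounds equal (log n! + |z|²)/2 up to O(log n).

Conclusion. Almost surely the deviation tends to 0 in L⁴ of the unit disc. The averages of log|z -
w| over two concentric discs differ by a nonnegative bump in w, supported in the larger disc. Hence
the spectral integrals of all such bumps in the unit disc converge to their circular-law values (s₂²
- s₁²)/4, and Fatou with the portmanteau theorem gives weak convergence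
(`tendsto_circularLaw_of_discBump`). -/

/-! ### Logarithmic singularities under measures dominated by Lebesgue measure -/

theorem integrableOn_inv_norm_ball : IntegrableOn (fun z : ℂ => ‖z‖⁻¹) (Metric.ball 0 1) := by
  have h : Integrable (fun z : ℂ => (Set.Iio (1 : ℝ)).indicator (fun t => t⁻¹) ‖z‖) := by
    rw [integrable_fun_norm_addHaar (μ := (volume : Measure ℂ))
      (f := (Set.Iio (1 : ℝ)).indicator (fun t => t⁻¹))]
    have h1 : IntegrableOn (fun _ : ℝ => (1 : ℝ)) (Set.Ioo 0 1) := by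
      simp
    refine Integrable.congr ((integrable_indicator_iff measurableSet_Ioo).2 h1).integrableOn ?_
    filter_upwards [ae_restrict_mem measurableSet_Ioi] with t ht
    have ht' : t ≠ 0 := (Set.mem_Ioi.1 ht).ne'
    by_cases h2 : t < 1
    · simp [Set.indicator, h2, Set.mem_Ioi.1 ht, ht']
    · simp [Set.indicator, h2]
  rw [← integrable_indicator_iff measurableSet_ball]
  refine h.congr (ae_of_all _ fun z => ?_)
  simp [Set.indicator]

/-- The integral of `1 / ‖z‖` over the unit disc. -/
noncomputable def invNormIntegral : ℝ := ∫ z in Metric.ball (0 : ℂ) 1, ‖z‖⁻¹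

/-- Near `a` the domination by Lebesgue measure bounds the integral by that over a unit disc;
elsewhere the integrand is at most 1. The bound does not depend on `a`, which later makes the
oscillation estimate uniform. -/
theorem integrable_inv_norm_sub {μ : Measure ℂ} [IsFiniteMeasure μ] (h : μ ≤ volume) (a : ℂ) :
    Integrable (fun z => ‖z - a‖⁻¹) μ ∧
      ∫ z, ‖z - a‖⁻¹ ∂μ ≤ invNormIntegral + μ.real Set.univ := by
  set f : ℂ → ℝ := (Metric.ball (0 : ℂ) 1).indicator fun z => ‖z‖⁻¹ with hf
  have hf0 : ∀ z, 0 ≤ f z := fun z => Set.indicator_nonneg (fun _ _ => by positivity) z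
  have hfi : Integrable f := (integrable_indicator_iff measurableSet_ball).2
    integrableOn_inv_norm_ball
  have hfa : Integrable (fun z => f (z - a)) := hfi.comp_sub_right a
  have hfμ : Integrable (fun z => f (z - a)) μ := hfa.mono_measure h
  have hle : ∀ z, ‖z - a‖⁻¹ ≤ f (z - a) + 1 := by
    intro z
    by_cases hz : ‖z - a‖ < 1
    · have : f (z - a) = ‖z - a‖⁻¹ := by simp [hf, hz]
      linarith
    · have := inv_le_one_of_one_le₀ (not_lt.1 hz)
      linarith [hf0 (z - a)]
  have hi : Integrable (fun z => f (z - a) + 1) μ := hfμ.add (integrable_const _)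
  have hI : Integrable (fun z => ‖z - a‖⁻¹) μ := by
    refine hi.mono' (by fun_prop) (ae_of_all _ fun z => ?_)
    rw [Real.norm_of_nonneg (by positivity)]
    exact hle z
  refine ⟨hI, (integral_mono hI hi hle).trans ?_⟩
  rw [integral_add hfμ (integrable_const _)]
  have h1 : ∫ z, f (z - a) ∂μ ≤ ∫ z, f (z - a) :=
    integral_mono_measure h (ae_of_all _ fun z => hf0 _) hfa
  rw [integral_sub_right_eq_self (μ := (volume : Measure ℂ)) f a, hf,
    integral_indicator measurableSet_ball, ← hf] at h1
  simp only [integral_const, smul_eq_mul, mul_one]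
  unfold invNormIntegral
  linarith

theorem abs_log_le_add_inv {t : ℝ} (ht : 0 ≤ t) : |Real.log t| ≤ t + t⁻¹ := by
  rcases ht.eq_or_lt with rfl | h
  -- At t = 0 both sides vanish under the conventions log 0 = 0 and 0⁻¹ = 0.
  · simp
  · have h1 := Real.log_le_sub_one_of_pos h
    have h2 := Real.log_le_sub_one_of_pos (inv_pos.2 h)
    rw [Real.log_inv] at h2
    have := inv_pos.2 h
    rw [abs_le]; constructor <;> linarith

theorem integrable_log_norm_sub {μ : Measure ℂ} [IsFiniteMeasure μ] (h : μ ≤ volume)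
    (hm : Integrable (fun z : ℂ => ‖z‖) μ) (a : ℂ) :
    Integrable (fun z => Real.log ‖z - a‖) μ := by
  have h1 := (integrable_inv_norm_sub h a).1
  have h2 : Integrable (fun z => (‖z‖ + ‖a‖) + ‖z - a‖⁻¹) μ :=
    (hm.add (integrable_const _)).add h1
  refine h2.mono' (Measurable.aestronglyMeasurable (by fun_prop)) (ae_of_all _ fun z => ?_)
  rw [Real.norm_eq_abs]
  exact (abs_log_le_add_inv (norm_nonneg _)).trans (by linarith [norm_sub_le z a])

/-! ### Disc averages of the logarithm and the bump function -/

/-- Integration in polar coordinates against a radial weight. -/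
theorem integral_radial_mul (ρ : ℝ → ℝ) (f : ℂ → ℝ) (hf : Integrable fun z => ρ ‖z‖ * f z) :
    IntegrableOn (fun r => 2 * Real.pi * r * ρ r * Real.circleAverage f 0 r) (Set.Ioi (0 : ℝ)) ∧
    ∫ z, ρ ‖z‖ * f z =
      ∫ r in Set.Ioi (0 : ℝ), 2 * Real.pi * r * ρ r * Real.circleAverage f 0 r := by
  rw [← Complex.integral_comp_polarCoord_symm]
  have htarget : polarCoord.target = Set.Ioi (0 : ℝ) ×ˢ Set.Ioo (-Real.pi) Real.pi := rfl
  have hint : IntegrableOn (fun p : ℝ × ℝ => p.1 •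
      (ρ ‖Complex.polarCoord.symm p‖ * f (Complex.polarCoord.symm p))) polarCoord.target := by
    have h1 : Integrable (fun p : ℝ × ℝ => (fun z => ρ ‖z‖ * f z)
        (Complex.measurableEquivRealProd.symm p)) :=
      (Complex.volume_preserving_equiv_real_prod.symm.integrable_comp_emb
        Complex.measurableEquivRealProd.symm.measurableEmbedding).2 hf
    have h2 := (integrableOn_image_iff_integrableOn_abs_det_fderiv_smul volume
      (measurableSet_Ioi.prod measurableSet_Ioo)
      (fun p _ => (hasFDerivAt_polarCoord_symm p).hasFDerivWithinAt)
      polarCoord.symm.injOn _).1 (h1.integrableOn (s := polarCoord.symm '' polarCoord.target))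
    refine h2.congr_fun (fun p hp => ?_) polarCoord.open_target.measurableSet
    have hp1 : 0 < p.1 := hp.1
    simp only [det_fderivPolarCoordSymm, abs_of_pos hp1]
    rfl
  rw [htarget] at hint ⊢
  rw [Measure.volume_eq_prod] at hint
  rw [Measure.volume_eq_prod, setIntegral_prod _ hint]
  have key : Set.EqOn (fun r => ∫ θ in Set.Ioo (-Real.pi) Real.pi, r •
      (ρ ‖Complex.polarCoord.symm (r, θ)‖ * f (Complex.polarCoord.symm (r, θ))))
      (fun r => 2 * Real.pi * r * ρ r * Real.circleAverage f 0 r) (Set.Ioi 0) := ?_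
  · rw [IntegrableOn, ← Measure.prod_restrict] at hint
    exact ⟨IntegrableOn.congr_fun hint.integral_prod_left key measurableSet_Ioi,
      setIntegral_congr_fun measurableSet_Ioi key⟩
  intro r hr
  have hr : 0 < r := hr
  have hc : ∀ θ : ℝ, Complex.polarCoord.symm (r, θ) = circleMap 0 r θ := by
    intro θ
    simp [circleMap, Complex.exp_mul_I]
  simp only [hc, norm_circleMap_zero, abs_of_pos hr, smul_eq_mul]
  rw [← integral_Ioc_eq_integral_Ioo,
    ← intervalIntegral.integral_of_le (by linarith [Real.pi_pos])]
  have hper : Function.Periodic (fun θ => f (circleMap 0 r θ)) (2 * Real.pi) := fun θ => by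
    simp [periodic_circleMap 0 r θ]
  have := hper.intervalIntegral_add_eq (-Real.pi) 0
  rw [show -Real.pi + 2 * Real.pi = Real.pi by ring, zero_add] at this
  rw [Real.circleAverage_def, ← this]
  simp_rw [intervalIntegral.integral_const_mul, smul_eq_mul]
  field_simp

/-- Jensen's formula: log|z - a| is harmonic inside the circle when a lies outside it; otherwise the
average is the constant log r. -/
theorem circleAverage_log_norm_sub_zero {r : ℝ} (hr : 0 < r) (a : ℂ) :
    Real.circleAverage (fun z => Real.log ‖z - a‖) 0 r = Real.log (max r ‖a‖) := by
  rw [circleAverage_log_norm_sub_const_eq_log_radius_add_posLog hr.ne']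
  rw [zero_sub, norm_neg, Real.posLog_eq_log_max_one (by positivity),
    ← Real.log_mul hr.ne' (by positivity), mul_max_of_nonneg _ _ hr.le, mul_one,
    mul_inv_cancel_left₀ hr.ne']

/-- The average over a disc of radius `s` of `log ‖z - w‖`, where `t` is the distance from `w` to
the centre. -/
noncomputable def discPotential (s t : ℝ) : ℝ :=
  if t ≤ s then Real.log s + (t ^ 2 / s ^ 2 - 1) / 2 else Real.log t

theorem discPotential_of_le {s t : ℝ} (h : t ≤ s) :
    discPotential s t = Real.log s + (t ^ 2 / s ^ 2 - 1) / 2 := if_pos h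

theorem discPotential_of_ge {s t : ℝ} (hs : 0 < s) (h : s ≤ t) :
    discPotential s t = Real.log t := by
  rcases h.eq_or_lt with rfl | h
  · rw [discPotential_of_le le_rfl, div_self (by positivity)]; ring
  · exact if_neg (not_le.2 h)

theorem integral_mul_log {a b : ℝ} (ha : 0 ≤ a) (hab : a ≤ b) :
    ∫ r in a..b, r * Real.log r =
      (b ^ 2 * Real.log b / 2 - b ^ 2 / 4) - (a ^ 2 * Real.log a / 2 - a ^ 2 / 4) := by
  have hc : Continuous fun r : ℝ => r * Real.log r := Real.continuous_mul_log
  refine intervalIntegral.integral_eq_sub_of_hasDerivAt_of_le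
    (f := fun r => r ^ 2 * Real.log r / 2 - r ^ 2 / 4) hab ?_ ?_ (hc.intervalIntegrable _ _)
  · have : (fun r : ℝ => r ^ 2 * Real.log r / 2 - r ^ 2 / 4) =
        fun r => r * (r * Real.log r) / 2 - r ^ 2 / 4 := by
      funext r; ring
    rw [this]
    fun_prop
  · intro r hr
    have hr0 : r ≠ 0 := (ha.trans_lt hr.1).ne'
    have h := (((hasDerivAt_pow 2 r).mul (Real.hasDerivAt_log hr0)).div_const 2).sub
      ((hasDerivAt_pow 2 r).div_const 4)
    refine HasDerivAt.congr_deriv h ?_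
    field_simp
    norm_num
    ring

theorem integral_mul_log_max {s t : ℝ} (hs : 0 < s) (ht : 0 ≤ t) :
    ∫ r in (0 : ℝ)..s, 2 * Real.pi * r * Real.log (max r t) =
      Real.pi * s ^ 2 * discPotential s t := by
  have hconst : ∀ a b : ℝ, 0 ≤ a → a ≤ b → b ≤ t →
      ∫ r in a..b, 2 * Real.pi * r * Real.log (max r t) =
        Real.pi * (b ^ 2 - a ^ 2) * Real.log t := by
    intro a b _ hab hbt
    have : ∫ r in a..b, 2 * Real.pi * r * Real.log (max r t) =
        ∫ r in a..b, (2 * Real.pi * Real.log t) * r := by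
      refine intervalIntegral.integral_congr fun r hr => ?_
      rw [Set.uIcc_of_le hab] at hr
      simp only [max_eq_right (hr.2.trans hbt)]
      ring
    rw [this, intervalIntegral.integral_const_mul, integral_id]
    ring
  have hlog : ∀ a b : ℝ, 0 ≤ a → a ≤ b → t ≤ a →
      ∫ r in a..b, 2 * Real.pi * r * Real.log (max r t) = 2 * Real.pi *
        ((b ^ 2 * Real.log b / 2 - b ^ 2 / 4) - (a ^ 2 * Real.log a / 2 - a ^ 2 / 4)) := by
    intro a b ha hab hta
    rw [← integral_mul_log ha hab, ← intervalIntegral.integral_const_mul]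
    refine intervalIntegral.integral_congr fun r hr => ?_
    rw [Set.uIcc_of_le hab] at hr
    simp only [max_eq_left (hta.trans hr.1)]
    ring
  rcases le_total s t with h | h
  · rw [hconst 0 s le_rfl hs.le h, discPotential_of_ge hs h]
    ring
  -- For t = 0 continuity at the origin rests on that of r log r; for t > 0 the logarithm stays away
  -- from its singularity.
  · have hcont : Continuous fun r : ℝ => r * Real.log (max r t) := by
      rcases ht.eq_or_lt with rfl | ht0
      · have : (fun r : ℝ => r * Real.log (max r 0)) =
            fun r => max r 0 * Real.log (max r 0) := by
          funext r
          rcases le_total r 0 with h | h <;> simp [h]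
        rw [this]
        exact Real.continuous_mul_log.comp (by fun_prop)
      · refine continuous_id.mul (Continuous.log (by fun_prop) fun r => ?_)
        exact (lt_max_of_lt_right ht0).ne'
    have hii : ∀ a b : ℝ, IntervalIntegrable
        (fun r => 2 * Real.pi * r * Real.log (max r t)) volume a b := fun a b => by
      simp_rw [mul_assoc]
      exact (((hcont.const_mul _).const_mul _).intervalIntegrable a b)
    rw [← intervalIntegral.integral_add_adjacent_intervals (hii 0 t) (hii t s),
      hconst 0 t le_rfl ht le_rfl, hlog t s ht h le_rfl, discPotential_of_le h]
    field_simp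
    ring

theorem isFiniteMeasure_restrict_ball (c : ℂ) (s : ℝ) :
    IsFiniteMeasure (volume.restrict (Metric.ball c s)) :=
  ⟨by simpa using (measure_ball_lt_top : volume (Metric.ball c s) < ⊤)⟩

theorem integrableOn_ball_log_norm_sub (c w : ℂ) (s : ℝ) :
    IntegrableOn (fun z => Real.log ‖z - w‖) (Metric.ball c s) := by
  have := isFiniteMeasure_restrict_ball c s
  refine integrable_log_norm_sub Measure.restrict_le_self ?_ w
  refine Integrable.mono' (integrable_const (‖c‖ + s)) (by fun_prop) ?_
  filter_upwards [ae_restrict_mem measurableSet_ball] with z hz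
  rw [norm_norm]
  have := norm_sub_norm_le z c
  rw [← dist_eq_norm] at this
  linarith [Metric.mem_ball.1 hz]

theorem setIntegral_ball_eq_zero_center (f : ℂ → ℝ) (c : ℂ) (s : ℝ) :
    ∫ z in Metric.ball c s, f z = ∫ z in Metric.ball 0 s, f (z + c) := by
  rw [← integral_indicator measurableSet_ball, ← integral_indicator measurableSet_ball,
    ← integral_add_right_eq_self _ c]
  refine integral_congr_ae (ae_of_all _ fun z => ?_)
  simp [Set.indicator]

theorem setIntegral_ball_radial {f : ℂ → ℝ} {s : ℝ} (hs : 0 < s)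
    (hf : IntegrableOn f (Metric.ball 0 s)) :
    ∫ z in Metric.ball 0 s, f z = ∫ r in (0 : ℝ)..s, 2 * Real.pi * r * Real.circleAverage f 0 r := by
  have h0 : (fun z => (Set.Iio s).indicator 1 ‖z‖ * f z) = (Metric.ball 0 s).indicator f := by
    funext z
    by_cases hz : ‖z‖ < s <;> simp [hz]
  have hi : Integrable (fun z => (Set.Iio s).indicator 1 ‖z‖ * f z) := by
    rw [h0]; exact (integrable_indicator_iff measurableSet_ball).2 hf
  have h := (integral_radial_mul ((Set.Iio s).indicator 1) f hi).2
  rw [h0, integral_indicator measurableSet_ball] at h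
  rw [h, intervalIntegral.integral_of_le hs.le, integral_Ioc_eq_integral_Ioo,
    ← integral_indicator measurableSet_Ioi, ← integral_indicator measurableSet_Ioo]
  refine integral_congr_ae (ae_of_all _ fun r => ?_)
  by_cases h1 : 0 < r <;> by_cases h2 : r < s <;> simp [Set.indicator, h1, h2]

theorem setIntegral_ball_log_norm_sub (c w : ℂ) {s : ℝ} (hs : 0 < s) :
    ∫ z in Metric.ball c s, Real.log ‖z - w‖ = Real.pi * s ^ 2 * discPotential s ‖w - c‖ := by
  rw [setIntegral_ball_eq_zero_center]
  have h0 : ∀ z : ℂ, z + c - w = z - (w - c) := fun z => by ring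
  simp_rw [h0]
  rw [setIntegral_ball_radial hs (integrableOn_ball_log_norm_sub _ _ _),
    ← integral_mul_log_max hs (norm_nonneg _)]
  rw [intervalIntegral.integral_of_le hs.le, intervalIntegral.integral_of_le hs.le]
  refine setIntegral_congr_fun measurableSet_Ioc fun r hr => ?_
  simp only [circleAverage_log_norm_sub_zero hr.1]

/-- The difference of two disc potentials: a bump supported in the disc of radius `s₂`. -/
noncomputable def discBump (s₁ s₂ t : ℝ) : ℝ := discPotential s₂ t - discPotential s₁ t

theorem discBump_eq_zero {s₁ s₂ t : ℝ} (h₁ : 0 < s₁) (h : s₁ ≤ s₂) (ht : s₂ ≤ t) :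
    discBump s₁ s₂ t = 0 := by
  rw [discBump, discPotential_of_ge (h₁.trans_le h) ht, discPotential_of_ge h₁ (h.trans ht),
    sub_self]

theorem log_sq_sub_le {u v : ℝ} (hu : 0 < u) (hv : 0 < v) :
    Real.log u - Real.log v ≤ (u ^ 2 / v ^ 2 - 1) / 2 := by
  have h := Real.log_le_sub_one_of_pos (show 0 < (u / v) ^ 2 by positivity)
  rw [Real.log_pow, Real.log_div hu.ne' hv.ne', div_pow] at h
  push_cast at h
  linarith

/-- This reflects subharmonicity: averages of log|z - w| over concentric discs grow with the radius.
In each regime it reduces to log x ≤ x - 1 at a squared ratio of lengths. -/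
theorem discBump_nonneg {s₁ s₂ t : ℝ} (h₁ : 0 < s₁) (h : s₁ ≤ s₂) (ht : 0 ≤ t) :
    0 ≤ discBump s₁ s₂ t := by
  have h₂ := h₁.trans_le h
  rcases le_total s₂ t with h3 | h3
  · rw [discBump_eq_zero h₁ h h3]
  rcases le_total s₁ t with h4 | h4
  · rw [discBump, discPotential_of_le h3, discPotential_of_ge h₁ h4]
    linarith [log_sq_sub_le (h₁.trans_le h4) h₂]
  · rw [discBump, discPotential_of_le h3, discPotential_of_le h4]
    have h5 := log_sq_sub_le h₁ h₂
    have h6 : t ^ 2 / s₁ ^ 2 - t ^ 2 / s₂ ^ 2 ≤ 1 - s₁ ^ 2 / s₂ ^ 2 := by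
      have e1 : t ^ 2 / s₁ ^ 2 - t ^ 2 / s₂ ^ 2 = t ^ 2 / s₁ ^ 2 * (1 - s₁ ^ 2 / s₂ ^ 2) := by
        field_simp
      have e2 : t ^ 2 / s₁ ^ 2 ≤ 1 := (div_le_one (by positivity)).2 (by gcongr)
      have e3 : 0 ≤ 1 - s₁ ^ 2 / s₂ ^ 2 := by
        rw [sub_nonneg]
        exact (div_le_one (by positivity)).2 (by gcongr)
      rw [e1]
      nlinarith
    linarith

theorem discPotential_eq {s : ℝ} (hs : 0 < s) (t : ℝ) :
    discPotential s t = Real.log (max s t) + ((min t s) ^ 2 / s ^ 2 - 1) / 2 := by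
  rcases le_total t s with h | h
  · rw [discPotential_of_le h, max_eq_left h, min_eq_left h]
  · rw [discPotential_of_ge hs h, max_eq_right h, min_eq_right h, div_self (by positivity)]
    ring

theorem continuous_discPotential {s : ℝ} (hs : 0 < s) : Continuous (discPotential s) := by
  rw [funext (discPotential_eq hs)]
  refine Continuous.add (Continuous.log (by fun_prop) fun t => (lt_max_of_lt_left hs).ne') ?_
  fun_prop

theorem integral_mul_discPotential {s R : ℝ} (hs : 0 < s) (hR : s ≤ R) :
    ∫ r in (0 : ℝ)..R, 2 * Real.pi * r * discPotential s r =
      Real.pi * R ^ 2 * Real.log R - Real.pi * R ^ 2 / 2 + Real.pi * s ^ 2 / 4 := by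
  have hc := continuous_discPotential hs
  have hii : ∀ a b : ℝ, IntervalIntegrable
      (fun r => 2 * Real.pi * r * discPotential s r) volume a b := fun a b =>
    Continuous.intervalIntegrable (by fun_prop) a b
  rw [← intervalIntegral.integral_add_adjacent_intervals (hii 0 s) (hii s R)]
  have h1 : ∫ r in (0 : ℝ)..s, 2 * Real.pi * r * discPotential s r =
      ∫ r in (0 : ℝ)..s, ((2 * Real.pi * (Real.log s - 1 / 2)) * r + Real.pi / s ^ 2 * r ^ 3) := by
    refine intervalIntegral.integral_congr fun r hr => ?_
    rw [Set.uIcc_of_le hs.le] at hr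
    simp only [discPotential_of_le hr.2]
    ring
  have h2 : ∫ r in s..R, 2 * Real.pi * r * discPotential s r =
      ∫ r in s..R, 2 * Real.pi * (r * Real.log r) := by
    refine intervalIntegral.integral_congr fun r hr => ?_
    rw [Set.uIcc_of_le hR] at hr
    simp only [discPotential_of_ge hs hr.1]
    ring
  rw [h1, h2, intervalIntegral.integral_const_mul, integral_mul_log hs.le hR,
    intervalIntegral.integral_add (Continuous.intervalIntegrable (by fun_prop) _ _)
      (Continuous.intervalIntegrable (by fun_prop) _ _),
    intervalIntegral.integral_const_mul, intervalIntegral.integral_const_mul, integral_id,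
    integral_pow]
  field_simp
  norm_num
  ring

theorem integral_discBump {s₁ s₂ : ℝ} (h₁ : 0 < s₁) (h : s₁ ≤ s₂) :
    ∫ w : ℂ, discBump s₁ s₂ ‖w‖ = Real.pi * (s₂ ^ 2 - s₁ ^ 2) / 4 := by
  have h₂ := h₁.trans_le h
  have hc₁ := continuous_discPotential h₁
  have hc₂ := continuous_discPotential h₂
  have hc : Continuous (discBump s₁ s₂) := hc₂.sub hc₁
  have hi : IntegrableOn (fun w : ℂ => discBump s₁ s₂ ‖w‖) (Metric.ball 0 s₂) :=
    ((hc.comp continuous_norm).continuousOn.integrableOn_compact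
      (isCompact_closedBall 0 s₂)).mono_set Metric.ball_subset_closedBall
  rw [← setIntegral_eq_integral_of_forall_compl_eq_zero (s := Metric.ball 0 s₂), setIntegral_ball_radial h₂ hi]
  · have h3 : ∫ r in (0 : ℝ)..s₂, 2 * Real.pi * r *
        Real.circleAverage (fun w : ℂ => discBump s₁ s₂ ‖w‖) 0 r =
        ∫ r in (0 : ℝ)..s₂, (2 * Real.pi * r * discPotential s₂ r -
          2 * Real.pi * r * discPotential s₁ r) := by
      refine intervalIntegral.integral_congr fun r hr => ?_
      rw [Set.uIcc_of_le h₂.le] at hr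
      have : Real.circleAverage (fun w : ℂ => discBump s₁ s₂ ‖w‖) 0 r = discBump s₁ s₂ r := by
        refine Real.circleAverage_const_on_circle fun z hz => ?_
        rw [mem_sphere_zero_iff_norm.1 hz, abs_of_nonneg hr.1]
      rw [this, discBump]
      ring
    rw [h3, intervalIntegral.integral_sub (Continuous.intervalIntegrable (by fun_prop) _ _)
      (Continuous.intervalIntegrable (by fun_prop) _ _), integral_mul_discPotential h₂ le_rfl,
      integral_mul_discPotential h₁ h]
    ring
  · intro w hw
    exact discBump_eq_zero h₁ h (by simpa using hw)

theorem continuous_discBump {s₁ s₂ : ℝ} (h₁ : 0 < s₁) (h : s₁ ≤ s₂) :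
    Continuous (discBump s₁ s₂) :=
  (continuous_discPotential (h₁.trans_le h)).sub (continuous_discPotential h₁)

theorem lintegral_discBump (c : ℂ) {s₁ s₂ : ℝ} (h₁ : 0 < s₁) (h : s₁ < s₂) :
    ∫⁻ w : ℂ, ENNReal.ofReal (discBump s₁ s₂ ‖w - c‖) =
      ENNReal.ofReal (Real.pi * (s₂ ^ 2 - s₁ ^ 2) / 4) := by
  rw [lintegral_sub_right_eq_self (fun w : ℂ => ENNReal.ofReal (discBump s₁ s₂ ‖w‖)) c,
    ← integral_discBump h₁ h.le, ofReal_integral_eq_lintegral_ofReal]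
  -- The Bochner integral of a non-integrable function is 0, whereas this one is positive.
  · by_contra hcon
    have := integral_undef hcon
    rw [integral_discBump h₁ h.le] at this
    have : 0 < Real.pi * (s₂ ^ 2 - s₁ ^ 2) / 4 := by
      have : 0 < s₂ ^ 2 - s₁ ^ 2 := by nlinarith
      positivity
    linarith
  · exact ae_of_all _ fun w => discBump_nonneg h₁ h.le (norm_nonneg _)

theorem circleAverage_norm_sq (c : ℂ) (r : ℝ) :
    Real.circleAverage (fun z => ‖z + c‖ ^ 2) 0 r = ‖c‖ ^ 2 + r ^ 2 := by
  have h : ∀ θ : ℝ, ‖circleMap 0 r θ + c‖ ^ 2 =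
      (‖c‖ ^ 2 + r ^ 2) + (2 * r * c.re * Real.cos θ + 2 * r * c.im * Real.sin θ) := by
    intro θ
    have hcm : circleMap 0 r θ = ⟨r * Real.cos θ, r * Real.sin θ⟩ := by
      apply Complex.ext <;> simp [circleMap, Complex.exp_mul_I, Complex.cos_ofReal_re, Complex.sin_ofReal_re]
    rw [hcm, ← Complex.normSq_eq_norm_sq, ← Complex.normSq_eq_norm_sq, Complex.normSq_apply,
      Complex.normSq_apply]
    simp only [Complex.add_re, Complex.add_im]
    linear_combination r ^ 2 * Real.sin_sq_add_cos_sq θ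
  rw [Real.circleAverage_def]
  simp_rw [h]
  rw [intervalIntegral.integral_add (by simp) (Continuous.intervalIntegrable (by fun_prop) _ _),
    intervalIntegral.integral_add (Continuous.intervalIntegrable (by fun_prop) _ _)
      (Continuous.intervalIntegrable (by fun_prop) _ _)]
  simp [intervalIntegral.integral_const_mul]
  field_simp

/-- The term ‖c‖² in the average is independent of the radius. Comparing two radii for ‖z‖²/2
therefore leaves (s₂² - s₁²)/4, the limit value of the bump statistics. -/
theorem setIntegral_ball_norm_sq (c : ℂ) {s : ℝ} (hs : 0 < s) :
    ∫ z in Metric.ball c s, ‖z‖ ^ 2 = Real.pi * s ^ 2 * (‖c‖ ^ 2 + s ^ 2 / 2) := by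
  rw [setIntegral_ball_eq_zero_center, setIntegral_ball_radial hs]
  · simp_rw [circleAverage_norm_sq]
    have : ∀ r : ℝ, 2 * Real.pi * r * (‖c‖ ^ 2 + r ^ 2) =
        (2 * Real.pi * ‖c‖ ^ 2) * r + 2 * Real.pi * r ^ 3 := fun r => by ring
    simp_rw [this]
    rw [intervalIntegral.integral_add (Continuous.intervalIntegrable (by fun_prop) _ _)
      (Continuous.intervalIntegrable (by fun_prop) _ _), intervalIntegral.integral_const_mul,
      intervalIntegral.integral_const_mul, integral_id, integral_pow]
    norm_num
    ring
  · exact ((Continuous.continuousOn (by fun_prop)).integrableOn_compact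
      (isCompact_closedBall 0 s)).mono_set Metric.ball_subset_closedBall


/-! ### The standard complex Gaussian law on ℂ -/

theorem complexGaussian_eq_withDensity :
    complexGaussian = volume.withDensity fun z : ℂ =>
      ENNReal.ofReal (Real.pi⁻¹ * Real.exp (-‖z‖ ^ 2)) := by
  have h2 : ((1 / 2 : NNReal)) ≠ 0 := by norm_num
  have hd : ∀ x y : ℝ, gaussianPDF 0 (1 / 2) x * gaussianPDF 0 (1 / 2) y =
      ENNReal.ofReal (Real.pi⁻¹ * Real.exp (-‖(⟨x, y⟩ : ℂ)‖ ^ 2)) := by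
    intro x y
    rw [gaussianPDF, gaussianPDF, ← ENNReal.ofReal_mul (gaussianPDFReal_nonneg _ _ _),
      gaussianPDFReal, gaussianPDFReal, ← Complex.normSq_eq_norm_sq, Complex.normSq_mk]
    congr 1
    push_cast
    rw [show 2 * Real.pi * (1 / 2) = Real.pi by ring, mul_mul_mul_comm, ← Real.exp_add, ← mul_inv,
      Real.mul_self_sqrt Real.pi_pos.le]
    congr 2
    ring
  have hm : Measurable fun z : ℂ => ENNReal.ofReal (Real.pi⁻¹ * Real.exp (-‖z‖ ^ 2)) := by
    fun_prop
  rw [complexGaussian, gaussianReal_of_var_ne_zero _ h2,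
    prod_withDensity (measurable_gaussianPDF _ _) (measurable_gaussianPDF _ _)]
  ext s hs
  rw [MeasurableEquiv.map_apply, withDensity_apply _ (Complex.measurableEquivRealProd.symm.measurable hs),
    withDensity_apply _ hs,
    ← Complex.volume_preserving_equiv_real_prod.symm.setLIntegral_comp_preimage hs hm]
  refine setLIntegral_congr_fun (Complex.measurableEquivRealProd.symm.measurable hs) fun p _ => ?_
  exact hd p.1 p.2

instance : IsProbabilityMeasure complexGaussian := by
  unfold complexGaussian
  exact Measure.isProbabilityMeasure_map (by fun_prop)

/-- The density is at most 1/π < 1. With a finite first moment, this is all that the integrability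
of logarithms requires. -/
theorem complexGaussian_le_volume : complexGaussian ≤ volume := by
  rw [complexGaussian_eq_withDensity]
  refine (withDensity_mono (ae_of_all _ fun z => ?_)).trans (withDensity_one).le
  rw [Pi.one_apply, ENNReal.ofReal_le_one]
  have h1 : Real.pi⁻¹ ≤ 1 := inv_le_one_of_one_le₀ (by linarith [Real.pi_gt_three])
  have h2 : Real.exp (-‖z‖ ^ 2) ≤ 1 := Real.exp_le_one_iff.2 (by simp)
  have := Real.exp_pos (-‖z‖ ^ 2)
  have := Real.pi_pos
  exact mul_le_one₀ h1 (by positivity) h2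

theorem integral_complexGaussian (f : ℂ → ℝ) :
    ∫ z, f z ∂complexGaussian = ∫ z, (Real.pi⁻¹ * Real.exp (-‖z‖ ^ 2)) * f z := by
  rw [complexGaussian_eq_withDensity, integral_withDensity_eq_integral_toReal_smul (by fun_prop)
    (ae_of_all _ fun z => ENNReal.ofReal_lt_top)]
  refine integral_congr_ae (ae_of_all _ fun z => ?_)
  have : 0 ≤ Real.pi⁻¹ * Real.exp (-‖z‖ ^ 2) := by positivity
  simp only [ENNReal.toReal_ofReal this, smul_eq_mul]

theorem integrable_complexGaussian_iff {f : ℂ → ℝ} :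
    Integrable f complexGaussian ↔
      Integrable fun z => (Real.pi⁻¹ * Real.exp (-‖z‖ ^ 2)) * f z := by
  rw [complexGaussian_eq_withDensity, integrable_withDensity_iff_integrable_smul' (by fun_prop)
    (ae_of_all _ fun z => ENNReal.ofReal_lt_top)]
  refine integrable_congr (ae_of_all _ fun z => ?_)
  have : 0 ≤ Real.pi⁻¹ * Real.exp (-‖z‖ ^ 2) := by positivity
  simp only [ENNReal.toReal_ofReal this, smul_eq_mul]

theorem charFun_complexGaussian (t : ℂ) :
    charFun complexGaussian t = Complex.exp (-(‖t‖ ^ 2 / 4 : ℝ)) := by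
  rw [charFun_apply, complexGaussian, integral_map_equiv]
  have h : ∀ p : ℝ × ℝ, Complex.exp (inner ℝ (Complex.measurableEquivRealProd.symm p) t * Complex.I)
      = Complex.exp (t.re * p.1 * Complex.I) * Complex.exp (t.im * p.2 * Complex.I) := by
    intro p
    rw [← Complex.exp_add, Complex.inner]
    congr 1
    simp [Complex.measurableEquivRealProd]
    ring
  simp_rw [h]
  rw [integral_prod_mul (fun x : ℝ => Complex.exp (t.re * x * Complex.I))
    (fun x : ℝ => Complex.exp (t.im * x * Complex.I)), ← charFun_apply_real,
    ← charFun_apply_real, charFun_gaussianReal, charFun_gaussianReal, ← Complex.exp_add,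
    ← Complex.normSq_eq_norm_sq, Complex.normSq_apply]
  congr 1
  push_cast
  ring

theorem integral_exp_neg_mul_norm_sq_complexGaussian {t : ℝ} (ht : 0 ≤ t) :
    ∫ z, Real.exp (-t * ‖z‖ ^ 2) ∂complexGaussian = (1 + t)⁻¹ := by
  rw [integral_complexGaussian]
  have h : ∀ z : ℂ, Real.pi⁻¹ * Real.exp (-‖z‖ ^ 2) * Real.exp (-t * ‖z‖ ^ 2) =
      Real.pi⁻¹ * Real.exp (-(1 + t) * ‖z‖ ^ 2) := by
    intro z
    rw [mul_assoc, ← Real.exp_add]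
    congr 2
    ring
  simp_rw [h]
  rw [integral_const_mul, GaussianFourier.integral_rexp_neg_mul_sq_norm (by linarith)]
  simp [Complex.finrank_real_complex]
  field_simp

theorem integral_norm_sq_complexGaussian :
    Integrable (fun z : ℂ => ‖z‖ ^ 2) complexGaussian ∧
      ∫ z, ‖z‖ ^ 2 ∂complexGaussian = 1 := by
  have hL : MemLp (id : ℝ → ℝ) 2 (gaussianReal 0 (1 / 2)) := memLp_id_gaussianReal 2
  have hsq : ∫ x : ℝ, x ^ 2 ∂gaussianReal 0 (1 / 2) = 1 / 2 := by
    have h := variance_id_gaussianReal (μ := 0) (v := 1 / 2)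
    rw [variance_of_integral_eq_zero (by fun_prop) (by simp)] at h
    simpa using h
  have hi : Integrable (fun x : ℝ => x ^ 2) (gaussianReal 0 (1 / 2)) := hL.integrable_sq
  have hn : ∀ p : ℝ × ℝ, ‖Complex.measurableEquivRealProd.symm p‖ ^ 2 = p.1 ^ 2 + p.2 ^ 2 := by
    intro p
    rw [← Complex.normSq_eq_norm_sq, Complex.normSq_apply]
    simp [Complex.measurableEquivRealProd]
    ring
  constructor
  · rw [complexGaussian, integrable_map_equiv]
    simp only [Function.comp_def, hn]
    exact (hi.comp_fst _).add (hi.comp_snd _)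
  · rw [complexGaussian, integral_map_equiv]
    simp_rw [hn]
    rw [integral_add (hi.comp_fst _) (hi.comp_snd _), integral_fun_fst (fun x : ℝ => x ^ 2),
      integral_fun_snd (fun x : ℝ => x ^ 2), hsq]
    norm_num

theorem integral_id_complexGaussian : ∫ z, z ∂complexGaussian = 0 := by
  have h : complexGaussian.map (fun z => -z) = complexGaussian := by
    refine @Measure.ext_of_charFun _ _ _ _ _ _ _ _ _ (Measure.isFiniteMeasure_map _ _) _ ?_
    funext t
    have := charFun_map_smul (μ := complexGaussian) (-1) t
    simp only [neg_smul, one_smul] at this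
    rw [this, charFun_complexGaussian, charFun_complexGaussian, norm_neg]
  have h1 : ∫ z, z ∂complexGaussian = -∫ z, z ∂complexGaussian := by
    conv_lhs => rw [← h]
    rw [integral_map (by fun_prop) (by fun_prop), integral_neg]
  exact self_eq_neg.1 h1

theorem integrable_norm_complexGaussian : Integrable (fun z : ℂ => ‖z‖) complexGaussian := by
  refine ((integrable_const (1 : ℝ)).add integral_norm_sq_complexGaussian.1).mono'
    (by fun_prop) (ae_of_all _ fun z => ?_)
  rw [norm_norm, Pi.add_apply]
  nlinarith [sq_nonneg (‖z‖ - 1)]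

theorem complexGaussian_singleton (a : ℂ) : complexGaussian {a} = 0 :=
  le_antisymm ((complexGaussian_le_volume _).trans_eq (by simp)) zero_le

theorem ae_ne_complexGaussian (a : ℂ) : ∀ᵐ z ∂complexGaussian, z ≠ a := by
  rw [ae_iff]
  simpa using complexGaussian_singleton a

theorem integrable_log_norm_affine (a b : ℂ) :
    Integrable (fun z => Real.log ‖a * z + b‖) complexGaussian := by
  by_cases ha : a = 0
  · simp [ha]
  have h := (integrable_const (Real.log ‖a‖)).add
    (integrable_log_norm_sub complexGaussian_le_volume integrable_norm_complexGaussian (-b / a))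
  refine h.congr ?_
  filter_upwards [ae_ne_complexGaussian (-b / a)] with z hz
  rw [Pi.add_apply, ← Real.log_mul (norm_ne_zero_iff.2 ha) (norm_ne_zero_iff.2 (sub_ne_zero.2 hz)),
    ← norm_mul]
  congr 2
  field_simp
  ring

/-- The mean of `log ‖g‖` for a standard complex Gaussian `g`. -/
noncomputable def gaussianLogMean : ℝ := ∫ z, Real.log ‖z‖ ∂complexGaussian

/-- After dividing by `a`, integrate in polar coordinates: the average of log|z - w| over the circle
of radius r is log max(r, |w|), which dominates both log r and log|w|. -/
theorem integral_log_norm_affine_ge {a b : ℂ} (ha : a ≠ 0) :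
    Real.log ‖a‖ + gaussianLogMean ≤ ∫ z, Real.log ‖a * z + b‖ ∂complexGaussian ∧
      (b ≠ 0 → Real.log ‖b‖ ≤ ∫ z, Real.log ‖a * z + b‖ ∂complexGaussian) := by
  set w := -b / a with hw
  have hi : ∀ w : ℂ, Integrable (fun z => Real.log ‖z - w‖) complexGaussian :=
    integrable_log_norm_sub complexGaussian_le_volume integrable_norm_complexGaussian
  have e1 : ∫ z, Real.log ‖a * z + b‖ ∂complexGaussian =
      Real.log ‖a‖ + ∫ z, Real.log ‖z - w‖ ∂complexGaussian := by
    have : Real.log ‖a‖ = ∫ z, Real.log ‖a‖ ∂complexGaussian := by simp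
    rw [this, ← integral_add (integrable_const _) (hi w)]
    refine integral_congr_ae ?_
    filter_upwards [ae_ne_complexGaussian w] with z hz
    rw [← Real.log_mul (norm_ne_zero_iff.2 ha) (norm_ne_zero_iff.2 (sub_ne_zero.2 hz)),
      ← norm_mul]
    congr 2
    rw [hw]
    field_simp
    ring
  have hpolar := fun w : ℂ => integral_radial_mul (fun r => Real.pi⁻¹ * Real.exp (-r ^ 2))
    (fun z => Real.log ‖z - w‖) (integrable_complexGaussian_iff.1 (hi w))
  have hmono : ∀ r : ℝ, 0 < r → 0 ≤ 2 * Real.pi * r * (Real.pi⁻¹ * Real.exp (-r ^ 2)) :=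
    fun r hr => by positivity
  rw [e1]
  constructor
  · have h0 : gaussianLogMean = ∫ z, Real.log ‖z - 0‖ ∂complexGaussian := by
      simp [gaussianLogMean]
    rw [add_le_add_iff_left, h0, integral_complexGaussian, integral_complexGaussian,
      (hpolar 0).2, (hpolar w).2]
    refine setIntegral_mono_on (hpolar 0).1 (hpolar w).1 measurableSet_Ioi fun r hr => ?_
    refine mul_le_mul_of_nonneg_left ?_ (hmono r hr)
    rw [circleAverage_log_norm_sub_zero hr, circleAverage_log_norm_sub_zero hr, norm_zero,
      max_eq_left (le_of_lt hr)]
    exact Real.log_le_log hr (le_max_left _ _)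
  · intro hb
    have hw0 : w ≠ 0 := div_ne_zero (neg_ne_zero.2 hb) ha
    have e2 : Real.log ‖b‖ = Real.log ‖a‖ + Real.log ‖w‖ := by
      rw [← Real.log_mul (norm_ne_zero_iff.2 ha) (norm_ne_zero_iff.2 hw0), ← norm_mul, hw,
        mul_div_cancel₀ _ ha, norm_neg]
    have h0 : Real.log ‖w‖ = ∫ z : ℂ, Real.log ‖w‖ ∂complexGaussian := by simp
    have hc := integral_radial_mul (fun r => Real.pi⁻¹ * Real.exp (-r ^ 2))
      (fun _ => Real.log ‖w‖) (integrable_complexGaussian_iff.1 (integrable_const _))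
    rw [e2, add_le_add_iff_left, h0, integral_complexGaussian, integral_complexGaussian, hc.2,
      (hpolar w).2]
    refine setIntegral_mono_on hc.1 (hpolar w).1 measurableSet_Ioi fun r hr => ?_
    refine mul_le_mul_of_nonneg_left ?_ (hmono r hr)
    rw [circleAverage_log_norm_sub_zero hr, Real.circleAverage_const]
    exact Real.log_le_log (norm_pos_iff.2 hw0) (le_max_right _ _)

/-! ### Gaussian vectors and unitary invariance -/

/-- The standard complex Gaussian law on `ι → ℂ`. -/
noncomputable def gaussianVec (ι : Type*) [Fintype ι] : Measure (ι → ℂ) :=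
  Measure.pi fun _ => complexGaussian

instance (ι : Type*) [Fintype ι] : IsProbabilityMeasure (gaussianVec ι) := by
  unfold gaussianVec; infer_instance

theorem charFun_gaussianVec {ι : Type*} [Fintype ι] (t : EuclideanSpace ℂ ι) :
    charFun ((gaussianVec ι).map (WithLp.toLp 2)) t = Complex.exp (-(‖t‖ ^ 2 / 4 : ℝ)) := by
  classical
  rw [gaussianVec, charFun_pi]
  simp_rw [charFun_complexGaussian]
  rw [← Complex.exp_sum, EuclideanSpace.norm_sq_eq, Finset.sum_neg_distrib, Finset.sum_div]
  push_cast
  rfl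

/-- The Gaussian law is invariant under unitary maps. -/
theorem gaussianVec_map_isometry {ι : Type*} [Fintype ι]
    (e : EuclideanSpace ℂ ι ≃ₗᵢ[ℂ] EuclideanSpace ℂ ι) :
    MeasurePreserving (fun x : ι → ℂ => WithLp.ofLp (e (WithLp.toLp 2 x)))
      (gaussianVec ι) (gaussianVec ι) := by
  have hmeas : Measurable (fun x : ι → ℂ => (WithLp.toLp 2 x : EuclideanSpace ℂ ι)) := by fun_prop
  have he : Measurable e := e.continuous.measurable
  have hof : Measurable (fun x : EuclideanSpace ℂ ι => WithLp.ofLp x) := by fun_prop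
  have key : ((gaussianVec ι).map (WithLp.toLp 2)).map e =
      (gaussianVec ι).map (WithLp.toLp 2) := by
    have := Measure.isProbabilityMeasure_map (μ := gaussianVec ι) hmeas.aemeasurable
    have := Measure.isProbabilityMeasure_map (μ := (gaussianVec ι).map (WithLp.toLp 2))
      he.aemeasurable
    refine Measure.ext_of_charFun ?_
    funext t
    rw [charFun_gaussianVec, charFun_apply, integral_map he.aemeasurable (by fun_prop)]
    -- The characteristic function uses the real inner product; polarisation shows that a complex
    -- isometry preserves it.
    have h1 : ∀ x, inner ℝ (e x) t = inner ℝ x (e.symm t) := fun x => by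
      have h3 : ‖e x + t‖ = ‖x + e.symm t‖ := by
        rw [← e.symm.norm_map, map_add, e.symm_apply_apply]
      rw [real_inner_eq_norm_add_mul_self_sub_norm_mul_self_sub_norm_mul_self_div_two,
        real_inner_eq_norm_add_mul_self_sub_norm_mul_self_sub_norm_mul_self_div_two, h3,
        e.norm_map, e.symm.norm_map]
    simp_rw [h1]
    rw [← charFun_apply, charFun_gaussianVec, e.symm.norm_map]
  refine ⟨by fun_prop, ?_⟩
  have h2 := congrArg (Measure.map fun x : EuclideanSpace ℂ ι => WithLp.ofLp x) key
  rw [Measure.map_map hof he, Measure.map_map (hof.comp he) hmeas, Measure.map_map hof hmeas] at h2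
  simpa [Function.comp_def] using h2

/-- A linear form of a Gaussian vector is a scaled complex Gaussian. -/
theorem gaussianVec_map_dotProduct {ι : Type*} [Fintype ι] (y : ι → ℂ) :
    (gaussianVec ι).map (fun r => r ⬝ᵥ y) =
      complexGaussian.map fun z => (‖WithLp.toLp 2 y‖ : ℂ) * z := by
  have h1 : Measurable fun r : ι → ℂ => r ⬝ᵥ y := by
    unfold dotProduct; fun_prop
  have := Measure.isProbabilityMeasure_map (μ := gaussianVec ι) h1.aemeasurable
  have h2 : Measurable fun z : ℂ => (‖WithLp.toLp 2 y‖ : ℂ) * z := by fun_prop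
  have := Measure.isProbabilityMeasure_map (μ := complexGaussian) h2.aemeasurable
  refine Measure.ext_of_charFun ?_
  funext t
  rw [charFun_apply, charFun_apply, integral_map h1.aemeasurable (by fun_prop),
    integral_map h2.aemeasurable (by fun_prop)]
  have e1 : ∀ r : ι → ℂ, inner ℝ (r ⬝ᵥ y) t =
      inner ℝ (WithLp.toLp 2 r) (WithLp.toLp 2 fun i => t * star (y i) : EuclideanSpace ℂ ι) := by
    intro r
    rw [PiLp.inner_apply, dotProduct, sum_inner]
    refine Finset.sum_congr rfl fun i _ => ?_
    simp [Complex.inner]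
    ring
  have e2 : ∀ z : ℂ, inner ℝ ((‖WithLp.toLp 2 y‖ : ℂ) * z) t =
      inner ℝ z ((‖WithLp.toLp 2 y‖ : ℂ) * t) := by
    intro z
    simp [Complex.inner]
    ring
  simp_rw [e1, e2]
  rw [← charFun_apply, charFun_complexGaussian]
  have e3 := charFun_gaussianVec (WithLp.toLp 2 fun i => t * star (y i) : EuclideanSpace ℂ ι)
  rw [charFun_apply, integral_map (by fun_prop) (by fun_prop)] at e3
  rw [e3]
  congr 4
  rw [EuclideanSpace.norm_sq_eq, norm_mul, mul_pow, Complex.norm_real, norm_norm,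
    EuclideanSpace.norm_sq_eq, Finset.sum_mul]
  refine Finset.sum_congr rfl fun i _ => ?_
  simp [mul_pow, mul_comm]


/-! ### A fourth moment inequality for functions of independent variables -/

theorem integral_pow_four_ge {X : Type*} [MeasurableSpace X] {μ : Measure X}
    [IsProbabilityMeasure μ] {h : X → ℝ} (hi : Integrable h μ)
    (hi4 : Integrable (fun x => h x ^ 4) μ) : (∫ x, h x ∂μ) ^ 4 ≤ ∫ x, h x ^ 4 ∂μ :=
  (Even.convexOn_pow (𝕜 := ℝ) (n := 4) (by decide)).map_integral_le (by fun_prop) isClosed_univ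
    (by simp) hi hi4

theorem integral_sq_le_of_pow_four {X : Type*} [MeasurableSpace X] {μ : Measure X}
    [IsProbabilityMeasure μ] {h : X → ℝ} (hm : AEStronglyMeasurable h μ)
    (hi4 : Integrable (fun x => h x ^ 4) μ) {q : ℝ} (hq : 0 ≤ q)
    (hle : ∫ x, h x ^ 4 ∂μ ≤ q ^ 2) :
    Integrable (fun x => h x ^ 2) μ ∧ ∫ x, h x ^ 2 ∂μ ≤ q := by
  have hi2 : Integrable (fun x => h x ^ 2) μ := by
    refine ((integrable_const (1 : ℝ)).add hi4).mono' (hm.pow 2) (ae_of_all _ fun x => ?_)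
    rw [Real.norm_of_nonneg (by positivity), Pi.add_apply]
    nlinarith [sq_nonneg (h x ^ 2 - 1)]
  refine ⟨hi2, ?_⟩
  have h1 : (∫ x, h x ^ 2 ∂μ) ^ 2 ≤ ∫ x, (h x ^ 2) ^ 2 ∂μ :=
    (Even.convexOn_pow (𝕜 := ℝ) (n := 2) (by decide)).map_integral_le (by fun_prop)
      isClosed_univ (by simp) hi2 (by simpa only [Function.comp_def, ← pow_mul] using hi4)
  simp only [← pow_mul, Nat.reduceMul] at h1
  exact abs_le_of_sq_le_sq' (h1.trans hle) hq |>.2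

theorem integrable_of_pow_four {X : Type*} [MeasurableSpace X] {μ : Measure X}
    [IsFiniteMeasure μ] {h : X → ℝ} (hm : AEStronglyMeasurable h μ)
    (hi4 : Integrable (fun x => h x ^ 4) μ) : Integrable h μ := by
  refine ((integrable_const (1 : ℝ)).add hi4).mono' hm (ae_of_all _ fun x => ?_)
  rw [Real.norm_eq_abs, Pi.add_apply, abs_le]
  constructor <;> nlinarith [sq_nonneg (h x ^ 2 - 1), sq_nonneg (h x - 1), sq_nonneg (h x + 1)]

section Product

variable {X Y : Type*} [MeasurableSpace X] [MeasurableSpace Y] {μ : Measure X} {ν : Measure Y}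
  [IsProbabilityMeasure μ] [IsProbabilityMeasure ν]

/-- Jensen's inequality in the second copy replaces it by its mean. Integrability of `h` itself is
read off from a single section `b ↦ h a - h b` with finite fourth moment. -/
theorem integrable_of_integrable_sub_pow_four {h : X → ℝ} (hm : Measurable h)
    (hi : Integrable (fun p : X × X => (h p.1 - h p.2) ^ 4) (μ.prod μ)) :
    Integrable h μ ∧ Integrable (fun x => (h x - ∫ z, h z ∂μ) ^ 4) μ ∧
      ∫ x, (h x - ∫ z, h z ∂μ) ^ 4 ∂μ ≤ ∫ p, (h p.1 - h p.2) ^ 4 ∂(μ.prod μ) := by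
  have hsec : ∀ᵐ a ∂μ, Integrable (fun b => (h a - h b) ^ 4) μ := hi.prod_right_ae
  have hI : Integrable h μ := by
    obtain ⟨a, ha⟩ := hsec.exists
    have h1 := integrable_of_pow_four (h := fun b => h a - h b) (by fun_prop) ha
    have := (integrable_const (h a)).sub h1
    exact this.congr (ae_of_all _ fun x => by simp)
  have hle : ∀ᵐ a ∂μ, (h a - ∫ z, h z ∂μ) ^ 4 ≤ ∫ b, (h a - h b) ^ 4 ∂μ := by
    filter_upwards [hsec] with a ha
    have h1 := integral_pow_four_ge (h := fun b => h a - h b) ((integrable_const _).sub hI) ha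
    rwa [integral_sub (integrable_const _) hI, integral_const, probReal_univ, one_smul] at h1
  have hJ : Integrable (fun a => ∫ b, (h a - h b) ^ 4 ∂μ) μ := hi.integral_prod_left
  have hK : Integrable (fun x => (h x - ∫ z, h z ∂μ) ^ 4) μ := by
    refine hJ.mono' (by fun_prop) ?_
    filter_upwards [hle] with a ha
    rwa [Real.norm_of_nonneg (by positivity)]
  refine ⟨hI, hK, ?_⟩
  rw [integral_prod _ hi]
  exact integral_mono_ae hK hJ hle

/-- One step of the fourth moment martingale inequality. -/
theorem fourth_moment_step {f : X → Y → ℝ} (hf : Measurable (Function.uncurry f)) {D q : ℝ}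
    (hD : 0 ≤ D) (hq : 0 ≤ q)
    (hosc : ∀ y, Integrable (fun p : X × X => (f p.1 y - f p.2 y) ^ 4) (μ.prod μ) ∧
      ∫ p, (f p.1 y - f p.2 y) ^ 4 ∂(μ.prod μ) ≤ D ^ 2)
    (hg : Integrable (fun y => ∫ x, f x y ∂μ) ν)
    (hg4 : Integrable (fun y => (∫ x, f x y ∂μ - ∫ y', ∫ x, f x y' ∂μ ∂ν) ^ 4) ν)
    (hgle : ∫ y, (∫ x, f x y ∂μ - ∫ y', ∫ x, f x y' ∂μ ∂ν) ^ 4 ∂ν ≤ q ^ 2) :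
    Integrable (fun p : X × Y => f p.1 p.2) (μ.prod ν) ∧
    Integrable (fun p : X × Y => (f p.1 p.2 - ∫ p', f p'.1 p'.2 ∂(μ.prod ν)) ^ 4) (μ.prod ν) ∧
    ∫ p, (f p.1 p.2 - ∫ p', f p'.1 p'.2 ∂(μ.prod ν)) ^ 4 ∂(μ.prod ν) ≤
      q ^ 2 + 8 * D * q + 3 * D ^ 2 := by
  have hfy : ∀ y, Measurable fun x => f x y := fun y => hf.of_uncurry_right
  set g : Y → ℝ := fun y => ∫ x, f x y ∂μ with hgdef
  set m : ℝ := ∫ y', g y' ∂ν with hm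
  have hgm : Measurable g := by
    have : StronglyMeasurable g := hf.stronglyMeasurable.integral_prod_left
    exact this.measurable
  have hf' : Measurable fun p : X × Y => f p.1 p.2 := hf
  have hsec := fun y => integrable_of_integrable_sub_pow_four (hfy y) (hosc y).1
  have hW4 : Integrable (fun p : X × Y => (f p.1 p.2 - g p.2) ^ 4) (μ.prod ν) := by
    rw [integrable_prod_iff' (by fun_prop)]
    refine ⟨ae_of_all _ fun y => (hsec y).2.1, ?_⟩
    refine (integrable_const (D ^ 2)).mono' ?_ (ae_of_all _ fun y => ?_)
    · have : Measurable fun p : X × Y => ‖(f p.1 p.2 - g p.2) ^ 4‖ := by fun_prop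
      exact (this.stronglyMeasurable.integral_prod_left'
        (f := fun p : X × Y => ‖(f p.1 p.2 - g p.2) ^ 4‖)).aestronglyMeasurable
    · rw [Real.norm_of_nonneg (by positivity)]
      have : ∀ x, ‖(f x y - g y) ^ 4‖ = (f x y - g y) ^ 4 := fun x =>
        Real.norm_of_nonneg (by positivity)
      simp_rw [this]
      exact (hsec y).2.2.trans (hosc y).2
  have hU4 : Integrable (fun p : X × Y => (g p.2 - m) ^ 4) (μ.prod ν) :=
    hg4.comp_snd (f := fun y => (g y - m) ^ 4) μ
  have hW : Integrable (fun p : X × Y => f p.1 p.2 - g p.2) (μ.prod ν) :=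
    integrable_of_pow_four (by fun_prop) hW4
  have hF : Integrable (fun p : X × Y => f p.1 p.2) (μ.prod ν) := by
    have := hW.add (hg.comp_snd μ)
    exact this.congr (ae_of_all _ fun p => by simp)
  have hEf : ∫ p', f p'.1 p'.2 ∂(μ.prod ν) = m := by
    rw [integral_prod_symm _ hF]
  have hsq : ∀ a b : ℝ, (a + b) ^ 4 ≤ 8 * (a ^ 4 + b ^ 4) := fun a b => by
    nlinarith [sq_nonneg (a ^ 2 - b ^ 2), sq_nonneg (a - b), sq_nonneg (a + b),
      sq_nonneg ((a - b) * (a + b)), mul_nonneg (sq_nonneg (a - b)) (sq_nonneg (a - b)),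
      mul_nonneg (sq_nonneg (a - b)) (sq_nonneg (a + b))]
  have hF4 : Integrable (fun p : X × Y => (f p.1 p.2 - m) ^ 4) (μ.prod ν) := by
    refine ((hW4.add hU4).const_mul 8).mono' (by fun_prop) (ae_of_all _ fun p => ?_)
    rw [Real.norm_of_nonneg (by positivity), Pi.add_apply]
    have := hsq (f p.1 p.2 - g p.2) (g p.2 - m)
    simpa using this
  rw [hEf]
  refine ⟨hF, hF4, ?_⟩
  rw [integral_prod_symm _ hF4]
  have hinner : ∀ y, ∫ x, (f x y - m) ^ 4 ∂μ ≤
      (g y - m) ^ 4 + 8 * D * (g y - m) ^ 2 + 3 * D ^ 2 := by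
    intro y
    obtain ⟨h1, h2, h3⟩ := hsec y
    have h3' := h3.trans (hosc y).2
    have hmy := (hfy y)
    obtain ⟨h4, h5⟩ := integral_sq_le_of_pow_four (h := fun x => f x y - g y) (by fun_prop) h2 hD h3'
    have h6 : Integrable (fun x => f x y - g y) μ := h1.sub (integrable_const _)
    have h7 : ∫ x, (f x y - g y) ∂μ = 0 := by
      rw [integral_sub h1 (integrable_const _), integral_const, probReal_univ, one_smul]
      exact sub_self _
    set u := g y - m
    -- With w the increment centred in x, 4uw³ ≤ 2u²w² + 2w⁴ absorbs the odd term of (w + u)⁴. The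
    -- term 4u³w is kept because its mean is zero.
    have hpt : ∀ x, (f x y - m) ^ 4 ≤ u ^ 4 + ((4 * u ^ 3) * (f x y - g y) +
        ((8 * u ^ 2) * (f x y - g y) ^ 2 + 3 * (f x y - g y) ^ 4)) := by
      intro x
      have : f x y - m = (f x y - g y) + u := by simp [u]
      rw [this]
      nlinarith [sq_nonneg ((f x y - g y) * (f x y - g y - u))]
    have i1 : Integrable (fun x => (8 * u ^ 2) * (f x y - g y) ^ 2 + 3 * (f x y - g y) ^ 4) μ :=
      (h4.const_mul _).add (h2.const_mul _)
    have i2 : Integrable (fun x => (4 * u ^ 3) * (f x y - g y) +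
        ((8 * u ^ 2) * (f x y - g y) ^ 2 + 3 * (f x y - g y) ^ 4)) μ := (h6.const_mul _).add i1
    have i3 := (integrable_const (μ := μ) (u ^ 4)).add i2
    have hm4 : Integrable (fun x => (f x y - m) ^ 4) μ := by
      refine i3.mono' (by fun_prop) (ae_of_all _ fun x => ?_)
      rw [Real.norm_of_nonneg (by positivity)]
      exact hpt x
    refine (integral_mono hm4 i3 hpt).trans ?_
    simp only [Pi.add_apply]
    rw [integral_add (integrable_const _) i2, integral_add (h6.const_mul _) i1,
      integral_add (h4.const_mul _) (h2.const_mul _), integral_const_mul, integral_const_mul,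
      integral_const_mul, h7, integral_const, probReal_univ, one_smul]
    have h8 := mul_le_mul_of_nonneg_left h5 (show 0 ≤ 8 * u ^ 2 by positivity)
    have : ∫ x, (f x y - g y) ^ 4 ∂μ ≤ D ^ 2 := h3'
    linarith
  obtain ⟨hg2, hg2le⟩ := integral_sq_le_of_pow_four (h := fun y => g y - m) (by fun_prop) hg4 hq hgle
  have j1 : Integrable (fun y => (g y - m) ^ 4 + 8 * D * (g y - m) ^ 2) ν :=
    hg4.add (hg2.const_mul _)
  refine (integral_mono hF4.integral_prod_right (j1.add (integrable_const _)) hinner).trans ?_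
  simp only [Pi.add_apply]
  rw [integral_add j1 (integrable_const _), integral_add hg4 (hg2.const_mul _),
    integral_const_mul, integral_const, probReal_univ, one_smul]
  have := mul_le_mul_of_nonneg_left hg2le (show 0 ≤ 8 * D by positivity)
  have h9 : ∫ y, (g y - m) ^ 4 ∂ν ≤ q ^ 2 := hgle
  linarith

theorem piFinSuccAbove_symm_eq_cons {X : Type*} [MeasurableSpace X] {k : ℕ} :
    (⇑(MeasurableEquiv.piFinSuccAbove (fun _ : Fin (k + 1) => X) 0).symm) =
      fun p : X × (Fin k → X) => (Fin.cons p.1 p.2 : Fin (k + 1) → X) := by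
  funext p
  exact Fin.insertNth_zero' p.1 p.2

theorem measurePreserving_cons {k : ℕ} :
    MeasurePreserving (fun p : X × (Fin k → X) => (Fin.cons p.1 p.2 : Fin (k + 1) → X))
      (μ.prod (Measure.pi fun _ => μ)) (Measure.pi fun _ => μ) := by
  have h := (measurePreserving_piFinSuccAbove (fun _ : Fin (k + 1) => μ) 0).symm
  rwa [piFinSuccAbove_symm_eq_cons] at h

theorem measurableEmbedding_cons {k : ℕ} :
    MeasurableEmbedding (fun p : X × (Fin k → X) => (Fin.cons p.1 p.2 : Fin (k + 1) → X)) := by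
  rw [← piFinSuccAbove_symm_eq_cons]
  exact MeasurableEquiv.measurableEmbedding _

theorem integral_pi_succ {k : ℕ} (f : (Fin (k + 1) → X) → ℝ) :
    ∫ x, f x ∂(Measure.pi fun _ => μ) =
      ∫ p, f (Fin.cons p.1 p.2) ∂(μ.prod (Measure.pi fun _ : Fin k => μ)) :=
  (measurePreserving_cons.integral_comp measurableEmbedding_cons f).symm

theorem integrable_pi_succ {k : ℕ} {f : (Fin (k + 1) → X) → ℝ} :
    Integrable f (Measure.pi fun _ => μ) ↔
      Integrable (fun p : X × (Fin k → X) => f (Fin.cons p.1 p.2))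
        (μ.prod (Measure.pi fun _ : Fin k => μ)) :=
  (measurePreserving_cons.integrable_comp_emb measurableEmbedding_cons).symm

/-- Concentration for functions of independent variables whose oscillation in each variable has a
bounded fourth moment. -/
theorem fourth_moment_pi {D : ℝ} (hD : 0 ≤ D) : ∀ (k : ℕ) (f : (Fin k → X) → ℝ), Measurable f →
    (∀ i x, Integrable (fun p : X × X =>
        (f (Function.update x i p.1) - f (Function.update x i p.2)) ^ 4) (μ.prod μ) ∧
      ∫ p, (f (Function.update x i p.1) - f (Function.update x i p.2)) ^ 4 ∂(μ.prod μ) ≤ D ^ 2) →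
    Integrable f (Measure.pi fun _ => μ) ∧
    Integrable (fun x => (f x - ∫ x', f x' ∂(Measure.pi fun _ => μ)) ^ 4) (Measure.pi fun _ => μ) ∧
    ∫ x, (f x - ∫ x', f x' ∂(Measure.pi fun _ => μ)) ^ 4 ∂(Measure.pi fun _ => μ) ≤
      (4 * D * k) ^ 2 := by
  intro k
  induction k with
  | zero =>
    intro f _ _
    have : f = fun _ => f default := funext fun x => by rw [Subsingleton.elim x default]
    rw [this]
    simp
  | succ k ih =>
    intro f hf hosc
    set F : X → (Fin k → X) → ℝ := fun a y => f (Fin.cons a y) with hFdef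
    have hF : Measurable (Function.uncurry F) := hf.comp measurableEmbedding_cons.measurable
    have hosc0 : ∀ y, Integrable (fun p : X × X => (F p.1 y - F p.2 y) ^ 4) (μ.prod μ) ∧
        ∫ p, (F p.1 y - F p.2 y) ^ 4 ∂(μ.prod μ) ≤ D ^ 2 := by
      intro y
      obtain ⟨a⟩ : Nonempty X := nonempty_of_isProbabilityMeasure μ
      have := hosc 0 (Fin.cons a y)
      simpa only [Fin.update_cons_zero] using this
    have hsec : ∀ y, Integrable (fun a => F a y) μ := fun y =>
      (integrable_of_integrable_sub_pow_four hF.of_uncurry_right (hosc0 y).1).1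
    have hgm : Measurable fun y => ∫ a, F a y ∂μ := by
      have : StronglyMeasurable fun y => ∫ a, F a y ∂μ := hF.stronglyMeasurable.integral_prod_left
      exact this.measurable
    -- Averaging over the first variable preserves the oscillation bounds in the others, by Jensen's
    -- inequality, so the induction hypothesis applies to the conditional mean.
    have hstep := ih (fun y => ∫ a, F a y ∂μ) hgm (by
      intro i y
      have hj : ∀ a, Integrable (fun p : X × X => (F a (Function.update y i p.1) -
            F a (Function.update y i p.2)) ^ 4) (μ.prod μ) ∧
          ∫ p, (F a (Function.update y i p.1) - F a (Function.update y i p.2)) ^ 4 ∂(μ.prod μ)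
            ≤ D ^ 2 := by
        intro a
        have := hosc i.succ (Fin.cons a y)
        simpa only [← Fin.cons_update] using this
      have hmu : ∀ j : X × X → X, Measurable j →
          Measurable fun p : X × (X × X) => F p.1 (Function.update y i (j p.2)) := by
        intro j hjm
        have : Measurable fun p : X × (X × X) => (p.1, Function.update y i (j p.2)) := by
          refine measurable_fst.prodMk ?_
          exact (measurable_update y).comp (hjm.comp measurable_snd)
        exact hF.comp this
      have hm1 := hmu _ measurable_fst
      have hm2 := hmu _ measurable_snd
      set H : X → X × X → ℝ := fun a p =>
        F a (Function.update y i p.1) - F a (Function.update y i p.2) with hH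
      have hHm : Measurable fun p : X × (X × X) => H p.1 p.2 := hm1.sub hm2
      have hH4 : Integrable (fun p : X × (X × X) => H p.1 p.2 ^ 4) (μ.prod (μ.prod μ)) := by
        rw [integrable_prod_iff (by fun_prop)]
        refine ⟨ae_of_all _ fun a => (hj a).1, ?_⟩
        refine (integrable_const (D ^ 2)).mono' ?_ (ae_of_all _ fun a => ?_)
        · have : Measurable fun p : X × (X × X) => ‖H p.1 p.2 ^ 4‖ := by fun_prop
          exact (this.stronglyMeasurable.integral_prod_right'
            (f := fun p : X × (X × X) => ‖H p.1 p.2 ^ 4‖)).aestronglyMeasurable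
        · rw [Real.norm_of_nonneg (by positivity)]
          have : ∀ p, ‖H a p ^ 4‖ = H a p ^ 4 := fun p => Real.norm_of_nonneg (by positivity)
          simp_rw [this]
          exact (hj a).2
      have hle : ∀ᵐ p ∂(μ.prod μ), (∫ a, F a (Function.update y i p.1) ∂μ -
          ∫ a, F a (Function.update y i p.2) ∂μ) ^ 4 ≤ ∫ a, H a p ^ 4 ∂μ := by
        filter_upwards [hH4.prod_left_ae] with p hp
        rw [← integral_sub (hsec _) (hsec _)]
        exact integral_pow_four_ge ((hsec _).sub (hsec _)) hp
      have hint := hH4.integral_prod_right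
      have hgi : Integrable (fun p : X × X => (∫ a, F a (Function.update y i p.1) ∂μ -
          ∫ a, F a (Function.update y i p.2) ∂μ) ^ 4) (μ.prod μ) := by
        refine hint.mono' ?_ ?_
        · have h1 : Measurable fun p : X × X => ∫ a, F a (Function.update y i p.1) ∂μ :=
            hgm.comp ((measurable_update y).comp measurable_fst)
          have h2 : Measurable fun p : X × X => ∫ a, F a (Function.update y i p.2) ∂μ :=
            hgm.comp ((measurable_update y).comp measurable_snd)
          exact ((h1.sub h2).pow_const 4).aestronglyMeasurable
        · filter_upwards [hle] with p hp
          rwa [Real.norm_of_nonneg (by positivity)]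
      refine ⟨hgi, (integral_mono_ae hgi hint hle).trans ?_⟩
      rw [← integral_prod_symm _ hH4, integral_prod _ hH4]
      refine (integral_mono hH4.integral_prod_left (integrable_const (D ^ 2))
        fun a => (hj a).2).trans ?_
      simp)
    obtain ⟨h1, h2, h3⟩ := fourth_moment_step hF hD (by positivity) hosc0 hstep.1 hstep.2.1
      hstep.2.2
    rw [integrable_pi_succ, integrable_pi_succ, integral_pi_succ f, integral_pi_succ]
    refine ⟨h1, h2, h3.trans ?_⟩
    push_cast
    -- With q = 4Dk the step yields 16D²k² + 32D²k + 3D², which is at most 16D²(k + 1)²; the factor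
    -- 4 is what matches the cross term 8Dq.
    nlinarith [mul_nonneg hD hD]

end Product


/-! ### Oscillation of the logarithm of an affine Gaussian form -/

/-- From log x ≤ x at a fourth root for t ≥ 1, giving 4⁴ = 256, and at an eighth root of 1/t for t ≤
1, giving 8⁴ = 4096. The square root of 1/t at the origin is what the next estimate can afford. -/
theorem log_pow_four_le {t : ℝ} (ht : 0 < t) :
    Real.log t ^ 4 ≤ 4096 * (t + Real.sqrt t⁻¹) := by
  have hs := Real.sqrt_nonneg t⁻¹
  rcases le_total 1 t with h | h
  · have h1 : Real.log t = 4 * Real.log (√√t) := by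
      rw [Real.log_sqrt (Real.sqrt_nonneg _), Real.log_sqrt ht.le]; ring
    have h2 : Real.log (√√t) ≤ √√t := (Real.log_le_sub_one_of_pos (by positivity)).trans (by simp)
    have h3 : (√√t) ^ 4 = t := by
      rw [show (4 : ℕ) = 2 * 2 from rfl, pow_mul, Real.sq_sqrt (Real.sqrt_nonneg _),
        Real.sq_sqrt ht.le]
    have h4 : Real.log t ≤ 4 * √√t := by linarith
    calc Real.log t ^ 4 ≤ (4 * √√t) ^ 4 := pow_le_pow_left₀ (Real.log_nonneg h) h4 4
      _ = 256 * t := by rw [mul_pow, h3]; norm_num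
      _ ≤ _ := by linarith
  · set u := t⁻¹ with hu
    have hu0 : 0 < u := inv_pos.2 ht
    have hu1 : 1 ≤ u := (one_le_inv₀ ht).2 h
    have h0 : Real.log t ^ 4 = Real.log u ^ 4 := by rw [hu, Real.log_inv]; ring
    have h1 : Real.log u = 8 * Real.log (√√√u) := by
      rw [Real.log_sqrt (Real.sqrt_nonneg _), Real.log_sqrt (Real.sqrt_nonneg _),
        Real.log_sqrt hu0.le]; ring
    have h2 : Real.log (√√√u) ≤ √√√u :=
      (Real.log_le_sub_one_of_pos (by positivity)).trans (by simp)
    have h3 : (√√√u) ^ 4 = √u := by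
      rw [show (4 : ℕ) = 2 * 2 from rfl, pow_mul, Real.sq_sqrt (Real.sqrt_nonneg _),
        Real.sq_sqrt (Real.sqrt_nonneg _)]
    have h4 : Real.log u ≤ 8 * √√√u := by linarith
    calc Real.log t ^ 4 = Real.log u ^ 4 := h0
      _ ≤ (8 * √√√u) ^ 4 := pow_le_pow_left₀ (Real.log_nonneg hu1) h4 4
      _ = 4096 * √u := by rw [mul_pow, h3]; norm_num
      _ ≤ _ := by linarith

/-- Centring at log(1 + ‖c‖) makes the bound uniform in `c`. The ratio ‖g + c‖/(1 + ‖c‖) is at most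
1 + ‖g‖; its inverse is at most (1 + ‖g‖)‖g + c‖⁻¹ + 1, and the arithmetic-geometric inequality
turns the square root of this product into an integrable sum. -/
theorem log_norm_add_sub_pow_four_le {g c : ℂ} (h : g + c ≠ 0) :
    (Real.log ‖g + c‖ - Real.log (1 + ‖c‖)) ^ 4 ≤ 4096 * (3 + 2 * ‖g‖ + ‖g + c‖⁻¹) := by
  have h0 : 0 < ‖g + c‖ := norm_pos_iff.2 h
  have hc : 0 < 1 + ‖c‖ := by positivity
  have hg := norm_nonneg g
  rw [← Real.log_div h0.ne' hc.ne']
  refine (log_pow_four_le (by positivity)).trans ?_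
  have h1 : ‖g + c‖ / (1 + ‖c‖) ≤ 1 + ‖g‖ := by
    rw [div_le_iff₀ hc]
    nlinarith [norm_add_le g c, norm_nonneg c]
  have h2 : √(‖g + c‖ / (1 + ‖c‖))⁻¹ ≤ (1 + ‖g‖ + ‖g + c‖⁻¹) / 2 + 1 := by
    rw [Real.sqrt_le_left (by positivity), inv_div, div_eq_mul_inv]
    set B := ‖g + c‖⁻¹ with hB
    have hB0 : 0 < B := inv_pos.2 h0
    have h3 : ‖c‖ ≤ ‖g + c‖ + ‖g‖ := by
      have := norm_sub_le (g + c) g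
      rwa [add_sub_cancel_left] at this
    have h4 : (1 + ‖c‖) * B ≤ (1 + ‖g‖) * B + 1 := by
      have : ‖g + c‖ * B = 1 := mul_inv_cancel₀ h0.ne'
      nlinarith
    nlinarith [sq_nonneg (1 + ‖g‖ - B)]
  have := inv_pos.2 h0
  nlinarith

/-- A uniform bound for the fourth moment of the oscillation of `log ‖a * g + b‖`. -/
noncomputable def logOscBound : ℝ :=
  16 * 4096 * (4 + 2 * ∫ z : ℂ, ‖z‖ ∂complexGaussian + invNormIntegral)

/-- Both the scale log‖a‖ and the centring log(1 + ‖b/a‖) cancel in the difference, which is why one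
constant serves all `a` and `b`. -/
theorem log_norm_affine_osc (a b : ℂ) :
    Integrable (fun p : ℂ × ℂ => (Real.log ‖a * p.1 + b‖ - Real.log ‖a * p.2 + b‖) ^ 4)
      (complexGaussian.prod complexGaussian) ∧
    ∫ p : ℂ × ℂ, (Real.log ‖a * p.1 + b‖ - Real.log ‖a * p.2 + b‖) ^ 4
      ∂(complexGaussian.prod complexGaussian) ≤ logOscBound := by
  have hI0 : 0 ≤ invNormIntegral := integral_nonneg fun z => by positivity
  have hE0 : 0 ≤ ∫ z : ℂ, ‖z‖ ∂complexGaussian := integral_nonneg fun z => by positivity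
  by_cases ha : a = 0
  · simp only [ha, zero_mul, sub_self]
    refine ⟨by simp, ?_⟩
    simp only [ne_eq, OfNat.ofNat_ne_zero, not_false_eq_true, zero_pow, integral_zero]
    unfold logOscBound
    positivity
  set c := b / a with hc
  set A : ℂ → ℝ := fun z => Real.log ‖z + c‖ - Real.log (1 + ‖c‖) with hA
  set B : ℂ → ℝ := fun z => 4096 * (3 + 2 * ‖z‖ + ‖z + c‖⁻¹) with hB
  have hinv := integrable_inv_norm_sub complexGaussian_le_volume (-c)
  simp only [sub_neg_eq_add] at hinv
  have hBi1 : Integrable (fun z : ℂ => 3 + 2 * ‖z‖) complexGaussian :=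
    (integrable_const _).add (integrable_norm_complexGaussian.const_mul 2)
  have hBi : Integrable B complexGaussian := (hBi1.add hinv.1).const_mul _
  have hBint : 16 * ∫ z, B z ∂complexGaussian ≤ logOscBound := by
    simp only [hB]
    rw [integral_const_mul, integral_add hBi1 hinv.1, integral_add (integrable_const _)
      (integrable_norm_complexGaussian.const_mul 2), integral_const_mul, integral_const]
    have := hinv.2
    simp only [probReal_univ, one_smul] at this ⊢
    unfold logOscBound
    linarith
  have hAB : ∀ᵐ z ∂complexGaussian, A z ^ 4 ≤ B z := by
    filter_upwards [ae_ne_complexGaussian (-c)] with z hz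
    exact log_norm_add_sub_pow_four_le fun h => hz (eq_neg_of_add_eq_zero_left h)
  have hAm : Measurable A := by fun_prop
  have hAi : Integrable (fun z => A z ^ 4) complexGaussian := by
    refine hBi.mono' (by fun_prop) ?_
    filter_upwards [hAB] with z hz
    rwa [Real.norm_of_nonneg (by positivity)]
  have hlog : ∀ᵐ z ∂complexGaussian, Real.log ‖a * z + b‖ =
      A z + (Real.log ‖a‖ + Real.log (1 + ‖c‖)) := by
    filter_upwards [ae_ne_complexGaussian (-c)] with z hz
    have hz' : z + c ≠ 0 := fun h => hz (eq_neg_of_add_eq_zero_left h)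
    have : a * z + b = a * (z + c) := by rw [hc]; field_simp
    rw [this, norm_mul, Real.log_mul (norm_ne_zero_iff.2 ha) (norm_ne_zero_iff.2 hz')]
    simp only [hA]; ring
  have hi8 : Integrable (fun p : ℂ × ℂ => 8 * (A p.1 ^ 4 + A p.2 ^ 4))
      (complexGaussian.prod complexGaussian) :=
    ((hAi.comp_fst _).add (hAi.comp_snd _)).const_mul 8
  have hle : ∀ᵐ p : ℂ × ℂ ∂(complexGaussian.prod complexGaussian),
      (Real.log ‖a * p.1 + b‖ - Real.log ‖a * p.2 + b‖) ^ 4 ≤ 8 * (A p.1 ^ 4 + A p.2 ^ 4) := by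
    filter_upwards [Measure.quasiMeasurePreserving_fst.ae hlog,
      Measure.quasiMeasurePreserving_snd.ae hlog] with p h1 h2
    rw [h1, h2]
    nlinarith [sq_nonneg (A p.1 ^ 2 - A p.2 ^ 2), sq_nonneg (A p.1 - A p.2),
      sq_nonneg (A p.1 + A p.2), mul_nonneg (sq_nonneg (A p.1 + A p.2)) (sq_nonneg (A p.1 + A p.2)),
      mul_nonneg (sq_nonneg (A p.1 - A p.2)) (sq_nonneg (A p.1 + A p.2))]
  have hi := hi8.mono' (f := fun p : ℂ × ℂ =>
    (Real.log ‖a * p.1 + b‖ - Real.log ‖a * p.2 + b‖) ^ 4)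
    (Measurable.aestronglyMeasurable (by fun_prop)) (by
      filter_upwards [hle] with p hp
      rwa [Real.norm_of_nonneg (by positivity)])
  refine ⟨hi, (integral_mono_ae hi hi8 hle).trans ?_⟩
  rw [integral_const_mul, integral_add (hAi.comp_fst _) (hAi.comp_snd _),
    integral_fun_fst (fun z => A z ^ 4), integral_fun_snd (fun z => A z ^ 4)]
  have := integral_mono_ae hAi hBi hAB
  simp only [probReal_univ, one_smul]
  linarith

/-! ### Functions that are affine in each Gaussian row -/

section Rows

variable {ι : Type*} [Fintype ι]

theorem measurable_dotProduct_right (y : ι → ℂ) : Measurable fun r : ι → ℂ => r ⬝ᵥ y := by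
  unfold dotProduct; fun_prop

theorem integral_dotProduct (y : ι → ℂ) {h : ℂ → ℝ} (hh : Measurable h) :
    ∫ r, h (r ⬝ᵥ y) ∂gaussianVec ι =
      ∫ z, h ((‖WithLp.toLp 2 y‖ : ℂ) * z) ∂complexGaussian := by
  rw [← integral_map (f := h) (measurable_dotProduct_right y).aemeasurable
    hh.aestronglyMeasurable, gaussianVec_map_dotProduct,
    integral_map (by fun_prop) hh.aestronglyMeasurable]

theorem integrable_dotProduct_iff (y : ι → ℂ) {h : ℂ → ℝ} (hh : Measurable h) :
    Integrable (fun r => h (r ⬝ᵥ y)) (gaussianVec ι) ↔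
      Integrable (fun z => h ((‖WithLp.toLp 2 y‖ : ℂ) * z)) complexGaussian := by
  have h1 := integrable_map_measure (f := fun r : ι → ℂ => r ⬝ᵥ y) (g := h) (μ := gaussianVec ι)
    hh.aestronglyMeasurable (measurable_dotProduct_right y).aemeasurable
  have h2 := integrable_map_measure (f := fun z : ℂ => (‖WithLp.toLp 2 y‖ : ℂ) * z) (g := h)
    (μ := complexGaussian) hh.aestronglyMeasurable (by fun_prop)
  rw [gaussianVec_map_dotProduct] at h1
  exact h1.symm.trans h2

theorem log_norm_dotProduct_osc (y : ι → ℂ) (s : ℂ) :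
    Integrable (fun p : (ι → ℂ) × (ι → ℂ) =>
      (Real.log ‖p.1 ⬝ᵥ y + s‖ - Real.log ‖p.2 ⬝ᵥ y + s‖) ^ 4)
      ((gaussianVec ι).prod (gaussianVec ι)) ∧
    ∫ p : (ι → ℂ) × (ι → ℂ), (Real.log ‖p.1 ⬝ᵥ y + s‖ - Real.log ‖p.2 ⬝ᵥ y + s‖) ^ 4
      ∂((gaussianVec ι).prod (gaussianVec ι)) ≤ logOscBound := by
  set H : ℂ × ℂ → ℝ := fun p => (Real.log ‖p.1 + s‖ - Real.log ‖p.2 + s‖) ^ 4 with hH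
  have hHm : Measurable H := by fun_prop
  have hy := measurable_dotProduct_right y
  have hT : Measurable (Prod.map (fun r : ι → ℂ => r ⬝ᵥ y) (fun r : ι → ℂ => r ⬝ᵥ y)) :=
    hy.prodMap hy
  set ℓ : ℂ := (‖WithLp.toLp 2 y‖ : ℂ)
  have hℓ : Measurable fun z : ℂ => ℓ * z := by fun_prop
  have hmap : ((gaussianVec ι).prod (gaussianVec ι)).map
      (Prod.map (fun r : ι → ℂ => r ⬝ᵥ y) (fun r : ι → ℂ => r ⬝ᵥ y)) =
      (complexGaussian.prod complexGaussian).map (Prod.map (fun z => ℓ * z) (fun z => ℓ * z)) := by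
    rw [← Measure.map_prod_map _ _ hy hy, ← Measure.map_prod_map _ _ hℓ hℓ,
      gaussianVec_map_dotProduct]
  obtain ⟨h1, h2⟩ := log_norm_affine_osc ℓ s
  have h1' : Integrable H (((gaussianVec ι).prod (gaussianVec ι)).map
      (Prod.map (fun r : ι → ℂ => r ⬝ᵥ y) (fun r : ι → ℂ => r ⬝ᵥ y))) := by
    rw [hmap]
    exact (integrable_map_measure hHm.aestronglyMeasurable (hℓ.prodMap hℓ).aemeasurable).2 h1
  refine ⟨(integrable_map_measure hHm.aestronglyMeasurable hT.aemeasurable).1 h1', ?_⟩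
  have e1 := integral_map hT.aemeasurable (f := H)
    (μ := (gaussianVec ι).prod (gaussianVec ι)) hHm.aestronglyMeasurable
  have e2 := integral_map (hℓ.prodMap hℓ).aemeasurable (f := H)
    (μ := complexGaussian.prod complexGaussian) hHm.aestronglyMeasurable
  rw [hmap, e2] at e1
  exact e1.symm.trans_le h2

theorem ae_dotProduct_add_ne_zero {y : ι → ℂ} {s : ℂ} (h : y ≠ 0 ∨ s ≠ 0) :
    ∀ᵐ r ∂gaussianVec ι, r ⬝ᵥ y + s ≠ 0 := by
  by_cases hy : y = 0
  · subst hy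
    simpa using h
  have hm : Measurable fun z : ℂ => (‖WithLp.toLp 2 y‖ : ℂ) * z := by fun_prop
  have h1 : ∀ᵐ w ∂(gaussianVec ι).map (fun r => r ⬝ᵥ y), w + s ≠ 0 := by
    have hset : MeasurableSet {w : ℂ | w + s ≠ 0} :=
      (measurableSet_eq_fun (f := fun w : ℂ => w + s) (g := fun _ => 0)
        (by fun_prop) (by fun_prop)).compl
    rw [gaussianVec_map_dotProduct]
    refine (ae_map_iff hm.aemeasurable hset).2 ?_
    have hn : ((‖WithLp.toLp 2 y‖ : ℝ) : ℂ) ≠ 0 := by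
      simpa using hy
    filter_upwards [ae_ne_complexGaussian (-s / (‖WithLp.toLp 2 y‖ : ℂ))] with z hz h0
    exact hz ((eq_div_iff hn).2 (by linear_combination h0))
  exact ae_of_ae_map (measurable_dotProduct_right y).aemeasurable h1

theorem integral_log_norm_dotProduct_ge {y : ι → ℂ} (s : ℂ) (hy : y ≠ 0) :
    Real.log ‖WithLp.toLp 2 y‖ + gaussianLogMean ≤
      ∫ r, Real.log ‖r ⬝ᵥ y + s‖ ∂gaussianVec ι := by
  rw [integral_dotProduct y (h := fun w => Real.log ‖w + s‖) (by fun_prop)]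
  have hn : ((‖WithLp.toLp 2 y‖ : ℝ) : ℂ) ≠ 0 := by simpa using hy
  have := (integral_log_norm_affine_ge (b := s) hn).1
  rwa [Complex.norm_real, norm_norm] at this

theorem integral_log_norm_dotProduct_eq {y : ι → ℂ} (hy : y ≠ 0) :
    ∫ r, Real.log ‖r ⬝ᵥ y‖ ∂gaussianVec ι = Real.log ‖WithLp.toLp 2 y‖ + gaussianLogMean := by
  rw [integral_dotProduct y (h := fun w => Real.log ‖w‖) (by fun_prop)]
  have hn : ((‖WithLp.toLp 2 y‖ : ℝ) : ℂ) ≠ 0 := by simpa using hy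
  have h0 : Real.log ‖WithLp.toLp 2 y‖ =
      ∫ z : ℂ, Real.log ‖WithLp.toLp 2 y‖ ∂complexGaussian := by simp
  have hi : Integrable (fun z : ℂ => Real.log ‖z‖) complexGaussian := by
    simpa using integrable_log_norm_affine 1 0
  rw [gaussianLogMean, h0, ← integral_add (integrable_const _) hi]
  refine integral_congr_ae ?_
  filter_upwards [ae_ne_complexGaussian 0] with z hz
  rw [norm_mul, Complex.norm_real, norm_norm, Real.log_mul (by simpa using hy)
    (norm_ne_zero_iff.2 hz)]

theorem log_norm_le_integral_dotProduct (y : ι → ℂ) {s : ℂ} (hs : s ≠ 0) :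
    Real.log ‖s‖ ≤ ∫ r, Real.log ‖r ⬝ᵥ y + s‖ ∂gaussianVec ι := by
  by_cases hy : y = 0
  · simp [hy]
  rw [integral_dotProduct y (h := fun w => Real.log ‖w + s‖) (by fun_prop)]
  have hn : ((‖WithLp.toLp 2 y‖ : ℝ) : ℂ) ≠ 0 := by simpa using hy
  exact (integral_log_norm_affine_ge (b := s) hn).2 hs

/-- A measurable function of `k` rows that is affine in each row separately. -/
structure RowAffine {k : ℕ} (F : (Fin k → ι → ℂ) → ℂ) : Prop where
  measurable : Measurable F
  affine : ∀ i x, ∃ (y : ι → ℂ) (s : ℂ), ∀ r, F (Function.update x i r) = r ⬝ᵥ y + s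

/-- The law of `k` independent standard complex Gaussian rows. -/
noncomputable def gaussianMat (k : ℕ) (ι : Type*) [Fintype ι] : Measure (Fin k → ι → ℂ) :=
  Measure.pi fun _ => gaussianVec ι

instance (k : ℕ) (ι : Type*) [Fintype ι] : IsProbabilityMeasure (gaussianMat k ι) := by
  unfold gaussianMat; infer_instance

/-- Resampling one row changes log‖F‖ by the oscillation of a single affine Gaussian form, so the
concentration inequality applies with D² = `logOscBound`, whatever the other rows are. -/
theorem RowAffine.fourth_moment {k : ℕ} {F : (Fin k → ι → ℂ) → ℂ} (hF : RowAffine F) :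
    Integrable (fun x => Real.log ‖F x‖) (gaussianMat k ι) ∧
    Integrable (fun x => (Real.log ‖F x‖ - ∫ x', Real.log ‖F x'‖ ∂gaussianMat k ι) ^ 4)
      (gaussianMat k ι) ∧
    ∫ x, (Real.log ‖F x‖ - ∫ x', Real.log ‖F x'‖ ∂gaussianMat k ι) ^ 4 ∂gaussianMat k ι ≤
      16 * logOscBound * k ^ 2 := by
  have hm := hF.measurable
  have hpos : 0 ≤ logOscBound := by
    have := (log_norm_affine_osc 0 0).2
    simpa using this
  have h := fourth_moment_pi (μ := gaussianVec ι) (Real.sqrt_nonneg logOscBound) k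
    (fun x => Real.log ‖F x‖) (by fun_prop) (by
      intro i x
      obtain ⟨y, s, hys⟩ := hF.affine i x
      simp only [hys, Real.sq_sqrt hpos]
      exact log_norm_dotProduct_osc y s)
  refine ⟨h.1, h.2.1, h.2.2.trans_eq ?_⟩
  rw [mul_pow, mul_pow, Real.sq_sqrt hpos]
  norm_num

theorem RowAffine.cons {k : ℕ} {F : (Fin (k + 1) → ι → ℂ) → ℂ} (hF : RowAffine F) (r : ι → ℂ) :
    RowAffine fun x : Fin k → ι → ℂ => F (Fin.cons r x) := by
  refine ⟨hF.measurable.comp (measurableEmbedding_cons.measurable.comp measurable_prodMk_left), ?_⟩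
  intro i x
  simpa only [Fin.cons_update] using hF.affine i.succ (Fin.cons r x)

theorem RowAffine.affine_zero {k : ℕ} {F : (Fin (k + 1) → ι → ℂ) → ℂ} (hF : RowAffine F)
    (x : Fin k → ι → ℂ) : ∃ (y : ι → ℂ) (s : ℂ), ∀ r, F (Fin.cons r x) = r ⬝ᵥ y + s := by
  simpa only [Fin.update_cons_zero] using hF.affine 0 (Fin.cons 0 x)

/-- Averaging over Gaussian rows does not decrease `log ‖F‖`. -/
theorem RowAffine.log_norm_zero_le : ∀ {k : ℕ} {F : (Fin k → ι → ℂ) → ℂ}, RowAffine F →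
    F 0 ≠ 0 → (∀ᵐ x ∂gaussianMat k ι, F x ≠ 0) ∧
      Real.log ‖F 0‖ ≤ ∫ x, Real.log ‖F x‖ ∂gaussianMat k ι := by
  intro k
  induction k with
  | zero =>
    intro F _ h0
    have : F = fun _ => F 0 := funext fun x => by rw [Subsingleton.elim x 0]
    rw [this]
    simpa using h0
  | succ k ih =>
    intro F hF h0
    have hcons0 : (Fin.cons 0 0 : Fin (k + 1) → ι → ℂ) = 0 := by
      funext i; refine Fin.cases ?_ (fun j => ?_) i <;> simp
    obtain ⟨y, s, hys⟩ := hF.affine_zero 0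
    have hs : s = F 0 := by
      have := hys 0
      rw [hcons0] at this
      simpa using this.symm
    have hne : ∀ᵐ r ∂gaussianVec ι, F (Fin.cons r 0) ≠ 0 := by
      simp only [hys]
      exact ae_dotProduct_add_ne_zero (Or.inr (hs ▸ h0))
    have hint := hF.fourth_moment.1
    rw [gaussianMat, integrable_pi_succ] at hint
    constructor
    · have hmeas : MeasurableSet {x : Fin (k + 1) → ι → ℂ | F x ≠ 0} :=
        (measurableSet_eq_fun hF.measurable measurable_const).compl
      have hcons := measurePreserving_cons (μ := gaussianVec ι) (k := k)
      rw [gaussianMat, ← hcons.map_eq]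
      refine (ae_map_iff hcons.measurable.aemeasurable hmeas).2 ?_
      refine (Measure.ae_prod_iff_ae_ae (hcons.measurable hmeas)).2 ?_
      filter_upwards [hne] with r hr
      exact (ih (hF.cons r) hr).1
    · rw [gaussianMat, integral_pi_succ, integral_prod _ hint]
      -- Randomise the first row while the others are still zero; for almost every value of it the
      -- induction hypothesis randomises the rest.
      have h1 : Real.log ‖F 0‖ ≤ ∫ r, Real.log ‖F (Fin.cons r 0)‖ ∂gaussianVec ι := by
        simp only [hys]
        rw [← hs]
        exact log_norm_le_integral_dotProduct y (hs ▸ h0)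
      refine h1.trans (integral_mono_ae ?_ hint.integral_prod_left ?_)
      · simp only [hys]
        exact (integrable_dotProduct_iff y (h := fun w => Real.log ‖w + s‖) (by fun_prop)).2
          (integrable_log_norm_affine _ _)
      · filter_upwards [hne] with r hr
        exact (ih (hF.cons r) hr).2

end Rows


/-! ### Unitary invariance of the Ginibre law -/

theorem norm_mulVec_of_unitary {ι : Type*} [Fintype ι] [DecidableEq ι] {M : Matrix ι ι ℂ}
    (h : M.conjTranspose * M = 1) (x : ι → ℂ) :
    ‖(WithLp.toLp 2 (M.mulVec x) : EuclideanSpace ℂ ι)‖ = ‖(WithLp.toLp 2 x : EuclideanSpace ℂ ι)‖ := by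
  have key : ∀ v : ι → ℂ, ((‖(WithLp.toLp 2 v : EuclideanSpace ℂ ι)‖ ^ 2 : ℝ) : ℂ) =
      star v ⬝ᵥ v := by
    intro v
    rw [EuclideanSpace.norm_sq_eq, dotProduct]
    push_cast
    refine Finset.sum_congr rfl fun i _ => ?_
    simp [← Complex.conj_mul']
  have h2 : star (M.mulVec x) ⬝ᵥ (M.mulVec x) = star x ⬝ᵥ x := by
    rw [Matrix.star_mulVec, ← Matrix.dotProduct_mulVec, Matrix.mulVec_mulVec, h, Matrix.one_mulVec]
  have h3 : ‖(WithLp.toLp 2 (M.mulVec x) : EuclideanSpace ℂ ι)‖ ^ 2 =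
      ‖(WithLp.toLp 2 x : EuclideanSpace ℂ ι)‖ ^ 2 := by
    have := (key (M.mulVec x)).trans (h2.trans (key x).symm)
    exact_mod_cast this
  exact (sq_eq_sq₀ (norm_nonneg _) (norm_nonneg _)).1 h3

theorem gaussianVec_mulVec {ι : Type*} [Fintype ι] [DecidableEq ι] {M : Matrix ι ι ℂ}
    (h : M.conjTranspose * M = 1) :
    MeasurePreserving (fun x : ι → ℂ => M.mulVec x) (gaussianVec ι) (gaussianVec ι) := by
  let e₀ : EuclideanSpace ℂ ι →ₗᵢ[ℂ] EuclideanSpace ℂ ι :=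
    ⟨Matrix.toEuclideanLin M, fun x => norm_mulVec_of_unitary h (WithLp.ofLp x)⟩
  exact gaussianVec_map_isometry (e₀.toLinearIsometryEquiv rfl)

theorem gaussianVec_map_curry (k : ℕ) (ι : Type*) [Fintype ι] :
    MeasurePreserving (Function.curry : (Fin k × ι → ℂ) → Fin k → ι → ℂ)
      (gaussianVec (Fin k × ι)) (gaussianMat k ι) := by
  have h := Measure.infinitePi_map_curry (fun (_ : Fin k) (_ : ι) => complexGaussian)
  simp only [Measure.infinitePi_eq_pi] at h
  exact ⟨measurable_curry, h⟩

theorem gaussianMat_swap (k : ℕ) :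
    MeasurePreserving (fun (D : Fin k → Fin k → ℂ) i j => D j i)
      (gaussianMat k (Fin k)) (gaussianMat k (Fin k)) := by
  have h1 := gaussianVec_map_curry k (Fin k)
  have h2 : MeasurePreserving (fun (D : Fin k × Fin k → ℂ) => fun p => D p.swap)
      (gaussianVec (Fin k × Fin k)) (gaussianVec (Fin k × Fin k)) :=
    measurePreserving_piCongrLeft (fun _ : Fin k × Fin k => complexGaussian)
      (Equiv.prodComm (Fin k) (Fin k))
  have hm : Measurable (fun (D : Fin k → Fin k → ℂ) i j => D j i) := by fun_prop
  refine ⟨hm, ?_⟩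
  conv_lhs => rw [← h1.map_eq]
  rw [Measure.map_map hm h1.measurable, ← (h1.comp h2).map_eq]
  rfl

/-- The Ginibre law is invariant under unitary conjugation. -/
theorem gaussianMat_conj (k : ℕ) {U : Matrix (Fin k) (Fin k) ℂ}
    (h : U.conjTranspose * U = 1) :
    MeasurePreserving (fun (D : Fin k → Fin k → ℂ) i j => (U * Matrix.of D * U.conjTranspose) i j)
      (gaussianMat k (Fin k)) (gaussianMat k (Fin k)) := by
  have hrow : ∀ {M : Matrix (Fin k) (Fin k) ℂ}, M.conjTranspose * M = 1 →
      MeasurePreserving (fun (D : Fin k → Fin k → ℂ) i => M.mulVec (D i))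
      (gaussianMat k (Fin k)) (gaussianMat k (Fin k)) := fun hM =>
    measurePreserving_pi _ _ fun _ => gaussianVec_mulVec hM
  have h' : (U.map star).conjTranspose * U.map star = 1 := by
    have h1 : (U.map star).conjTranspose * U.map star =
        (U.conjTranspose * U).map (starRingEnd ℂ) := by
      rw [Matrix.map_mul]
      rfl
    rw [h1, h]
    exact Matrix.map_one _ (map_zero _) (map_one _)
  -- Right multiplication by U* acts on each row by the entrywise conjugate of U; left
  -- multiplication by U acts on each row of the transpose.
  have := (gaussianMat_swap k).comp ((hrow h).comp ((gaussianMat_swap k).comp (hrow h')))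
  convert this using 1
  funext D i j
  simp only [Function.comp_apply, Matrix.mul_apply, Matrix.mulVec, dotProduct, Matrix.map_apply,
    Matrix.of_apply, Matrix.conjTranspose_apply, Finset.sum_mul, Finset.mul_sum]
  rw [Finset.sum_comm]
  refine Finset.sum_congr rfl fun a _ => Finset.sum_congr rfl fun b _ => ?_
  ring

theorem gaussianMat_split (k : ℕ) {n : ℕ} :
    MeasurePreserving (fun (p : (Fin k → ℂ) × (Fin k → Fin n → ℂ)) i =>
        (Fin.cons (p.1 i) (p.2 i) : Fin (n + 1) → ℂ))
      ((gaussianVec (Fin k)).prod (gaussianMat k (Fin n))) (gaussianMat k (Fin (n + 1))) := by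
  have h1 := (measurePreserving_arrowProdEquivProdArrow ℂ (Fin n → ℂ) (Fin k)
    (fun _ => complexGaussian) (fun _ => gaussianVec (Fin n))).symm
  have h2 : MeasurePreserving (fun (q : Fin k → ℂ × (Fin n → ℂ)) i =>
      (Fin.cons (q i).1 (q i).2 : Fin (n + 1) → ℂ))
      (Measure.pi fun _ : Fin k => complexGaussian.prod (gaussianVec (Fin n)))
      (gaussianMat k (Fin (n + 1))) :=
    measurePreserving_pi _ _ fun _ => measurePreserving_cons (μ := complexGaussian) (k := n)
  exact h2.comp h1

theorem measurableEmbedding_split (k n : ℕ) :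
    MeasurableEmbedding (fun (p : (Fin k → ℂ) × (Fin k → Fin n → ℂ)) i =>
        (Fin.cons (p.1 i) (p.2 i) : Fin (n + 1) → ℂ)) := by
  have h2 : MeasurableEmbedding (MeasurableEquiv.piCongrRight fun _ : Fin k =>
    (MeasurableEquiv.piFinSuccAbove (fun _ : Fin (n + 1) => ℂ) 0).symm) :=
    MeasurableEquiv.measurableEmbedding _
  have h1 := (MeasurableEquiv.arrowProdEquivProdArrow ℂ (Fin n → ℂ) (Fin k)).symm.measurableEmbedding
  convert h2.comp h1 using 1
  funext p i
  exact (congrFun (piFinSuccAbove_symm_eq_cons (X := ℂ) (k := n)) (p.1 i, p.2 i)).symm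

/-- The normalised vector extends to an orthonormal basis, whose vectors are the columns of U. -/
theorem exists_unitary_mulVec_single {k : ℕ} (c : Fin (k + 1) → ℂ) (hc : c ≠ 0) :
    ∃ U : Matrix (Fin (k + 1)) (Fin (k + 1)) ℂ, U.conjTranspose * U = 1 ∧
      c = (‖(WithLp.toLp 2 c : EuclideanSpace ℂ _)‖ : ℂ) • U.mulVec (Pi.single 0 1) := by
  set v : EuclideanSpace ℂ (Fin (k + 1)) := WithLp.toLp 2 c with hv
  have hv0 : v ≠ 0 := by simpa [hv] using hc
  have hn : ‖v‖ ≠ 0 := norm_ne_zero_iff.2 hv0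
  set u : EuclideanSpace ℂ (Fin (k + 1)) := (‖v‖⁻¹ : ℂ) • v with hu
  have hu1 : ‖u‖ = 1 := by
    rw [hu, norm_smul]; simp [hn]
  have hort : Orthonormal ℂ (({0} : Set (Fin (k + 1))).domRestrict fun _ => u) := by
    refine ⟨fun i => hu1, fun i j hij => ?_⟩
    exact absurd (Subsingleton.elim i j) hij
  obtain ⟨b, hb⟩ := hort.exists_orthonormalBasis_extension_of_card_eq (by simp)
  set a := EuclideanSpace.basisFun (Fin (k + 1)) ℂ
  refine ⟨a.toBasis.toMatrix b, a.toMatrix_orthonormalBasis_conjTranspose_mul_self b, ?_⟩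
  funext i
  rw [Matrix.mulVec_single_one]
  simp only [Matrix.col_apply, Pi.smul_apply, Module.Basis.toMatrix_apply]
  have h0 : b 0 = u := hb 0 (by simp)
  have h1 : (a.toBasis.repr (b 0)) i = u i := by
    rw [h0]; simp [a]
  rw [h1, hu]
  simp only [hv, PiLp.smul_apply, smul_eq_mul]
  rw [mul_inv_cancel_left₀ (Complex.ofReal_ne_zero.2 hn)]


/-! ### Determinants and first-row cofactors -/

theorem rowAffine_det_add {n : ℕ} (B : Matrix (Fin n) (Fin n) ℂ) :
    RowAffine fun x : Fin n → Fin n → ℂ => (Matrix.of x + B).det := by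
  constructor
  · refine Continuous.measurable (Continuous.matrix_det ?_)
    exact Continuous.add (by exact continuous_id) continuous_const
  · intro i x
    set M : Matrix (Fin n) (Fin n) ℂ := Matrix.of x + B with hM
    refine ⟨fun j => M.transpose.cramer (Pi.single j 1) i, M.transpose.cramer (B i) i, fun r => ?_⟩
    have h1 : Matrix.of (Function.update x i r) + B = M.updateRow i (r + B i) := by
      ext a b
      by_cases hab : a = i
      · subst hab; simp
      · simp [hab, hM, Matrix.updateRow_apply]
    rw [h1, ← Matrix.cramer_transpose_apply, map_add, Pi.add_apply]
    congr 1
    have h2 := LinearMap.pi_apply_eq_sum_univ (M.transpose.cramer) r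
    rw [h2, Finset.sum_apply, dotProduct]
    refine Finset.sum_congr rfl fun j _ => ?_
    simp only [Pi.smul_apply, smul_eq_mul]
    have h3 : (fun k => if j = k then (1 : ℂ) else 0) = Pi.single j 1 := by
      funext k
      simp [Pi.single_apply, eq_comm]
    rw [h3]

theorem rowAffine_det_sub {n : ℕ} (z : ℂ) :
    RowAffine fun x : Fin n → Fin n → ℂ => (Matrix.of x - z • 1 : Matrix _ _ ℂ).det := by
  simpa only [sub_eq_add_neg] using rowAffine_det_add (-(z • 1 : Matrix (Fin n) (Fin n) ℂ))

theorem det_sub_ae_ne_zero (n : ℕ) {z : ℂ} (hz : z ≠ 0) :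
    (∀ᵐ x ∂gaussianMat n (Fin n), (Matrix.of x - z • 1 : Matrix _ _ ℂ).det ≠ 0) ∧
    n * Real.log ‖z‖ ≤
      ∫ x, Real.log ‖(Matrix.of x - z • 1 : Matrix _ _ ℂ).det‖ ∂gaussianMat n (Fin n) := by
  have h0 : (Matrix.of (0 : Fin n → Fin n → ℂ) - z • 1 : Matrix _ _ ℂ).det = (-z) ^ n := by
    have : (Matrix.of (0 : Fin n → Fin n → ℂ) - z • 1 : Matrix _ _ ℂ) = (-z) • 1 := by
      rw [neg_smul]
      exact zero_sub _
    rw [this, Matrix.det_smul]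
    simp
  have h := (rowAffine_det_sub (n := n) z).log_norm_zero_le (by
    rw [h0]; exact pow_ne_zero _ (neg_ne_zero.2 hz))
  refine ⟨h.1, ?_⟩
  have h2 := h.2
  rw [h0, norm_pow, norm_neg, Real.log_pow] at h2
  exact h2

/-- The last `m` rows of an `(m + 1) × (m + 1)` matrix `G - z`. -/
def lowerRows {m : ℕ} (z : ℂ) (x : Fin m → Fin (m + 1) → ℂ) : Fin m → Fin (m + 1) → ℂ :=
  fun i j => x i j - if i.succ = j then z else 0

/-- The cofactors of the first row of `G - z`. -/
noncomputable def cofactorVec {m : ℕ} (z : ℂ) (x : Fin m → Fin (m + 1) → ℂ) : Fin (m + 1) → ℂ :=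
  fun j => (-1) ^ (j : ℕ) * ((Matrix.of (lowerRows z x)).submatrix id j.succAbove).det

theorem measurable_cofactorVec {m : ℕ} (z : ℂ) : Measurable (cofactorVec (m := m) z) := by
  refine Continuous.measurable (continuous_pi fun j => ?_)
  refine continuous_const.mul (Continuous.matrix_det ?_)
  refine continuous_matrix fun a b => ?_
  simp only [Matrix.submatrix_apply, Matrix.of_apply, lowerRows, id]
  fun_prop

theorem det_cons_lowerRows {m : ℕ} (z : ℂ) (x : Fin m → Fin (m + 1) → ℂ) (w : Fin (m + 1) → ℂ) :
    (Matrix.of (Fin.cons w (lowerRows z x) : Fin (m + 1) → Fin (m + 1) → ℂ)).det =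
      w ⬝ᵥ cofactorVec z x := by
  rw [Matrix.det_succ_row_zero, dotProduct]
  refine Finset.sum_congr rfl fun j _ => ?_
  simp only [Matrix.of_apply, Fin.cons_zero, cofactorVec]
  have : (Matrix.of (Fin.cons w (lowerRows z x) : Fin (m + 1) → Fin (m + 1) → ℂ)).submatrix
      Fin.succ j.succAbove = (Matrix.of (lowerRows z x)).submatrix id j.succAbove := by
    ext a b; simp
  rw [this]
  ring

/-- The product is a determinant with a repeated row. These relations are a linear system for the
cofactors. -/
theorem lowerRows_dotProduct_cofactorVec {m : ℕ} (z : ℂ) (x : Fin m → Fin (m + 1) → ℂ)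
    (i : Fin m) : lowerRows z x i ⬝ᵥ cofactorVec z x = 0 := by
  rw [← det_cons_lowerRows]
  refine Matrix.det_zero_of_row_eq (i := 0) (j := i.succ) (Fin.succ_ne_zero i).symm ?_
  funext j
  simp

theorem of_cons_sub_eq {m : ℕ} (z : ℂ) (x : Fin m → Fin (m + 1) → ℂ) (r : Fin (m + 1) → ℂ) :
    (Matrix.of (Fin.cons r x : Fin (m + 1) → Fin (m + 1) → ℂ) - z • 1 : Matrix _ _ ℂ) =
      Matrix.of (Fin.cons (r - Pi.single 0 z) (lowerRows z x) :
        Fin (m + 1) → Fin (m + 1) → ℂ) := by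
  ext a b
  refine Fin.cases ?_ (fun i => ?_) a
  · simp [Matrix.one_apply, Pi.single_apply, eq_comm]
  · simp [lowerRows, Matrix.one_apply]

theorem det_of_cons_sub {m : ℕ} (z : ℂ) (x : Fin m → Fin (m + 1) → ℂ) (r : Fin (m + 1) → ℂ) :
    (Matrix.of (Fin.cons r x : Fin (m + 1) → Fin (m + 1) → ℂ) - z • 1 : Matrix _ _ ℂ).det =
      r ⬝ᵥ cofactorVec z x + -(z * cofactorVec z x 0) := by
  rw [of_cons_sub_eq, det_cons_lowerRows, sub_dotProduct, single_dotProduct, sub_eq_add_neg]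

/-- This is det(G - z) with the shift left out of the first row. Integrating that row out gives
exactly the log-norm of the cofactors plus a constant, hence its integrability. -/
theorem rowAffine_dotProduct_cofactorVec (m : ℕ) (z : ℂ) :
    RowAffine fun x : Fin (m + 1) → Fin (m + 1) → ℂ => x 0 ⬝ᵥ cofactorVec z (Fin.tail x) := by
  have h := rowAffine_det_add
    (Matrix.of (Fin.cons 0 (lowerRows z 0) : Fin (m + 1) → Fin (m + 1) → ℂ))
  have e : ∀ x : Fin (m + 1) → Fin (m + 1) → ℂ, (Matrix.of x +
      Matrix.of (Fin.cons 0 (lowerRows z 0) : Fin (m + 1) → Fin (m + 1) → ℂ)).det =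
      x 0 ⬝ᵥ cofactorVec z (Fin.tail x) := by
    intro x
    rw [← det_cons_lowerRows]
    congr 1
    ext a b
    refine Fin.cases ?_ (fun i => ?_) a
    · simp
    · simp [lowerRows, Fin.tail, sub_eq_add_neg]
  simpa only [e] using h

/-- The first column of the adjugate does not see the first row, which links cofactors to an object
that behaves well under conjugation. -/
theorem adjugate_mulVec_single {m : ℕ} (z : ℂ) (x : Fin m → Fin (m + 1) → ℂ)
    (r : Fin (m + 1) → ℂ) :
    (Matrix.of (Fin.cons r x : Fin (m + 1) → Fin (m + 1) → ℂ) - z • 1 :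
      Matrix _ _ ℂ).adjugate.mulVec (Pi.single 0 1) = cofactorVec z x := by
  funext j
  rw [Matrix.mulVec_single_one, Matrix.col_apply, Matrix.adjugate_fin_succ_eq_det_submatrix,
    of_cons_sub_eq, cofactorVec]
  congr 2
  simp

theorem cofactorVec_split {m : ℕ} (z : ℂ) (c : Fin m → ℂ) (D : Fin m → Fin m → ℂ) :
    cofactorVec z (fun i => (Fin.cons (c i) (D i) : Fin (m + 1) → ℂ)) 0 =
      (Matrix.of D - z • 1 : Matrix _ _ ℂ).det := by
  simp only [cofactorVec, Fin.val_zero, pow_zero, one_mul]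
  congr 1
  ext a b
  simp [lowerRows, Matrix.one_apply]

/-- With A = D - z, orthogonality to the lower rows says that A applied to the tail of the cofactors
is -det(A) c. Multiply by the adjugate and cancel det(A). -/
theorem cofactorVec_split_succ {m : ℕ} (z : ℂ) (c : Fin m → ℂ) (D : Fin m → Fin m → ℂ)
    (h : (Matrix.of D - z • 1 : Matrix _ _ ℂ).det ≠ 0) :
    (fun j => cofactorVec z (fun i => (Fin.cons (c i) (D i) : Fin (m + 1) → ℂ)) (Fin.succ j)) =
      -((Matrix.of D - z • 1 : Matrix _ _ ℂ).adjugate.mulVec c) := by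
  set A : Matrix (Fin m) (Fin m) ℂ := Matrix.of D - z • 1 with hA
  set y := cofactorVec z (fun i => (Fin.cons (c i) (D i) : Fin (m + 1) → ℂ)) with hy
  have h0 : y 0 = A.det := cofactorVec_split z c D
  have h1 : A.mulVec (fun j => y j.succ) = -(A.det • c) := by
    funext i
    have := lowerRows_dotProduct_cofactorVec z
      (fun i => (Fin.cons (c i) (D i) : Fin (m + 1) → ℂ)) i
    rw [← hy, dotProduct, Fin.sum_univ_succ, h0] at this
    have e : ∀ j : Fin m, lowerRows z (fun i => (Fin.cons (c i) (D i) : Fin (m + 1) → ℂ)) i j.succ =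
        A i j := by
      intro j
      simp [lowerRows, hA, Matrix.one_apply]
    simp only [e] at this
    have e0 : lowerRows z (fun i => (Fin.cons (c i) (D i) : Fin (m + 1) → ℂ)) i 0 = c i := by
      simp [lowerRows]
    rw [e0] at this
    simp only [Matrix.mulVec, dotProduct, Pi.neg_apply, Pi.smul_apply, smul_eq_mul]
    linear_combination this
  have h2 := congrArg (A.adjugate.mulVec) h1
  rw [Matrix.mulVec_mulVec, Matrix.adjugate_mul, Matrix.smul_mulVec, Matrix.one_mulVec,
    Matrix.mulVec_neg, Matrix.mulVec_smul, ← smul_neg] at h2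
  exact smul_right_injective _ h h2

theorem norm_apply_le_norm_toLp {ι : Type*} [Fintype ι] (y : ι → ℂ) (i : ι) :
    ‖y i‖ ≤ ‖(WithLp.toLp 2 y : EuclideanSpace ℂ ι)‖ :=
  PiLp.norm_apply_le (WithLp.toLp 2 y : EuclideanSpace ℂ ι) i

theorem norm_toLp_succ_le {m : ℕ} (y : Fin (m + 1) → ℂ) :
    ‖(WithLp.toLp 2 (fun j : Fin m => y j.succ) : EuclideanSpace ℂ (Fin m))‖ ≤
      ‖(WithLp.toLp 2 y : EuclideanSpace ℂ (Fin (m + 1)))‖ := by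
  rw [EuclideanSpace.norm_eq, EuclideanSpace.norm_eq, Fin.sum_univ_succ (n := m)]
  refine Real.sqrt_le_sqrt ?_
  simp only
  have := sq_nonneg ‖y 0‖
  linarith

/-! ### Recursion for the mean log-norm of the cofactors -/

/-- The mean of the logarithm of the norm of the first-row cofactors of `G - z`. -/
noncomputable def cofactorLogMean (z : ℂ) (m : ℕ) : ℝ :=
  ∫ x, Real.log ‖(WithLp.toLp 2 (cofactorVec z x) : EuclideanSpace ℂ (Fin (m + 1)))‖
    ∂gaussianMat m (Fin (m + 1))

theorem cofactorVec_ae_ne_zero (m : ℕ) {z : ℂ} (hz : z ≠ 0) :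
    ∀ᵐ x ∂gaussianMat m (Fin (m + 1)), cofactorVec z x ≠ 0 := by
  have hset : MeasurableSet {x : Fin m → Fin (m + 1) → ℂ | cofactorVec z x ≠ 0} :=
    (measurableSet_eq_fun (measurable_cofactorVec z) measurable_const).compl
  have hs := gaussianMat_split m (n := m)
  rw [← hs.map_eq]
  refine (ae_map_iff hs.measurable.aemeasurable hset).2 ?_
  filter_upwards [Measure.quasiMeasurePreserving_snd.ae (det_sub_ae_ne_zero m hz).1] with p hp h0
  rw [← cofactorVec_split z p.1 p.2, h0] at hp
  exact hp rfl

theorem integrable_log_norm_cofactorVec (m : ℕ) {z : ℂ} (hz : z ≠ 0) :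
    Integrable (fun x => Real.log
      ‖(WithLp.toLp 2 (cofactorVec z x) : EuclideanSpace ℂ (Fin (m + 1)))‖)
      (gaussianMat m (Fin (m + 1))) := by
  have h := (rowAffine_dotProduct_cofactorVec m z).fourth_moment.1
  rw [gaussianMat, integrable_pi_succ] at h
  have h1 := h.integral_prod_right
  simp only [Fin.cons_zero, Fin.tail_cons] at h1
  refine (h1.sub (integrable_const gaussianLogMean)).congr ?_
  filter_upwards [cofactorVec_ae_ne_zero m hz] with x hx
  rw [Pi.sub_apply, integral_log_norm_dotProduct_eq hx]
  ring

/-- Given the other rows, the determinant is an affine form in the first row with the cofactors as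
coefficients, and a shift of a Gaussian form cannot lower the mean of its log-modulus. -/
theorem integral_log_norm_det_ge_cofactorLogMean (m : ℕ) {z : ℂ} (hz : z ≠ 0) :
    gaussianLogMean + cofactorLogMean z m ≤
      ∫ x, Real.log ‖(Matrix.of x - z • 1 : Matrix _ _ ℂ).det‖
        ∂gaussianMat (m + 1) (Fin (m + 1)) := by
  have h := (rowAffine_det_sub (n := m + 1) z).fourth_moment.1
  rw [gaussianMat, integrable_pi_succ] at h
  rw [gaussianMat, integral_pi_succ, integral_prod_symm _ h]
  simp only [det_of_cons_sub] at h ⊢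
  have hc := integrable_log_norm_cofactorVec m hz
  have : gaussianLogMean + cofactorLogMean z m = ∫ x, (Real.log
      ‖(WithLp.toLp 2 (cofactorVec z x) : EuclideanSpace ℂ (Fin (m + 1)))‖ + gaussianLogMean)
      ∂gaussianMat m (Fin (m + 1)) := by
    rw [integral_add hc (integrable_const _), cofactorLogMean]
    simp [add_comm]
  rw [this]
  refine integral_mono_ae (hc.add (integrable_const _)) h.integral_prod_right ?_
  filter_upwards [cofactorVec_ae_ne_zero m hz] with x hx
  exact integral_log_norm_dotProduct_ge _ hx

/-- Keep only the cofactor of index 0, which is det(D - z) for a smaller Ginibre matrix. This bound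
starts the recursion. -/
theorem cofactorLogMean_ge_mul_log (m : ℕ) {z : ℂ} (hz : z ≠ 0) :
    m * Real.log ‖z‖ ≤ cofactorLogMean z m := by
  have hs := gaussianMat_split m (n := m)
  have he := measurableEmbedding_split m m
  obtain ⟨h1, h2⟩ := det_sub_ae_ne_zero m hz
  refine h2.trans ?_
  have hc := (hs.integrable_comp_emb he).2 (integrable_log_norm_cofactorVec m hz)
  rw [cofactorLogMean, ← hs.integral_comp he]
  have hd := (rowAffine_det_sub (n := m) z).fourth_moment.1
  have : ∫ x, Real.log ‖(Matrix.of x - z • 1 : Matrix _ _ ℂ).det‖ ∂gaussianMat m (Fin m) =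
      ∫ p, Real.log ‖(Matrix.of p.2 - z • 1 : Matrix _ _ ℂ).det‖
        ∂((gaussianVec (Fin m)).prod (gaussianMat m (Fin m))) := by
    rw [integral_fun_snd (fun x : Fin m → Fin m → ℂ =>
      Real.log ‖(Matrix.of x - z • 1 : Matrix _ _ ℂ).det‖)]
    simp
  rw [this]
  refine integral_mono_ae (hd.comp_snd _) hc ?_
  filter_upwards [Measure.quasiMeasurePreserving_snd.ae h1] with p hp
  refine Real.log_le_log (norm_pos_iff.2 hp) ?_
  rw [← cofactorVec_split z p.1 p.2]
  exact norm_apply_le_norm_toLp _ 0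

/-- A unitary conjugation preserves the law of D, fixes z and commutes with the adjugate, so c may
be replaced by ‖c‖ times the first basis vector; then the first column of the adjugate, the cofactor
vector, appears. -/
theorem integral_log_norm_adjugate_mulVec (m : ℕ) {z : ℂ} (hz : z ≠ 0) {c : Fin (m + 1) → ℂ}
    (hc : c ≠ 0) :
    Integrable (fun D => Real.log ‖(WithLp.toLp 2
      ((Matrix.of D - z • 1 : Matrix _ _ ℂ).adjugate.mulVec c) :
        EuclideanSpace ℂ (Fin (m + 1)))‖) (gaussianMat (m + 1) (Fin (m + 1))) ∧
    ∫ D, Real.log ‖(WithLp.toLp 2 ((Matrix.of D - z • 1 : Matrix _ _ ℂ).adjugate.mulVec c) :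
        EuclideanSpace ℂ (Fin (m + 1)))‖ ∂gaussianMat (m + 1) (Fin (m + 1)) =
      Real.log ‖(WithLp.toLp 2 c : EuclideanSpace ℂ (Fin (m + 1)))‖ + cofactorLogMean z m := by
  obtain ⟨U, hU, hcU⟩ := exists_unitary_mulVec_single c hc
  set ℓ := ‖(WithLp.toLp 2 c : EuclideanSpace ℂ (Fin (m + 1)))‖ with hℓ
  have hℓ0 : ℓ ≠ 0 := by simpa [hℓ] using hc
  have hU' : U * U.conjTranspose = 1 := mul_eq_one_comm.1 hU
  set Φ : (Fin (m + 1) → Fin (m + 1) → ℂ) → ℝ := fun D => Real.log ‖(WithLp.toLp 2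
      ((Matrix.of D - z • 1 : Matrix _ _ ℂ).adjugate.mulVec c) :
        EuclideanSpace ℂ (Fin (m + 1)))‖ with hΦ
  have hΦm : Measurable Φ := by
    have : Continuous fun D : Fin (m + 1) → Fin (m + 1) → ℂ => (WithLp.toLp 2
      ((Matrix.of D - z • 1 : Matrix _ _ ℂ).adjugate.mulVec c) :
        EuclideanSpace ℂ (Fin (m + 1))) := by
      refine (PiLp.continuous_toLp 2 _).comp (Continuous.matrix_mulVec ?_ continuous_const)
      refine Continuous.matrix_adjugate ?_
      exact Continuous.sub (by exact continuous_id) continuous_const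
    exact Real.measurable_log.comp this.norm.measurable
  have hconj := gaussianMat_conj (m + 1) hU
  have hrot : ∀ D : Fin (m + 1) → Fin (m + 1) → ℂ,
      Φ (fun i j => (U * Matrix.of D * U.conjTranspose) i j) = Real.log (ℓ *
        ‖(WithLp.toLp 2 ((Matrix.of D - z • 1 : Matrix _ _ ℂ).adjugate.mulVec (Pi.single 0 1)) :
        EuclideanSpace ℂ (Fin (m + 1)))‖) := by
    intro D
    have e1 : (Matrix.of (fun i j => (U * Matrix.of D * U.conjTranspose) i j) - z • 1 :
        Matrix _ _ ℂ) = U * (Matrix.of D - z • 1) * U.conjTranspose := by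
      rw [mul_sub, sub_mul]
      simp only [mul_smul_comm, smul_mul_assoc, mul_one, hU']
      rfl
    have e2 : ∀ V W : Matrix (Fin (m + 1)) (Fin (m + 1)) ℂ, V * W = 1 →
        V.adjugate = V.det • W := by
      intro V W hVW
      have : V.adjugate * V * W = V.det • W := by
        rw [Matrix.adjugate_mul, smul_mul_assoc, one_mul]
      rwa [mul_assoc, hVW, mul_one] at this
    have e3 : U.conjTranspose.det * U.det = 1 := by rw [← Matrix.det_mul, hU, Matrix.det_one]
    -- The adjugates of U and U* are det(U) U* and det(U*) U, and the two determinants cancel.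
    have e4 : (U * (Matrix.of D - z • 1) * U.conjTranspose).adjugate =
        U * (Matrix.of D - z • 1 : Matrix _ _ ℂ).adjugate * U.conjTranspose := by
      rw [Matrix.adjugate_mul_distrib, Matrix.adjugate_mul_distrib, e2 _ _ hU, e2 _ _ hU',
        mul_smul_comm, smul_mul_assoc, mul_smul_comm, smul_smul, e3, one_smul,
        mul_assoc]
    have e5 : U.conjTranspose.mulVec c = (ℓ : ℂ) • Pi.single 0 1 := by
      rw [hcU, Matrix.mulVec_smul, Matrix.mulVec_mulVec, hU, Matrix.one_mulVec]
    simp only [hΦ]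
    rw [e1, e4, ← Matrix.mulVec_mulVec, e5, Matrix.mulVec_smul, ← Matrix.mulVec_mulVec,
      WithLp.toLp_smul, norm_smul, norm_mulVec_of_unitary hU, Complex.norm_real, hℓ, norm_norm]
  have hcons := measurePreserving_cons (μ := gaussianVec (Fin (m + 1))) (k := m)
  have hev : (fun p : (Fin (m + 1) → ℂ) × (Fin m → Fin (m + 1) → ℂ) =>
      Φ (fun i j => (U * Matrix.of (Fin.cons p.1 p.2 : Fin (m + 1) → Fin (m + 1) → ℂ) *
        U.conjTranspose) i j)) =ᵐ[(gaussianVec (Fin (m + 1))).prod (gaussianMat m (Fin (m + 1)))]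
      fun p => Real.log ℓ + Real.log
        ‖(WithLp.toLp 2 (cofactorVec z p.2) : EuclideanSpace ℂ (Fin (m + 1)))‖ := by
    filter_upwards [Measure.quasiMeasurePreserving_snd.ae (cofactorVec_ae_ne_zero m hz)] with p hp
    rw [hrot, adjugate_mulVec_single, Real.log_mul hℓ0 (by simpa using hp)]
  have hiC := (integrable_log_norm_cofactorVec m hz).comp_snd (gaussianVec (Fin (m + 1)))
  have hi1 := ((integrable_const (Real.log ℓ)).add hiC).congr hev.symm
  have hi2 : Integrable (fun D => Φ (fun i j => (U * Matrix.of D * U.conjTranspose) i j))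
      (gaussianMat (m + 1) (Fin (m + 1))) := integrable_pi_succ.2 hi1
  have hΦ' : AEStronglyMeasurable Φ ((gaussianMat (m + 1) (Fin (m + 1))).map
      fun (D : Fin (m + 1) → Fin (m + 1) → ℂ) i j => (U * Matrix.of D * U.conjTranspose) i j) :=
    hΦm.aestronglyMeasurable
  constructor
  · rw [← hconj.map_eq]
    exact (integrable_map_measure hΦ' hconj.measurable.aemeasurable).2 hi2
  · rw [← hconj.map_eq, integral_map hconj.measurable.aemeasurable hΦ']
    rw [gaussianMat, integral_pi_succ]
    refine (integral_congr_ae hev).trans ?_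
    rw [integral_add (integrable_const _) hiC, integral_fun_snd (fun x =>
      Real.log ‖(WithLp.toLp 2 (cofactorVec z x) : EuclideanSpace ℂ (Fin (m + 1)))‖)]
    simp [cofactorLogMean]

/-- Split off the first column c of the lower rows, independent of the remaining block D. Dropping
the cofactor of index 0 leaves a vector of norm ‖adj(D - z) c‖, whose mean log-norm at fixed c is
log‖c‖ plus the previous cofactor mean. -/
theorem cofactorLogMean_succ_ge (m : ℕ) {z : ℂ} (hz : z ≠ 0)
    (hi : Integrable (fun c : Fin (m + 1) → ℂ =>
      Real.log ‖(WithLp.toLp 2 c : EuclideanSpace ℂ (Fin (m + 1)))‖) (gaussianVec (Fin (m + 1)))) :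
    ∫ c, Real.log ‖(WithLp.toLp 2 c : EuclideanSpace ℂ (Fin (m + 1)))‖
      ∂gaussianVec (Fin (m + 1)) + cofactorLogMean z m ≤ cofactorLogMean z (m + 1) := by
  have hs := gaussianMat_split (m + 1) (n := m + 1)
  have he := measurableEmbedding_split (m + 1) (m + 1)
  have hc := (hs.integrable_comp_emb he).2 (integrable_log_norm_cofactorVec (m + 1) hz)
  rw [cofactorLogMean.eq_1 z (m + 1), ← hs.integral_comp he]
  simp only [Function.comp_def] at hc
  rw [integral_prod _ hc]
  have : ∫ c, Real.log ‖(WithLp.toLp 2 c : EuclideanSpace ℂ (Fin (m + 1)))‖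
      ∂gaussianVec (Fin (m + 1)) + cofactorLogMean z m =
      ∫ c, (Real.log ‖(WithLp.toLp 2 c : EuclideanSpace ℂ (Fin (m + 1)))‖ + cofactorLogMean z m)
      ∂gaussianVec (Fin (m + 1)) := by
    rw [integral_add hi (integrable_const _)]; simp
  rw [this]
  refine integral_mono_ae (hi.add (integrable_const _)) hc.integral_prod_left ?_
  have hne : ∀ᵐ c ∂gaussianVec (Fin (m + 1)), c ≠ 0 := by
    have := ae_dotProduct_add_ne_zero (ι := Fin (m + 1)) (y := Pi.single 0 1) (s := 0)
      (Or.inl (by simp))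
    filter_upwards [this] with c hc h0
    simp [h0] at hc
  filter_upwards [hne, hc.prod_right_ae] with c hc0 hci
  obtain ⟨h1, h2⟩ := integral_log_norm_adjugate_mulVec m hz hc0
  rw [← h2]
  refine integral_mono_ae h1 hci ?_
  filter_upwards [(det_sub_ae_ne_zero (m + 1) hz).1] with D hD
  have hA : (Matrix.of D - z • 1 : Matrix _ _ ℂ).adjugate.mulVec c ≠ 0 := by
    intro h0
    have := congrArg ((Matrix.of D - z • 1 : Matrix _ _ ℂ).mulVec) h0
    rw [Matrix.mulVec_mulVec, Matrix.mul_adjugate, Matrix.smul_mulVec, Matrix.one_mulVec,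
      Matrix.mulVec_zero] at this
    exact hc0 ((smul_eq_zero.1 this).resolve_left hD)
  refine Real.log_le_log (by simpa using hA) ?_
  have h3 := norm_toLp_succ_le (cofactorVec z
    (fun i => (Fin.cons (c i) (D i) : Fin (m + 1 + 1) → ℂ)))
  rw [cofactorVec_split_succ z c D hD, WithLp.toLp_neg, norm_neg] at h3
  exact h3


/-! ### Mean log-norm of a Gaussian vector -/

theorem integral_Ioi_one_add_pow {n : ℕ} :
    IntegrableOn (fun t : ℝ => ((1 + t)⁻¹) ^ (n + 2)) (Set.Ioi 0) ∧
    ∫ t in Set.Ioi (0 : ℝ), ((1 + t)⁻¹) ^ (n + 2) = 1 / (n + 1 : ℝ) := by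
  have hd : ∀ t ∈ Set.Ici (0 : ℝ), HasDerivAt
      (fun t : ℝ => -(1 / (n + 1 : ℝ)) * ((1 + t)⁻¹) ^ (n + 1)) (((1 + t)⁻¹) ^ (n + 2)) t := by
    intro t ht
    have ht' : (1 + t) ≠ 0 := by have : (0 : ℝ) ≤ t := ht; positivity
    have h1 := ((((hasDerivAt_id t).const_add 1).inv ht').pow (n + 1)).const_mul
      (-(1 / (n + 1 : ℝ)))
    refine HasDerivAt.congr_deriv h1 ?_
    have : (n + 1 : ℝ) ≠ 0 := by positivity
    simp only [id, Pi.inv_apply]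
    simp only [Nat.add_sub_cancel]
    push_cast
    rw [pow_add _ n 2]
    field_simp
  have hpos : ∀ t ∈ Set.Ioi (0 : ℝ), 0 ≤ ((1 + t)⁻¹) ^ (n + 2) := by
    intro t ht
    have : (0 : ℝ) < t := ht
    positivity
  have hlim : Tendsto (fun t : ℝ => -(1 / (n + 1 : ℝ)) * ((1 + t)⁻¹) ^ (n + 1)) atTop (𝓝 0) := by
    have h1 : Tendsto (fun t : ℝ => (1 + t)⁻¹) atTop (𝓝 0) :=
      tendsto_inv_atTop_zero.comp (tendsto_atTop_add_const_left _ _ tendsto_id)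
    have := (h1.pow (n + 1)).const_mul (-(1 / (n + 1 : ℝ)))
    simpa using this
  refine ⟨integrableOn_Ioi_deriv_of_nonneg' hd hpos hlim, ?_⟩
  rw [integral_Ioi_of_hasDerivAt_of_nonneg' hd hpos hlim]
  simp

theorem inv_le_lintegral_exp {s : ℝ} (hs : 0 ≤ s) :
    ENNReal.ofReal s⁻¹ ≤ ∫⁻ t in Set.Ioi (0 : ℝ), ENNReal.ofReal (Real.exp (-t * s)) := by
  rcases hs.eq_or_lt with rfl | h
  · simp
  · have h1 := integral_exp_mul_Ioi (neg_neg_of_pos h) 0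
    have h2 := integrableOn_exp_mul_Ioi (neg_neg_of_pos h) 0
    have e : ∀ t : ℝ, -t * s = -s * t := fun t => by ring
    simp_rw [e]
    rw [← ofReal_integral_eq_lintegral_ofReal h2 (ae_of_all _ fun t => (Real.exp_pos _).le), h1]
    simp

/-- Write 1/S as the integral of e^{-tS} over t > 0 and exchange: the coordinates are independent,
each contributing (1 + t)⁻¹, and dimension at least 2 makes the integral in t converge. -/
theorem integral_inv_norm_sq_gaussianVec (n : ℕ) :
    Integrable (fun c : Fin (n + 2) → ℂ =>
      (‖(WithLp.toLp 2 c : EuclideanSpace ℂ (Fin (n + 2)))‖ ^ 2)⁻¹) (gaussianVec (Fin (n + 2))) ∧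
    ∫ c, (‖(WithLp.toLp 2 c : EuclideanSpace ℂ (Fin (n + 2)))‖ ^ 2)⁻¹
      ∂gaussianVec (Fin (n + 2)) ≤ 1 / (n + 1 : ℝ) := by
  set S : (Fin (n + 2) → ℂ) → ℝ := fun c =>
    ‖(WithLp.toLp 2 c : EuclideanSpace ℂ (Fin (n + 2)))‖ ^ 2 with hS
  have hSe : ∀ c, S c = ∑ i, ‖c i‖ ^ 2 := fun c => EuclideanSpace.norm_sq_eq _
  have hSm : Measurable S := by
    have : S = fun c => ∑ i, ‖c i‖ ^ 2 := funext hSe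
    rw [this]; fun_prop
  have hS0 : ∀ c, 0 ≤ S c := fun c => by positivity
  have hle : ∫⁻ c, ENNReal.ofReal (S c)⁻¹ ∂gaussianVec (Fin (n + 2)) ≤
      ENNReal.ofReal (1 / (n + 1 : ℝ)) := by
    calc ∫⁻ c, ENNReal.ofReal (S c)⁻¹ ∂gaussianVec (Fin (n + 2))
        ≤ ∫⁻ c, (∫⁻ t in Set.Ioi (0 : ℝ), ENNReal.ofReal (Real.exp (-t * S c)))
            ∂gaussianVec (Fin (n + 2)) := lintegral_mono fun c => inv_le_lintegral_exp (hS0 c)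
      _ = ∫⁻ t in Set.Ioi (0 : ℝ), (∫⁻ c, ENNReal.ofReal (Real.exp (-t * S c))
            ∂gaussianVec (Fin (n + 2))) := lintegral_lintegral_swap (by fun_prop)
      _ = ∫⁻ t in Set.Ioi (0 : ℝ), ENNReal.ofReal (((1 + t)⁻¹) ^ (n + 2)) := by
          refine setLIntegral_congr_fun measurableSet_Ioi fun t ht => ?_
          have ht0 : (0 : ℝ) ≤ t := le_of_lt ht
          have he : ∀ c : Fin (n + 2) → ℂ, Real.exp (-t * S c) =
              ∏ i, Real.exp (-t * ‖c i‖ ^ 2) := fun c => by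
            rw [hSe, Finset.mul_sum, Real.exp_sum]
          have hi : Integrable (fun c => Real.exp (-t * S c)) (gaussianVec (Fin (n + 2))) := by
            refine (integrable_const (1 : ℝ)).mono' (by fun_prop) (ae_of_all _ fun c => ?_)
            rw [Real.norm_of_nonneg (Real.exp_pos _).le, Real.exp_le_one_iff]
            nlinarith [hS0 c]
          rw [← ofReal_integral_eq_lintegral_ofReal hi (ae_of_all _ fun c => (Real.exp_pos _).le)]
          simp_rw [he]
          rw [gaussianVec, integral_fintype_prod_eq_pow (fun z : ℂ => Real.exp (-t * ‖z‖ ^ 2)),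
            integral_exp_neg_mul_norm_sq_complexGaussian ht0, Fintype.card_fin]
      _ = ENNReal.ofReal (1 / (n + 1 : ℝ)) := by
          rw [← integral_Ioi_one_add_pow.2, ofReal_integral_eq_lintegral_ofReal
            integral_Ioi_one_add_pow.1]
          filter_upwards [ae_restrict_mem measurableSet_Ioi] with t ht
          have : (0 : ℝ) < t := ht
          simp only [Pi.zero_apply]
          positivity
  have h0 : 0 ≤ᵐ[gaussianVec (Fin (n + 2))] fun c => (S c)⁻¹ :=
    ae_of_all _ fun c => inv_nonneg.2 (hS0 c)
  have hm : AEStronglyMeasurable (fun c => (S c)⁻¹) (gaussianVec (Fin (n + 2))) := by fun_prop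
  refine ⟨⟨hm, ?_⟩, ?_⟩
  · rw [hasFiniteIntegral_iff_ofReal h0]
    exact hle.trans_lt ENNReal.ofReal_lt_top
  · rw [integral_eq_lintegral_of_nonneg_ae h0 hm]
    exact ENNReal.toReal_le_of_le_ofReal (by positivity) hle

theorem gaussianVec_ae_apply_ne_zero {n : ℕ} (i : Fin n) :
    ∀ᵐ c ∂gaussianVec (Fin n), c i ≠ 0 := by
  have := ae_dotProduct_add_ne_zero (ι := Fin n) (y := Pi.single i 1) (s := 0)
    (Or.inl (by simp))
  filter_upwards [this] with c hc
  simpa using hc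

theorem integrable_norm_sq_gaussianVec (n : ℕ) :
    Integrable (fun c : Fin n → ℂ =>
      ‖(WithLp.toLp 2 c : EuclideanSpace ℂ (Fin n))‖ ^ 2) (gaussianVec (Fin n)) := by
  simp_rw [EuclideanSpace.norm_sq_eq]
  refine integrable_finsetSum _ fun i _ => ?_
  exact integrable_comp_eval (μ := fun _ : Fin n => complexGaussian) (i := i)
    integral_norm_sq_complexGaussian.1

theorem integrable_log_norm_gaussianVec (n : ℕ) :
    Integrable (fun c : Fin (n + 1) → ℂ =>
      Real.log ‖(WithLp.toLp 2 c : EuclideanSpace ℂ (Fin (n + 1)))‖)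
      (gaussianVec (Fin (n + 1))) := by
  have h1 : Integrable (fun c : Fin (n + 1) → ℂ => ‖c 0‖⁻¹) (gaussianVec (Fin (n + 1))) := by
    have := (integrable_inv_norm_sub complexGaussian_le_volume 0).1
    simp only [sub_zero] at this
    exact integrable_comp_eval (μ := fun _ : Fin (n + 1) => complexGaussian) (i := 0) this
  have h2 := ((integrable_const (1 : ℝ)).add (integrable_norm_sq_gaussianVec (n + 1))).add h1
  have hm : Measurable fun c : Fin (n + 1) → ℂ =>
      ‖(WithLp.toLp 2 c : EuclideanSpace ℂ (Fin (n + 1)))‖ := by fun_prop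
  refine h2.mono' (Measurable.aestronglyMeasurable (by fun_prop)) ?_
  filter_upwards [gaussianVec_ae_apply_ne_zero (0 : Fin (n + 1))] with c hc
  set t := ‖(WithLp.toLp 2 c : EuclideanSpace ℂ (Fin (n + 1)))‖ with ht
  have h3 : ‖c 0‖ ≤ t := norm_apply_le_norm_toLp c 0
  have h4 : t⁻¹ ≤ ‖c 0‖⁻¹ := inv_anti₀ (norm_pos_iff.2 hc) h3
  have h5 := abs_log_le_add_inv (norm_nonneg _ : 0 ≤ t)
  simp only [Pi.add_apply, Real.norm_eq_abs]
  nlinarith [sq_nonneg (t - 1)]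

theorem integral_log_norm_gaussianVec_one :
    ∫ c, Real.log ‖(WithLp.toLp 2 c : EuclideanSpace ℂ (Fin 1))‖ ∂gaussianVec (Fin 1) =
      gaussianLogMean := by
  have h : ∀ c : Fin 1 → ℂ, ‖(WithLp.toLp 2 c : EuclideanSpace ℂ (Fin 1))‖ = ‖c 0‖ := by
    intro c
    simp [EuclideanSpace.norm_eq]
  simp_rw [h]
  exact integral_comp_eval (μ := fun _ : Fin 1 => complexGaussian) (i := 0)
    (f := fun z : ℂ => Real.log ‖z‖) (Measurable.aestronglyMeasurable (by fun_prop))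

/-- The inequality log x ≥ 1 - 1/x at x = ‖c‖²/a, with a the dimension, reduces the claim to E‖c‖⁻²
≤ 1/(a - 1). Dimension one is separate because ‖c‖⁻² is not integrable there; it is the reason for
`gaussianLogMean` in the error term. -/
theorem integral_log_norm_gaussianVec_ge (n : ℕ) :
    Real.log (n + 1) / 2 - (|gaussianLogMean| + 1) / (n + 1) ≤
      ∫ c, Real.log ‖(WithLp.toLp 2 c : EuclideanSpace ℂ (Fin (n + 1)))‖
        ∂gaussianVec (Fin (n + 1)) := by
  rcases n with _ | n
  · rw [integral_log_norm_gaussianVec_one]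
    have := neg_abs_le gaussianLogMean
    norm_num
    linarith
  · obtain ⟨h1, h2⟩ := integral_inv_norm_sq_gaussianVec n
    have hi := integrable_log_norm_gaussianVec (n + 1)
    set a : ℝ := (n + 2 : ℝ) with ha
    have ha0 : 0 < a := by positivity
    have hpt : ∀ᵐ c ∂gaussianVec (Fin (n + 1 + 1)), (Real.log a + 1) / 2 -
        a / 2 * (‖(WithLp.toLp 2 c : EuclideanSpace ℂ (Fin (n + 2)))‖ ^ 2)⁻¹ ≤
        Real.log ‖(WithLp.toLp 2 c : EuclideanSpace ℂ (Fin (n + 1 + 1)))‖ := by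
      filter_upwards [gaussianVec_ae_apply_ne_zero (0 : Fin (n + 1 + 1))] with c hc
      set t := ‖(WithLp.toLp 2 c : EuclideanSpace ℂ (Fin (n + 1 + 1)))‖ with ht
      have ht0 : 0 < t := (norm_pos_iff.2 hc).trans_le (norm_apply_le_norm_toLp c 0)
      have h3 := Real.log_le_sub_one_of_pos (show 0 < a * (t ^ 2)⁻¹ by positivity)
      rw [Real.log_mul ha0.ne' (by positivity), Real.log_inv, Real.log_pow] at h3
      push_cast at h3
      linarith
    have h3 := integral_mono_ae ((integrable_const _).sub (h1.const_mul (a / 2))) hi hpt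
    rw [integral_sub' (integrable_const _) (h1.const_mul _), integral_const_mul,
      integral_const, probReal_univ, one_smul] at h3
    have h4 : a / 2 * ∫ c, (‖(WithLp.toLp 2 c : EuclideanSpace ℂ (Fin (n + 2)))‖ ^ 2)⁻¹
        ∂gaussianVec (Fin (n + 2)) ≤ a / 2 * (1 / (n + 1 : ℝ)) :=
      mul_le_mul_of_nonneg_left h2 (by positivity)
    refine le_trans ?_ h3
    push_cast
    have e1 : (n + 1 + 1 : ℝ) = a := by rw [ha]; ring
    rw [e1]
    have h5 : a / 2 * (1 / (n + 1 : ℝ)) ≤ 1 / 2 + 1 / a := by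
      have : (n + 1 : ℝ) = a - 1 := by rw [ha]; ring
      have ha1 : 2 ≤ a := by rw [ha]; linarith [(Nat.cast_nonneg n : (0 : ℝ) ≤ n)]
      rw [this]
      have ha2 : 0 < a - 1 := by linarith
      rw [div_mul_div_comm, mul_one, div_add_div _ _ two_ne_zero ha0.ne',
        div_le_div_iff₀ (by positivity) (by positivity)]
      nlinarith
    have h6 : 1 / a ≤ (|gaussianLogMean| + 1) / a := by
      gcongr
      linarith [abs_nonneg gaussianLogMean]
    linarith


/-! ### Second moment of the determinant and the upper bound for the mean -/

theorem integral_mul_conj_gaussianVec {n : ℕ} (a b : Fin n) (p q : ℂ) :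
    Integrable (fun r : Fin n → ℂ => (r a - p) * (starRingEnd ℂ) (r b - q))
      (gaussianVec (Fin n)) ∧
    ∫ r, (r a - p) * (starRingEnd ℂ) (r b - q) ∂gaussianVec (Fin n) =
      (if a = b then 1 else 0) + p * (starRingEnd ℂ) q := by
  have hid : Integrable (fun z : ℂ => z) complexGaussian :=
    (integrable_norm_iff (by fun_prop)).1 integrable_norm_complexGaussian
  have h1 : ∀ a : Fin n, Integrable (fun r : Fin n → ℂ => r a) (gaussianVec (Fin n)) ∧
      ∫ r : Fin n → ℂ, r a ∂gaussianVec (Fin n) = 0 := fun a =>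
    ⟨integrable_comp_eval (μ := fun _ : Fin n => complexGaussian) (i := a) hid,
      (integral_comp_eval (μ := fun _ : Fin n => complexGaussian) (i := a)
        (f := fun z : ℂ => z) (by fun_prop)).trans integral_id_complexGaussian⟩
  have h2 : ∀ a : Fin n, Integrable (fun r : Fin n → ℂ => (starRingEnd ℂ) (r a))
      (gaussianVec (Fin n)) ∧
      ∫ r : Fin n → ℂ, (starRingEnd ℂ) (r a) ∂gaussianVec (Fin n) = 0 := fun a =>
    ⟨(LinearIsometryEquiv.integrable_comp_iff (Complex.conjLIE)).2 (h1 a).1, by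
      rw [integral_conj, (h1 a).2, map_zero]⟩
  have h3 : Integrable (fun r : Fin n → ℂ => r a * (starRingEnd ℂ) (r b)) (gaussianVec (Fin n)) ∧
      ∫ r : Fin n → ℂ, r a * (starRingEnd ℂ) (r b) ∂gaussianVec (Fin n) =
        if a = b then 1 else 0 := by
    rcases eq_or_ne a b with rfl | hab
    · have e : ∀ r : Fin n → ℂ, r a * (starRingEnd ℂ) (r a) = ((‖r a‖ ^ 2 : ℝ) : ℂ) := fun r => by
        rw [Complex.mul_conj, Complex.normSq_eq_norm_sq]
      simp_rw [e, if_true]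
      refine ⟨Integrable.ofReal (integrable_comp_eval (μ := fun _ : Fin n => complexGaussian)
        (i := a) integral_norm_sq_complexGaussian.1), ?_⟩
      rw [integral_complex_ofReal]
      have := (integral_comp_eval (μ := fun _ : Fin n => complexGaussian) (i := a)
        (f := fun z : ℂ => ‖z‖ ^ 2) (by fun_prop)).trans integral_norm_sq_complexGaussian.2
      unfold gaussianVec
      rw [this]
      simp
    · have hi : IndepFun (fun r : Fin n → ℂ => r a) (fun r => (starRingEnd ℂ) (r b))
          (gaussianVec (Fin n)) := by
        have h := iIndepFun_pi (μ := fun _ : Fin n => complexGaussian) (X := fun _ z => z)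
          (fun _ => by fun_prop)
        exact (h.indepFun hab).comp measurable_id (Complex.continuous_conj.measurable)
      rw [if_neg hab]
      refine ⟨hi.integrable_mul (h1 a).1 (h2 b).1, ?_⟩
      rw [hi.integral_fun_mul_eq_mul_integral (h1 a).1.aestronglyMeasurable
        (h2 b).1.aestronglyMeasurable, (h1 a).2, zero_mul]
  have e : ∀ r : Fin n → ℂ, (r a - p) * (starRingEnd ℂ) (r b - q) =
      r a * (starRingEnd ℂ) (r b) - r a * (starRingEnd ℂ) q - p * (starRingEnd ℂ) (r b)
        + p * (starRingEnd ℂ) q := fun r => by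
    rw [map_sub]; ring
  simp_rw [e]
  have i1 : Integrable (fun r : Fin n → ℂ => r a * (starRingEnd ℂ) (r b) -
      r a * (starRingEnd ℂ) q) (gaussianVec (Fin n)) := h3.1.sub ((h1 a).1.mul_const ((starRingEnd ℂ) q))
  have i2 : Integrable (fun r : Fin n → ℂ => r a * (starRingEnd ℂ) (r b) -
      r a * (starRingEnd ℂ) q - p * (starRingEnd ℂ) (r b)) (gaussianVec (Fin n)) := i1.sub ((h2 b).1.const_mul p)
  refine ⟨i2.add (integrable_const _), ?_⟩
  rw [integral_add i2 (integrable_const _), integral_sub i1 ((h2 b).1.const_mul p),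
    integral_sub h3.1 ((h1 a).1.mul_const _), integral_mul_const, integral_const_mul, h3.2,
    (h1 a).2, (h2 b).2]
  simp

theorem det_sub_smul_one_eq_sum {n : ℕ} (z : ℂ) (x : Fin n → Fin n → ℂ) :
    (Matrix.of x - z • 1 : Matrix _ _ ℂ).det =
      ∑ σ : Equiv.Perm (Fin n), ((Equiv.Perm.sign σ : ℤ) : ℂ) *
        ∏ i, (x i (σ i) - if σ i = i then z else 0) := by
  rw [← Matrix.det_transpose, Matrix.det_apply']
  refine Finset.sum_congr rfl fun σ _ => ?_
  congr 1
  refine Finset.prod_congr rfl fun i _ => ?_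
  simp [Matrix.one_apply, eq_comm]

theorem norm_det_sub_smul_one_sq_eq_sum {n : ℕ} (z : ℂ) (x : Fin n → Fin n → ℂ) :
    ((‖(Matrix.of x - z • 1 : Matrix _ _ ℂ).det‖ ^ 2 : ℝ) : ℂ) =
      ∑ σ : Equiv.Perm (Fin n), ∑ τ : Equiv.Perm (Fin n),
        (((Equiv.Perm.sign σ : ℤ) : ℂ) * ((Equiv.Perm.sign τ : ℤ) : ℂ)) *
          ∏ i, ((x i (σ i) - if σ i = i then z else 0) *
            (starRingEnd ℂ) (x i (τ i) - if τ i = i then z else 0)) := by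
  rw [← Complex.normSq_eq_norm_sq, ← Complex.mul_conj, det_sub_smul_one_eq_sum, map_sum,
    Finset.sum_mul_sum]
  refine Finset.sum_congr rfl fun σ _ => Finset.sum_congr rfl fun τ _ => ?_
  rw [Finset.prod_mul_distrib, map_mul, map_prod, map_intCast]
  ring

/-- Independence of the rows factors the mean. In a row where σ and τ differ the two entries are
orthogonal, and at most one of them is diagonal, so the product of shifts vanishes too. -/
theorem integral_perm_prod_gaussianMat {n : ℕ} (z : ℂ) (σ τ : Equiv.Perm (Fin n)) :
    Integrable (fun x : Fin n → Fin n → ℂ => ∏ i, ((x i (σ i) - if σ i = i then z else 0) *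
      (starRingEnd ℂ) (x i (τ i) - if τ i = i then z else 0))) (gaussianMat n (Fin n)) ∧
    ∫ x : Fin n → Fin n → ℂ, ∏ i, ((x i (σ i) - if σ i = i then z else 0) *
      (starRingEnd ℂ) (x i (τ i) - if τ i = i then z else 0)) ∂gaussianMat n (Fin n) =
      if σ = τ then ((∏ i, (1 + if σ i = i then ‖z‖ ^ 2 else 0) : ℝ) : ℂ) else 0 := by
  have h := fun i => integral_mul_conj_gaussianVec (σ i) (τ i) (if σ i = i then z else 0)
    (if τ i = i then z else 0)
  refine ⟨Integrable.fintype_prod fun i => (h i).1, ?_⟩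
  rw [gaussianMat]
  refine (integral_fintype_prod_eq_prod (f := fun i (r : Fin n → ℂ) =>
    (r (σ i) - if σ i = i then z else 0) *
      (starRingEnd ℂ) (r (τ i) - if τ i = i then z else 0))).trans ?_
  rw [Finset.prod_congr rfl fun i _ => (h i).2]
  split_ifs with hs
  · subst hs
    rw [Complex.ofReal_prod]
    refine Finset.prod_congr rfl fun i _ => ?_
    rw [if_pos rfl]
    split_ifs
    · rw [Complex.mul_conj, Complex.normSq_eq_norm_sq]; push_cast; rfl
    · simp
  · obtain ⟨i, hi⟩ : ∃ i, σ i ≠ τ i := by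
      by_contra! h'
      exact hs (Equiv.ext h')
    refine Finset.prod_eq_zero (Finset.mem_univ i) ?_
    rw [if_neg hi, zero_add]
    by_cases h1 : σ i = i
    · have : τ i ≠ i := fun h2 => hi (h1.trans h2.symm)
      simp [this]
    · simp [h1]

theorem integral_norm_det_sq (n : ℕ) (z : ℂ) :
    Integrable (fun x => ‖(Matrix.of x - z • 1 : Matrix _ _ ℂ).det‖ ^ 2)
      (gaussianMat n (Fin n)) ∧
    ∫ x, ‖(Matrix.of x - z • 1 : Matrix _ _ ℂ).det‖ ^ 2 ∂gaussianMat n (Fin n) =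
      ∑ σ : Equiv.Perm (Fin n), ∏ i, (1 + if σ i = i then ‖z‖ ^ 2 else 0) := by
  have hint := fun σ τ : Equiv.Perm (Fin n) => (integral_perm_prod_gaussianMat z σ τ).1
  have hI : Integrable (fun x : Fin n → Fin n → ℂ =>
      ((‖(Matrix.of x - z • 1 : Matrix _ _ ℂ).det‖ ^ 2 : ℝ) : ℂ)) (gaussianMat n (Fin n)) := by
    simp_rw [norm_det_sub_smul_one_sq_eq_sum]
    exact integrable_finsetSum _ fun σ _ => integrable_finsetSum _ fun τ _ =>
      (hint σ τ).const_mul _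
  refine ⟨hI.re, ?_⟩
  apply Complex.ofReal_injective
  rw [← integral_complex_ofReal]
  simp_rw [norm_det_sub_smul_one_sq_eq_sum]
  rw [integral_finsetSum _ fun σ _ => integrable_finsetSum _ fun τ _ => (hint σ τ).const_mul _,
    Complex.ofReal_sum]
  refine Finset.sum_congr rfl fun σ _ => ?_
  rw [integral_finsetSum _ fun τ _ => (hint σ τ).const_mul _]
  simp_rw [integral_const_mul, fun τ => (integral_perm_prod_gaussianMat z σ τ).2]
  simp only [mul_ite, mul_zero, Finset.sum_ite_eq, Finset.mem_univ, if_true]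
  rcases Int.units_eq_one_or (Equiv.Perm.sign σ) with h | h <;> simp [h]

theorem card_perm_fixing {n : ℕ} (S : Finset (Fin n)) :
    (Finset.univ.filter fun σ : Equiv.Perm (Fin n) => ∀ i ∈ S, σ i = i).card =
      (n - S.card).factorial := by
  have e := Equiv.Perm.subtypeEquivSubtypePerm (fun i : Fin n => i ∉ S)
  have h := Fintype.card_congr e
  rw [Fintype.card_perm, Fintype.card_subtype_compl] at h
  simp only [not_not, Fintype.card_fin, Fintype.card_coe] at h
  rw [h, Fintype.card_subtype]

/-- Expand over sets S of fixed points: (n - k)! permutations fix a given S of size k, and the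
number of such S times (n - k)! is n!/k!. -/
theorem sum_perm_prod_fixed (n : ℕ) (t : ℝ) :
    ∑ σ : Equiv.Perm (Fin n), ∏ i, (1 + if σ i = i then t else 0) =
      n.factorial * ∑ k ∈ Finset.range (n + 1), t ^ k / k.factorial := by
  simp_rw [Finset.prod_one_add]
  rw [Finset.sum_comm]
  have h : ∀ S : Finset (Fin n), ∑ σ : Equiv.Perm (Fin n), ∏ i ∈ S, (if σ i = i then t else 0) =
      (fun k => t ^ k * ((n - k).factorial : ℝ)) S.card := by
    intro S
    have : ∀ σ : Equiv.Perm (Fin n), ∏ i ∈ S, (if σ i = i then t else 0) =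
        if ∀ i ∈ S, σ i = i then t ^ S.card else 0 := fun σ => by
      rw [Finset.prod_ite_zero, Finset.prod_const]
      congr
    simp_rw [this]
    rw [← Finset.sum_filter, Finset.sum_const, card_perm_fixing, nsmul_eq_mul, mul_comm]
  rw [Finset.sum_congr rfl fun S _ => h S]
  rw [Finset.sum_powerset_apply_card (fun k => t ^ k * ((n - k).factorial : ℝ)), Finset.card_univ, Fintype.card_fin, Finset.mul_sum]
  refine Finset.sum_congr rfl fun k hk => ?_
  have hk' : k ≤ n := Nat.lt_succ_iff.1 (Finset.mem_range.1 hk)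
  rw [nsmul_eq_mul, Nat.cast_choose ℝ hk']
  have := Nat.factorial_ne_zero k
  have := Nat.factorial_ne_zero (n - k)
  field_simp

theorem integral_norm_det_sq_le (n : ℕ) (z : ℂ) :
    ∫ x, ‖(Matrix.of x - z • 1 : Matrix _ _ ℂ).det‖ ^ 2 ∂gaussianMat n (Fin n) ≤
      n.factorial * Real.exp (‖z‖ ^ 2) := by
  rw [(integral_norm_det_sq n z).2, sum_perm_prod_fixed]
  gcongr
  exact Real.sum_le_exp_of_nonneg (by positivity) _

/-- Jensen's inequality, written with the tangent line of the logarithm at the bound A for the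
second moment. -/
theorem integral_log_norm_det_le (n : ℕ) {z : ℂ} (hz : z ≠ 0) :
    ∫ x, Real.log ‖(Matrix.of x - z • 1 : Matrix _ _ ℂ).det‖ ∂gaussianMat n (Fin n) ≤
      (Real.log n.factorial + ‖z‖ ^ 2) / 2 := by
  have hi := (rowAffine_det_sub (n := n) z).fourth_moment.1
  have h0 := (det_sub_ae_ne_zero n hz).1
  obtain ⟨h1, -⟩ := integral_norm_det_sq n z
  have h2 := integral_norm_det_sq_le n z
  set A : ℝ := n.factorial * Real.exp (‖z‖ ^ 2) with hA
  have hf : (0 : ℝ) < n.factorial := by exact_mod_cast n.factorial_pos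
  have hA0 : 0 < A := by positivity
  have hlA : Real.log A = Real.log n.factorial + ‖z‖ ^ 2 := by
    rw [hA, Real.log_mul hf.ne' (Real.exp_pos _).ne', Real.log_exp]
  have h3 : ∀ᵐ x ∂gaussianMat n (Fin n),
      Real.log ‖(Matrix.of x - z • 1 : Matrix _ _ ℂ).det‖ ≤
      (2 * A)⁻¹ * ‖(Matrix.of x - z • 1 : Matrix _ _ ℂ).det‖ ^ 2 + (Real.log A - 1) / 2 := by
    filter_upwards [h0] with x hx
    have hd := norm_pos_iff.2 hx
    set d := ‖(Matrix.of x - z • 1 : Matrix _ _ ℂ).det‖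
    have h4 := Real.log_le_sub_one_of_pos (show 0 < d ^ 2 / A by positivity)
    rw [Real.log_div (by positivity) hA0.ne', Real.log_pow] at h4
    push_cast at h4
    have : (2 * A)⁻¹ * d ^ 2 = d ^ 2 / A / 2 := by field_simp
    linarith
  have h4 := integral_mono_ae hi ((h1.const_mul (2 * A)⁻¹).add (integrable_const _)) h3
  rw [integral_add' (h1.const_mul _) (integrable_const _), integral_const_mul, integral_const,
    probReal_univ, one_smul] at h4
  have h5 := mul_le_mul_of_nonneg_left h2 (show 0 ≤ (2 * A)⁻¹ by positivity)
  have h6 : (2 * A)⁻¹ * A = 1 / 2 := by field_simp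
  linarith


/-! ### Lower bound for the mean and the fourth moment estimate -/

theorem log_factorial_le (k : ℕ) :
    Real.log k.factorial ≤ (k + 1) * Real.log (k + 1) - k := by
  induction k with
  | zero => simp
  | succ k ih =>
    have hk : (0 : ℝ) < k + 1 := by positivity
    have hk2 : (0 : ℝ) < k + 2 := by positivity
    have hf : (0 : ℝ) < k.factorial := by exact_mod_cast k.factorial_pos
    rw [Nat.factorial_succ]
    push_cast
    rw [Real.log_mul hk.ne' hf.ne']
    have h1 := Real.log_le_sub_one_of_pos (show (0 : ℝ) < (k + 1) / (k + 2) by positivity)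
    rw [Real.log_div hk.ne' hk2.ne'] at h1
    have h2 : ((k + 1) / (k + 2) : ℝ) - 1 = -1 / (k + 2) := by field_simp; ring
    rw [h2, le_div_iff₀ hk2] at h1
    have e : (k + 1 + 1 : ℝ) = k + 2 := by ring
    rw [e]
    nlinarith

/-- Iterating the recursion, the main terms log(j + 1)/2 telescope into factorials and the errors
1/(j + 1) into harmonic numbers. -/
theorem cofactorLogMean_ge_sum {z : ℂ} (hz : z ≠ 0) {k m : ℕ} (hkm : k ≤ m) :
    cofactorLogMean z k + (Real.log m.factorial - Real.log k.factorial) / 2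
      - (|gaussianLogMean| + 1) * (harmonic m - harmonic k : ℚ) ≤ cofactorLogMean z m := by
  induction m, hkm using Nat.le_induction with
  | base => simp
  | succ m hkm ih =>
    have h1 := integral_log_norm_gaussianVec_ge m
    have h2 := cofactorLogMean_succ_ge m hz (integrable_log_norm_gaussianVec m)
    have hk : (0 : ℝ) < m + 1 := by positivity
    have hf : (0 : ℝ) < m.factorial := by exact_mod_cast m.factorial_pos
    rw [Nat.factorial_succ, harmonic_succ]
    push_cast at ih ⊢
    rw [Real.log_mul hk.ne' hf.ne']
    rw [div_eq_mul_inv (|gaussianLogMean| + 1)] at h1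
    linarith

/-- With t = ‖z‖², starting the recursion at k yields (k log t - log k!)/2. This is largest near k =
t, where it is t/2 up to a logarithm; hence k = ⌊t⌋, and t < n ensures k ≤ n - 1. -/
theorem integral_log_norm_det_ge {n : ℕ} {z : ℂ} (hz : z ≠ 0) (hzn : ‖z‖ ^ 2 < n) :
    (Real.log n.factorial + ‖z‖ ^ 2) / 2 - 3 * (|gaussianLogMean| + 1) * (1 + Real.log n) ≤
      ∫ x, Real.log ‖(Matrix.of x - z • 1 : Matrix _ _ ℂ).det‖ ∂gaussianMat n (Fin n) := by
  obtain ⟨m, rfl⟩ : ∃ m, n = m + 1 := by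
    refine Nat.exists_eq_succ_of_ne_zero ?_
    rintro rfl
    have : 0 ≤ ‖z‖ ^ 2 := by positivity
    norm_num at hzn
    linarith
  set t := ‖z‖ ^ 2 with ht
  have hz0 : 0 < ‖z‖ := norm_pos_iff.2 hz
  have ht0 : 0 < t := by positivity
  set k := ⌊t⌋₊ with hk
  have hkt : (k : ℝ) ≤ t := Nat.floor_le ht0.le
  have htk : t < k + 1 := Nat.lt_floor_add_one t
  have hkm : k ≤ m := by
    have : (k : ℝ) < (m + 1 : ℕ) := hkt.trans_lt hzn
    exact Nat.lt_succ_iff.1 (by exact_mod_cast this)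
  have h1 := integral_log_norm_det_ge_cofactorLogMean m hz
  have h2 := cofactorLogMean_ge_sum hz hkm
  have h3 := cofactorLogMean_ge_mul_log k hz
  have h4 := log_factorial_le k
  have hL : Real.log ((m + 1 : ℕ) : ℝ) = Real.log (m + 1) := by push_cast; rfl
  have hmk : Real.log (k + 1) ≤ Real.log (m + 1) := by
    apply Real.log_le_log (by positivity)
    exact_mod_cast Nat.succ_le_succ hkm
  have h5 : (harmonic m - harmonic k : ℚ) ≤ 1 + Real.log (m + 1) := by
    have e1 := harmonic_le_one_add_log m
    have e2 : (0 : ℝ) ≤ (harmonic k : ℚ) := by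
      rw [harmonic]; positivity
    have e3 : Real.log m ≤ Real.log (m + 1) := by
      rcases Nat.eq_zero_or_pos m with rfl | hm
      · simp
      · exact Real.log_le_log (by exact_mod_cast hm) (by linarith)
    push_cast
    linarith
  have hlt : (k : ℝ) * Real.log t / 2 = k * Real.log ‖z‖ := by
    rw [ht, Real.log_pow]; push_cast; ring
  have h6 : (k : ℝ) * Real.log (k + 1) - k * Real.log t ≤ 1 := by
    rcases Nat.eq_zero_or_pos k with h0 | h0
    · rw [h0]; simp
    · have hk0 : (0 : ℝ) < k := by exact_mod_cast h0
      have e1 := Real.log_le_sub_one_of_pos (show (0 : ℝ) < (k + 1) / k by positivity)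
      rw [Real.log_div (by positivity) hk0.ne'] at e1
      have e2 : ((k + 1) / k : ℝ) - 1 = 1 / k := by field_simp; ring
      rw [e2, le_div_iff₀ hk0] at e1
      have e3 : k * Real.log k ≤ k * Real.log t := by gcongr
      linarith
  have hf : (0 : ℝ) < m.factorial := by exact_mod_cast m.factorial_pos
  have h7 : Real.log ((m + 1).factorial : ℝ) = Real.log (m + 1) + Real.log m.factorial := by
    rw [Nat.factorial_succ]; push_cast
    rw [Real.log_mul (by positivity) hf.ne']
  have h8 := neg_abs_le gaussianLogMean
  have h9 : 0 ≤ Real.log (m + 1) := Real.log_nonneg (by linarith [(m.cast_nonneg : (0 : ℝ) ≤ m)])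
  set g := |gaussianLogMean| with hg
  have hg0 : 0 ≤ g := abs_nonneg _
  have h10 : (g + 1) * (harmonic m - harmonic k : ℚ) ≤ (g + 1) * (1 + Real.log (m + 1)) := by
    gcongr
  rw [hL, h7]
  set ℓ := Real.log (m + 1 : ℝ)
  have h11 : (Real.log (m.factorial) + ℓ + t) / 2 - (1 + ℓ) - g - (g + 1) * (1 + ℓ) ≤
      gaussianLogMean + cofactorLogMean z m := by
    have : (k + 1 : ℝ) * Real.log (k + 1) = k * Real.log (k + 1) + Real.log (k + 1) := by ring
    linarith
  nlinarith [mul_nonneg hg0 h9]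

/-- The fluctuation contributes O(n²). The bias is O(1 + log n), hence O(√n), and its fourth power
is also O(n²). -/
theorem exists_logDet_fourth_moment_bound : ∃ C : ℝ, 0 ≤ C ∧
    ∀ (n : ℕ) (z : ℂ), z ≠ 0 → ‖z‖ ^ 2 < n →
    Integrable (fun x => (Real.log ‖(Matrix.of x - z • 1 : Matrix _ _ ℂ).det‖
      - (Real.log n.factorial + ‖z‖ ^ 2) / 2) ^ 4) (gaussianMat n (Fin n)) ∧
    ∫ x, (Real.log ‖(Matrix.of x - z • 1 : Matrix _ _ ℂ).det‖
      - (Real.log n.factorial + ‖z‖ ^ 2) / 2) ^ 4 ∂gaussianMat n (Fin n) ≤ C * n ^ 2 := by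
  set B := logOscBound
  set g := |gaussianLogMean| + 1 with hg
  have hg1 : 0 ≤ g := by positivity
  have hB : 0 ≤ B := by
    have := (log_norm_affine_osc 0 0).2
    simpa using this
  refine ⟨8 * (16 * B) + 8 * (6 * g) ^ 4, by positivity, fun n z hz hzn => ?_⟩
  obtain ⟨i1, i2, h1⟩ := (rowAffine_det_sub (n := n) z).fourth_moment
  have hu := integral_log_norm_det_le n hz
  have hl := integral_log_norm_det_ge hz hzn
  set E := ∫ x, Real.log ‖(Matrix.of x - z • 1 : Matrix _ _ ℂ).det‖ ∂gaussianMat n (Fin n)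
  set h := (Real.log n.factorial + ‖z‖ ^ 2) / 2 with hh
  have hn : (0 : ℝ) < n := lt_of_le_of_lt (by positivity) hzn
  have hlog : 1 + Real.log n ≤ 2 * √n := by
    have e1 := Real.log_le_sub_one_of_pos (Real.sqrt_pos.2 hn)
    rw [Real.log_sqrt hn.le] at e1
    linarith
  have hdiff : |E - h| ≤ 6 * g * √n := by
    have e1 : 3 * g * (1 + Real.log n) ≤ 3 * g * (2 * √n) := by gcongr
    have e2 : 0 ≤ 6 * g * √n := by positivity
    rw [abs_le]
    constructor <;> linarith
  have hdiff4 : (E - h) ^ 4 ≤ (6 * g) ^ 4 * n ^ 2 := by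
    have e1 : (E - h) ^ 4 = |E - h| ^ 4 := by rw [pow_abs, abs_of_nonneg (by positivity)]
    have e2 : (6 * g) ^ 4 * (n : ℝ) ^ 2 = (6 * g * √n) ^ 4 := by
      rw [mul_pow _ (√n : ℝ), show (√n : ℝ) ^ 4 = (√n ^ 2) ^ 2 by ring, Real.sq_sqrt hn.le]
    rw [e1, e2]
    gcongr
  have hpt : ∀ a b : ℝ, (a + b) ^ 4 ≤ 8 * a ^ 4 + 8 * b ^ 4 := fun a b => by
    nlinarith [sq_nonneg (a ^ 2 - b ^ 2), sq_nonneg (a - b), sq_nonneg ((a - b) ^ 2),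
      mul_nonneg (sq_nonneg (a - b)) (sq_nonneg (a + b)),
      mul_nonneg (sq_nonneg (a - b)) (sq_nonneg a), mul_nonneg (sq_nonneg (a - b)) (sq_nonneg b)]
  have hpt' : ∀ L : ℝ, (L - h) ^ 4 ≤ 8 * (L - E) ^ 4 + 8 * (E - h) ^ 4 := fun L => by
    have := hpt (L - E) (E - h)
    simpa using this
  have i3 := (i2.const_mul 8).add (integrable_const (8 * (E - h) ^ 4))
  have i4 : Integrable (fun x => (Real.log ‖(Matrix.of x - z • 1 : Matrix _ _ ℂ).det‖ - h) ^ 4)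
      (gaussianMat n (Fin n)) := by
    refine i3.mono' ((i1.aestronglyMeasurable.sub aestronglyMeasurable_const).pow 4)
      (ae_of_all _ fun x => ?_)
    rw [Real.norm_of_nonneg (by positivity)]
    exact hpt' _
  refine ⟨i4, (integral_mono i4 i3 fun x => hpt' _).trans ?_⟩
  rw [integral_add' (i2.const_mul 8) (integrable_const _), integral_const_mul, integral_const,
    probReal_univ, one_smul]
  nlinarith


/-! ### Weak convergence to the circular law from bump functions -/

theorem circularLaw_apply_of_isOpen {O : Set ℂ} (hO : IsOpen O) :
    (circularLaw : Measure ℂ) O =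
      ENNReal.ofReal Real.pi⁻¹ * volume (O ∩ Metric.ball 0 1) := by
  have hset : {z : ℂ | ‖z‖ ≤ 1} = Metric.closedBall 0 1 := by
    ext z; simp
  have hae : (O ∩ Metric.closedBall (0 : ℂ) 1 : Set ℂ) =ᵐ[volume] (O ∩ Metric.ball 0 1 : Set ℂ) := by
    refine (ae_eq_refl O).inter ?_
    have h := Measure.addHaar_sphere (volume : Measure ℂ) 0 1
    have : ∀ᵐ z : ℂ, z ∉ Metric.sphere (0 : ℂ) 1 := measure_eq_zero_iff_ae_notMem.1 h
    filter_upwards [this] with z hz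
    have hz1 : ‖z‖ ≠ 1 := by simpa using hz
    apply propext
    change z ∈ Metric.closedBall (0 : ℂ) 1 ↔ z ∈ Metric.ball (0 : ℂ) 1
    simp [le_iff_lt_or_eq, hz1]
  change (volume.withDensity ({z : ℂ | ‖z‖ ≤ 1}.indicator fun _ => ENNReal.ofReal Real.pi⁻¹)) O = _
  rw [hset, withDensity_apply _ hO.measurableSet, lintegral_indicator measurableSet_closedBall,
    setLIntegral_const, Measure.restrict_apply measurableSet_closedBall, Set.inter_comm,
    measure_congr hae]

/-- After exchanging the integrals, each w receives at most the full mass of a bump, and nothing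
unless it is within s₂ of K. -/
theorem lintegral_discBump_prod_le {K O : Set ℂ} {s₁ s₂ : ℝ} (h₁ : 0 < s₁) (h : s₁ < s₂)
    (hK : MeasurableSet K) (hO : MeasurableSet O) (hKO : Metric.thickening s₂ K ⊆ O) (μ : Measure ℂ) [SFinite μ] :
    ∫⁻ c in K, (∫⁻ w, ENNReal.ofReal (discBump s₁ s₂ ‖w - c‖) ∂μ) ≤
      ENNReal.ofReal (Real.pi * (s₂ ^ 2 - s₁ ^ 2) / 4) * μ O := by
  have hcont := continuous_discBump h₁ h.le
  rw [lintegral_lintegral_swap (by fun_prop)]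
  calc ∫⁻ w, (∫⁻ c in K, ENNReal.ofReal (discBump s₁ s₂ ‖w - c‖)) ∂μ
      ≤ ∫⁻ w, O.indicator (fun _ => ENNReal.ofReal (Real.pi * (s₂ ^ 2 - s₁ ^ 2) / 4)) w ∂μ := by
        refine lintegral_mono fun w => ?_
        by_cases hw : w ∈ O
        · rw [Set.indicator_of_mem hw, ← lintegral_discBump w h₁ h]
          simp_rw [norm_sub_rev w]
          exact setLIntegral_le_lintegral _ _
        · rw [Set.indicator_of_notMem hw]
          refine le_of_eq (lintegral_eq_zero_of_ae_eq_zero ?_)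
          refine ae_restrict_of_forall_mem hK fun c hc => ?_
          have hle : s₂ ≤ ‖w - c‖ := by
            by_contra! hlt
            exact hw (hKO (Metric.ball_subset_thickening hc s₂ (mem_ball_iff_norm.2 hlt)))
          simp only [discBump_eq_zero h₁ h.le hle, ENNReal.ofReal_zero, Pi.zero_apply]
      _ = _ := by rw [lintegral_indicator_const hO]

/-- By the portmanteau theorem a lower bound for liminf μₙ(O) on open sets suffices. Exhaust the
part of O inside the disc by compact sets K, average bumps over centres in K, and apply Fatou; only
bumps supported in the unit disc are tested. -/
theorem tendsto_circularLaw_of_discBump {μ : ℕ → ProbabilityMeasure ℂ}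
    (H : ∀ (c : ℂ) (s₁ s₂ : ℝ), 0 < s₁ → s₁ < s₂ → Metric.ball c s₂ ⊆ Metric.ball 0 1 →
      Tendsto (fun n => ∫⁻ w, ENNReal.ofReal (discBump s₁ s₂ ‖w - c‖) ∂(μ n : Measure ℂ)) atTop
        (𝓝 (ENNReal.ofReal ((s₂ ^ 2 - s₁ ^ 2) / 4)))) :
    Tendsto μ atTop (𝓝 circularLaw) := by
  refine tendsto_of_forall_isOpen_le_liminf' fun O hO => ?_
  rw [circularLaw_apply_of_isOpen hO,
    (hO.inter Metric.isOpen_ball).measure_eq_iSup_isCompact, ENNReal.mul_iSup]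
  refine iSup_le fun K => ?_
  rw [ENNReal.mul_iSup]
  refine iSup_le fun hKO => ?_
  rw [ENNReal.mul_iSup]
  refine iSup_le fun hK => ?_
  obtain ⟨δ, hδ, hth⟩ := hK.exists_thickening_subset_open (hO.inter Metric.isOpen_ball) hKO
  -- Any two radii 0 < s₁ < s₂ ≤ δ would do; the normalisation `a` cancels at the end.
  have h₁ : 0 < δ / 2 := by positivity
  have h₂ : δ / 2 < δ := by linarith
  set a : ℝ := (δ ^ 2 - (δ / 2) ^ 2) / 4 with ha
  have ha0 : 0 < a := by rw [ha]; nlinarith [sq_pos_of_pos hδ]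
  have hcont := continuous_discBump h₁ h₂.le
  have hfatou : ENNReal.ofReal a * volume K ≤
      liminf (fun n => ENNReal.ofReal (Real.pi * a) * (μ n : Measure ℂ) O) atTop := by
    calc ENNReal.ofReal a * volume K = ∫⁻ c in K, ENNReal.ofReal a := by rw [setLIntegral_const]
      _ = ∫⁻ c in K, liminf (fun n => ∫⁻ w, ENNReal.ofReal (discBump (δ / 2) δ ‖w - c‖)
            ∂(μ n : Measure ℂ)) atTop := by
          refine setLIntegral_congr_fun hK.measurableSet fun c hc => ?_
          refine (Tendsto.liminf_eq (H c _ _ h₁ h₂ ?_)).symm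
          exact (Metric.ball_subset_thickening hc δ).trans (hth.trans Set.inter_subset_right)
      _ ≤ liminf (fun n => ∫⁻ c in K, (∫⁻ w, ENNReal.ofReal (discBump (δ / 2) δ ‖w - c‖)
            ∂(μ n : Measure ℂ))) atTop := by
          refine lintegral_liminf_le fun n => ?_
          exact Measurable.lintegral_prod_right' (f := fun p : ℂ × ℂ =>
            ENNReal.ofReal (discBump (δ / 2) δ ‖p.2 - p.1‖)) (by fun_prop)
      _ ≤ _ := by
          refine liminf_le_liminf (Eventually.of_forall fun n => ?_)
          have := lintegral_discBump_prod_le h₁ h₂ hK.measurableSet hO.measurableSet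
            (hth.trans Set.inter_subset_left) (μ n : Measure ℂ)
          rwa [mul_div_assoc] at this
  have hpa : 0 < Real.pi * a := by positivity
  have e1 : ENNReal.ofReal Real.pi⁻¹ = ENNReal.ofReal (Real.pi * a)⁻¹ * ENNReal.ofReal a := by
    rw [← ENNReal.ofReal_mul (by positivity)]
    congr 1
    field_simp
  have e2 : ENNReal.ofReal (Real.pi * a)⁻¹ * ENNReal.ofReal (Real.pi * a) = 1 := by
    rw [← ENNReal.ofReal_mul (by positivity), inv_mul_cancel₀ hpa.ne', ENNReal.ofReal_one]
  rw [e1, mul_assoc]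
  refine (mul_le_mul_right hfatou _).trans ?_
  rw [ENNReal.liminf_const_mul_of_ne_top ENNReal.ofReal_ne_top, ← mul_assoc, e2, one_mul]


/-! ### From eigenvalue sums to log-determinants -/

theorem lintegral_multiset_dirac (s : Multiset ℂ) (f : ℂ → ENNReal) :
    ∫⁻ w, f w ∂(s.map Measure.dirac).sum = (s.map f).sum := by
  induction s using Multiset.induction_on with
  | empty => simp
  | cons a s ih => simp [lintegral_add_measure, ih]

theorem ofReal_multiset_sum (s : Multiset ℂ) {f : ℂ → ℝ} (hf : ∀ w, 0 ≤ f w) :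
    (s.map fun w => ENNReal.ofReal (f w)).sum = ENNReal.ofReal (s.map f).sum ∧
      0 ≤ (s.map f).sum := by
  induction s using Multiset.induction_on with
  | empty => simp
  | cons a s ih =>
    simp only [Multiset.map_cons, Multiset.sum_cons]
    exact ⟨by rw [ih.1, ENNReal.ofReal_add (hf a) ih.2], add_nonneg (hf a) ih.2⟩

theorem lintegral_empiricalSpectralDistribution {n : ℕ} [NeZero n] (A : Matrix (Fin n) (Fin n) ℂ)
    {f : ℂ → ℝ} (hf : ∀ w, 0 ≤ f w) :
    ∫⁻ w, ENNReal.ofReal (f w) ∂(empiricalSpectralDistribution A : Measure ℂ) =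
      ENNReal.ofReal ((A.charpoly.roots.map f).sum / n) := by
  change ∫⁻ w, ENNReal.ofReal (f w) ∂((n : ENNReal)⁻¹ • eigenvalueCount A) = _
  have hn : (0 : ℝ) < n := by exact_mod_cast Nat.pos_of_ne_zero (NeZero.ne n)
  rw [lintegral_smul_measure, eigenvalueCount, lintegral_multiset_dirac,
    (ofReal_multiset_sum _ hf).1, div_eq_inv_mul, ENNReal.ofReal_mul (by positivity),
    ENNReal.ofReal_inv_of_pos hn, ENNReal.ofReal_natCast, smul_eq_mul]

theorem setIntegral_ball_multiset_log (r : Multiset ℂ) (c : ℂ) {s : ℝ} (hs : 0 < s) :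
    IntegrableOn (fun z => (r.map fun a => Real.log ‖z - a‖).sum) (Metric.ball c s) ∧
    ∫ z in Metric.ball c s, (r.map fun a => Real.log ‖z - a‖).sum =
      Real.pi * s ^ 2 * (r.map fun a => discPotential s ‖a - c‖).sum := by
  induction r using Multiset.induction_on with
  | empty => simp
  | cons a r ih =>
    simp only [Multiset.map_cons, Multiset.sum_cons]
    have h := integrableOn_ball_log_norm_sub c a s
    refine ⟨h.add ih.1, ?_⟩
    rw [integral_add h ih.1, setIntegral_ball_log_norm_sub c a hs, ih.2]
    ring

theorem log_norm_multiset_prod_sub (r : Multiset ℂ) {z : ℂ} (hz : z ∉ r) :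
    (r.map (z - ·)).prod ≠ 0 ∧
    Real.log ‖(r.map (z - ·)).prod‖ = (r.map fun a => Real.log ‖z - a‖).sum := by
  induction r using Multiset.induction_on with
  | empty => simp
  | cons a r ih =>
    rw [Multiset.mem_cons, not_or] at hz
    have h1 : z - a ≠ 0 := sub_ne_zero.2 hz.1
    obtain ⟨h2, h3⟩ := ih hz.2
    simp only [Multiset.map_cons, Multiset.sum_cons, Multiset.prod_cons]
    exact ⟨mul_ne_zero h1 h2, by
      rw [norm_mul, Real.log_mul (norm_ne_zero_iff.2 h1) (norm_ne_zero_iff.2 h2), h3]⟩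

theorem norm_det_sub_eq_norm_eval_charpoly {n : ℕ} (A : Matrix (Fin n) (Fin n) ℂ) (z : ℂ) :
    ‖(A - z • 1).det‖ = ‖A.charpoly.eval z‖ := by
  have h : (A - z • 1) = -(Matrix.scalar (Fin n) z - A) := by
    rw [neg_sub, Matrix.scalar_apply, Matrix.smul_one_eq_diagonal]
  rw [Matrix.eval_charpoly, h, Matrix.det_neg]
  simp

theorem log_norm_det_sub_eq_sum_roots {n : ℕ} (A : Matrix (Fin n) (Fin n) ℂ) {z : ℂ}
    (hz : z ∉ A.charpoly.roots) :
    Real.log ‖(A - z • 1).det‖ = (A.charpoly.roots.map fun a => Real.log ‖z - a‖).sum := by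
  rw [norm_det_sub_eq_norm_eval_charpoly, ← (log_norm_multiset_prod_sub _ hz).2,
    (IsAlgClosed.splits A.charpoly).eval_eq_prod_roots_of_monic A.charpoly_monic]

/-- The deviation, per eigenvalue, of `log ‖det (x - √n z)‖` from half of
`log n! + ‖√n z‖²`. -/
noncomputable def logDetDeviation {n : ℕ} (x : Fin n → Fin n → ℂ) (z : ℂ) : ℝ :=
  (Real.log ‖(Matrix.of x - (((√n : ℝ) : ℂ) * z) • 1 : Matrix _ _ ℂ).det‖ -
    (Real.log n.factorial + ‖((√n : ℝ) : ℂ) * z‖ ^ 2) / 2) / n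

/-- Off the spectrum the deviation is a constant depending only on n, plus the logarithmic potential
of the empirical measure, minus ‖z‖²/2. -/
theorem logDetDeviation_eq {n : ℕ} (hn : n ≠ 0) (x : Fin n → Fin n → ℂ) {z : ℂ}
    (hz : z ∉ (((1 / √n : ℝ) : ℂ) • Matrix.of x).charpoly.roots) :
    logDetDeviation x z = (Real.log (√n) - Real.log n.factorial / (2 * n)) +
      (((((1 / √n : ℝ) : ℂ) • Matrix.of x).charpoly.roots.map fun a => Real.log ‖z - a‖).sum / n
        - ‖z‖ ^ 2 / 2) := by
  have hn0 : (0 : ℝ) < n := by exact_mod_cast Nat.pos_of_ne_zero hn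
  have hs : (0 : ℝ) < √n := Real.sqrt_pos.2 hn0
  have hsc : ((√n : ℝ) : ℂ) ≠ 0 := by exact_mod_cast hs.ne'
  set A := ((1 / √n : ℝ) : ℂ) • Matrix.of x with hA
  have h : (Matrix.of x - (((√n : ℝ) : ℂ) * z) • 1 : Matrix _ _ ℂ) =
      ((√n : ℝ) : ℂ) • (A - z • 1) := by
    rw [smul_sub, hA, smul_smul, smul_smul]
    push_cast
    rw [mul_one_div_cancel hsc, one_smul]
  have hd : (A - z • 1).det ≠ 0 := by
    rw [← norm_ne_zero_iff, norm_det_sub_eq_norm_eval_charpoly, norm_ne_zero_iff]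
    exact fun h0 => hz ((Polynomial.mem_roots A.charpoly_monic.ne_zero).2 h0)
  have hnz : ‖((√n : ℝ) : ℂ) * z‖ ^ 2 = n * ‖z‖ ^ 2 := by
    rw [norm_mul, mul_pow, Complex.norm_real, Real.norm_of_nonneg hs.le, Real.sq_sqrt hn0.le]
  rw [logDetDeviation, hnz, h, Matrix.det_smul, Fintype.card_fin, norm_mul, norm_pow,
    Complex.norm_real, Real.norm_of_nonneg hs.le,
    Real.log_mul (by positivity) (norm_ne_zero_iff.2 hd), Real.log_pow,
    log_norm_det_sub_eq_sum_roots A hz]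
  field_simp
  ring

theorem setIntegral_ball_logDetDeviation {n : ℕ} (hn : n ≠ 0) (x : Fin n → Fin n → ℂ) (c : ℂ)
    {s : ℝ} (hs : 0 < s) :
    ∫ z in Metric.ball c s, logDetDeviation x z = Real.pi * s ^ 2 *
      ((Real.log (√n) - Real.log n.factorial / (2 * n)) +
      (((((1 / √n : ℝ) : ℂ) • Matrix.of x).charpoly.roots.map
        fun a => discPotential s ‖a - c‖).sum / n - (‖c‖ ^ 2 + s ^ 2 / 2) / 2)) := by
  have := isFiniteMeasure_restrict_ball c s
  set r := (((1 / √n : ℝ) : ℂ) • Matrix.of x).charpoly.roots with hr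
  have hae : ∀ᵐ z : ℂ ∂volume.restrict (Metric.ball c s), z ∉ r := by
    refine ae_restrict_of_ae ?_
    have h : volume (r.toFinset : Set ℂ) = 0 := r.toFinset.finite_toSet.measure_zero _
    filter_upwards [measure_eq_zero_iff_ae_notMem.1 h] with z hz
    simpa using hz
  obtain ⟨i1, e1⟩ := setIntegral_ball_multiset_log r c hs
  have i2 : IntegrableOn (fun z : ℂ => ‖z‖ ^ 2 / 2) (Metric.ball c s) := by
    refine Integrable.mono' (integrable_const ((‖c‖ + s) ^ 2 / 2)) (by fun_prop) ?_
    filter_upwards [ae_restrict_mem measurableSet_ball] with z hz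
    rw [Real.norm_of_nonneg (by positivity)]
    have h1 : ‖z‖ ≤ ‖c‖ + s := by
      have h2 : ‖z - c‖ < s := mem_ball_iff_norm.1 hz
      have h3 : ‖z‖ ≤ ‖z - c‖ + ‖c‖ := by simpa using norm_add_le (z - c) c
      linarith
    gcongr
  have i3 : IntegrableOn (fun z => (r.map fun a => Real.log ‖z - a‖).sum / n - ‖z‖ ^ 2 / 2)
      (Metric.ball c s) := (i1.div_const _).sub i2
  rw [integral_congr_ae (hae.mono fun z hz => logDetDeviation_eq hn x hz),
    integral_add (integrable_const _) i3, integral_sub (i1.div_const _) i2, integral_const, integral_div, integral_div, e1,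
    setIntegral_ball_norm_sq c hs]
  have hv : (volume.restrict (Metric.ball c s)).real Set.univ = Real.pi * s ^ 2 := by
    rw [Measure.real, Measure.restrict_apply_univ, Complex.volume_ball, ENNReal.toReal_mul,
      ENNReal.toReal_pow, ENNReal.toReal_ofReal hs.le]
    simp [mul_comm]
  rw [hv, smul_eq_mul]
  ring

/-- The constant depending on n cancels between the two disc averages, so no asymptotics of n! are
needed. -/
theorem sum_discBump_eq_average_sub {n : ℕ} (hn : n ≠ 0) (x : Fin n → Fin n → ℂ) (c : ℂ)
    {s₁ s₂ : ℝ} (h₁ : 0 < s₁) (h₂ : 0 < s₂) :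
    ((((1 / √n : ℝ) : ℂ) • Matrix.of x).charpoly.roots.map
        fun a => discBump s₁ s₂ ‖a - c‖).sum / n =
      (s₂ ^ 2 - s₁ ^ 2) / 4 +
      ((Real.pi * s₂ ^ 2)⁻¹ * ∫ z in Metric.ball c s₂, logDetDeviation x z) -
      ((Real.pi * s₁ ^ 2)⁻¹ * ∫ z in Metric.ball c s₁, logDetDeviation x z) := by
  have hp := Real.pi_pos
  rw [setIntegral_ball_logDetDeviation hn x c h₁, setIntegral_ball_logDetDeviation hn x c h₂,
    inv_mul_cancel_left₀ (by positivity), inv_mul_cancel_left₀ (by positivity)]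
  simp only [discBump]
  rw [Multiset.sum_map_sub]
  ring

theorem tendsto_setIntegral_of_lintegral_pow_four {α : Type*} [MeasurableSpace α] {μ : Measure α}
    [IsFiniteMeasure μ] {f : ℕ → α → ℝ} (hf : ∀ n, AEStronglyMeasurable (f n) μ)
    (h : Tendsto (fun n => ∫⁻ a, ‖f n a‖ₑ ^ 4 ∂μ) atTop (𝓝 0)) (S : Set α) :
    Tendsto (fun n => ∫ a in S, f n a ∂μ) atTop (𝓝 0) := by
  have h4 : ∀ n, eLpNorm (f n) 4 μ = (∫⁻ a, ‖f n a‖ₑ ^ 4 ∂μ) ^ (1 / 4 : ℝ) := fun n => by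
    rw [eLpNorm_eq_lintegral_rpow_enorm_toReal (by norm_num) (by norm_num)]
    norm_num
  have ht : Tendsto (fun n => eLpNorm (f n) 4 μ) atTop (𝓝 0) := by
    simp_rw [h4]
    have := h.ennrpow_const (1 / 4)
    simpa using this
  have h1 : Tendsto (fun n => eLpNorm (f n) 1 μ) atTop (𝓝 0) := by
    have hb : ∀ n, eLpNorm (f n) 1 μ ≤ eLpNorm (f n) 4 μ *
        μ Set.univ ^ (1 / (1 : ENNReal).toReal - 1 / (4 : ENNReal).toReal) := fun n =>
      eLpNorm_le_eLpNorm_mul_rpow_measure_univ (by norm_num) (hf n)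
    refine tendsto_of_tendsto_of_tendsto_of_le_of_le tendsto_const_nhds ?_ (fun _ => zero_le) hb
    have := ENNReal.Tendsto.mul_const ht (Or.inr (ENNReal.rpow_ne_top_of_nonneg
      (y := 1 / (1 : ENNReal).toReal - 1 / (4 : ENNReal).toReal) (by norm_num)
      (measure_ne_top μ Set.univ)))
    simpa using this
  rw [tendsto_zero_iff_enorm_tendsto_zero]
  refine tendsto_of_tendsto_of_tendsto_of_le_of_le tendsto_const_nhds h1 (fun _ => zero_le)
    fun n => ?_
  rw [eLpNorm_one_eq_lintegral_enorm]
  exact (enorm_integral_le_lintegral_enorm _).trans (setLIntegral_le_lintegral _ _)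

theorem measurable_logDetDeviation (n : ℕ) :
    Measurable fun p : (Fin n → Fin n → ℂ) × ℂ => logDetDeviation p.1 p.2 := by
  have h : Continuous fun p : (Fin n → Fin n → ℂ) × ℂ =>
      (Matrix.of p.1 - (((√n : ℝ) : ℂ) * p.2) • 1 : Matrix _ _ ℂ).det := by
    refine Continuous.matrix_det (continuous_matrix fun i j => ?_)
    simp only [Matrix.sub_apply, Matrix.of_apply, Matrix.smul_apply]
    fun_prop
  unfold logDetDeviation
  have := h.measurable
  fun_prop

/-- For 0 < ‖z‖ < 1 the point √n z satisfies ‖√n z‖² < n, so the fourth moment estimate applies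
pointwise; division by n⁴ leaves C/n², and the disc has area π. -/
theorem exists_lintegral_logDetDeviation_bound : ∃ C : ℝ, 0 ≤ C ∧ ∀ n : ℕ, n ≠ 0 →
    ∫⁻ x, (∫⁻ z in Metric.ball (0 : ℂ) 1, ‖logDetDeviation x z‖ₑ ^ 4) ∂gaussianMat n (Fin n) ≤
      ENNReal.ofReal (C / n ^ 2) := by
  obtain ⟨C, hC, H⟩ := exists_logDet_fourth_moment_bound
  refine ⟨C * Real.pi, by positivity, fun n hn => ?_⟩
  have hn0 : (0 : ℝ) < n := by exact_mod_cast Nat.pos_of_ne_zero hn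
  have hs : (0 : ℝ) < √n := Real.sqrt_pos.2 hn0
  have hm := measurable_logDetDeviation n
  have hm' : AEMeasurable (Function.uncurry fun (x : Fin n → Fin n → ℂ) z =>
      ‖logDetDeviation x z‖ₑ ^ 4)
      ((gaussianMat n (Fin n)).prod (volume.restrict (Metric.ball (0 : ℂ) 1))) := by
    exact (hm.enorm.pow_const 4).aemeasurable
  rw [lintegral_lintegral_swap hm']
  calc ∫⁻ z in Metric.ball (0 : ℂ) 1, (∫⁻ x, ‖logDetDeviation x z‖ₑ ^ 4 ∂gaussianMat n (Fin n))
      ≤ ∫⁻ z in Metric.ball (0 : ℂ) 1, ENNReal.ofReal (C / n ^ 2) := by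
        refine lintegral_mono_ae ?_
        have h0 : ∀ᵐ z : ℂ, z ≠ 0 := by
          simpa using measure_eq_zero_iff_ae_notMem.1 (measure_singleton (μ := (volume : Measure ℂ)) 0)
        filter_upwards [ae_restrict_mem measurableSet_ball, ae_restrict_of_ae h0] with z hz hz0
        have hz1 : ‖z‖ < 1 := by simpa using hz
        obtain ⟨h1, h2⟩ := H n (((√n : ℝ) : ℂ) * z)
          (mul_ne_zero (by exact_mod_cast hs.ne') hz0) (by
            rw [norm_mul, mul_pow, Complex.norm_real, Real.norm_of_nonneg hs.le,
              Real.sq_sqrt hn0.le]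
            have : ‖z‖ ^ 2 < 1 := by nlinarith [norm_nonneg z]
            nlinarith)
        have e : ∀ x : Fin n → Fin n → ℂ, ‖logDetDeviation x z‖ₑ ^ 4 = ENNReal.ofReal
            ((Real.log ‖(Matrix.of x - (((√n : ℝ) : ℂ) * z) • 1 : Matrix _ _ ℂ).det‖ -
              (Real.log n.factorial + ‖((√n : ℝ) : ℂ) * z‖ ^ 2) / 2) ^ 4 / n ^ 4) := fun x => by
          rw [← ofReal_norm, ← ENNReal.ofReal_pow (norm_nonneg _), Real.norm_eq_abs,
            pow_abs, abs_of_nonneg (by positivity), logDetDeviation, div_pow]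
        simp_rw [e]
        rw [← ofReal_integral_eq_lintegral_ofReal (h1.div_const _)
          (ae_of_all _ fun x => by positivity), integral_div]
        refine ENNReal.ofReal_le_ofReal ?_
        rw [div_le_div_iff₀ (by positivity) (by positivity)]
        nlinarith [pow_pos hn0 2]
    _ = ENNReal.ofReal (C * Real.pi / n ^ 2) := by
        rw [setLIntegral_const, Complex.volume_ball, ENNReal.ofReal_one, one_pow, one_mul,
          ← NNReal.coe_real_pi, ← ENNReal.ofReal_coe_nnreal, ← ENNReal.ofReal_mul (by positivity)]
        congr 1
        ring

/-! ### Almost sure convergence -/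

theorem map_corner_eq_gaussianMat {Ω : Type*} [MeasurableSpace Ω] {P : Measure Ω}
    [IsProbabilityMeasure P] {G : ℕ → ℕ → Ω → ℂ}
    (hlaw : ∀ i j : ℕ, HasLaw (G i j) complexGaussian P)
    (hindep : iIndepFun (fun p : ℕ × ℕ => G p.1 p.2) P) (n : ℕ) :
    AEMeasurable (fun ω (i j : Fin n) => G i j ω) P ∧
      P.map (fun ω (i j : Fin n) => G i j ω) = gaussianMat n (Fin n) := by
  have hinj : Function.Injective fun p : Fin n × Fin n => ((p.1 : ℕ), (p.2 : ℕ)) := by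
    rintro ⟨a, b⟩ ⟨c, d⟩ h
    simpa [Fin.ext_iff] using h
  have h1 := hindep.precomp hinj
  have hm : ∀ p : Fin n × Fin n, AEMeasurable (G p.1 p.2) P := fun p => (hlaw _ _).aemeasurable
  have h2 := (iIndepFun_iff_map_fun_eq_pi_map hm).1 h1
  have h3 : P.map (fun ω (p : Fin n × Fin n) => G p.1 p.2 ω) = gaussianVec (Fin n × Fin n) := by
    rw [h2, gaussianVec]
    congr 1
    funext p
    exact (hlaw _ _).map_eq
  have hc := gaussianVec_map_curry n (Fin n)
  have hm2 : AEMeasurable (fun ω (p : Fin n × Fin n) => G p.1 p.2 ω) P :=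
    aemeasurable_pi_lambda _ hm
  refine ⟨hc.measurable.comp_aemeasurable hm2, ?_⟩
  rw [← hc.map_eq, ← h3, AEMeasurable.map_map_of_aemeasurable hc.measurable.aemeasurable hm2]
  rfl

/-- The expectations are summable, so the series is almost surely finite and its terms tend to 0. No
relation between different sizes is used, only the law of each corner. -/
theorem ae_tendsto_lintegral_logDetDeviation {Ω : Type*} [MeasurableSpace Ω] {P : Measure Ω}
    [IsProbabilityMeasure P] {G : ℕ → ℕ → Ω → ℂ}
    (hlaw : ∀ i j : ℕ, HasLaw (G i j) complexGaussian P)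
    (hindep : iIndepFun (fun p : ℕ × ℕ => G p.1 p.2) P) :
    ∀ᵐ ω ∂P, Tendsto (fun n : ℕ => ∫⁻ z in Metric.ball (0 : ℂ) 1,
      ‖logDetDeviation (fun i j : Fin (n + 1) => G i j ω) z‖ₑ ^ 4) atTop (𝓝 0) := by
  obtain ⟨C, hC, H⟩ := exists_lintegral_logDetDeviation_bound
  have hFm : ∀ n : ℕ, Measurable fun x : Fin n → Fin n → ℂ =>
      ∫⁻ z in Metric.ball (0 : ℂ) 1, ‖logDetDeviation x z‖ₑ ^ 4 := fun n =>
    Measurable.lintegral_prod_right' (f := fun p : (Fin n → Fin n → ℂ) × ℂ =>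
      ‖logDetDeviation p.1 p.2‖ₑ ^ 4) ((measurable_logDetDeviation n).enorm.pow_const 4)
  have hlaw' := fun n => map_corner_eq_gaussianMat hlaw hindep n
  have hm : ∀ n : ℕ, AEMeasurable (fun ω => ∫⁻ z in Metric.ball (0 : ℂ) 1,
      ‖logDetDeviation (fun i j : Fin (n + 1) => G i j ω) z‖ₑ ^ 4) P := fun n =>
    (hFm (n + 1)).comp_aemeasurable (hlaw' (n + 1)).1
  have hsum : ∫⁻ ω, ∑' n : ℕ, (∫⁻ z in Metric.ball (0 : ℂ) 1,
      ‖logDetDeviation (fun i j : Fin (n + 1) => G i j ω) z‖ₑ ^ 4) ∂P ≠ ⊤ := by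
    rw [lintegral_tsum hm]
    have hb : ∀ n : ℕ, ∫⁻ ω, (∫⁻ z in Metric.ball (0 : ℂ) 1,
        ‖logDetDeviation (fun i j : Fin (n + 1) => G i j ω) z‖ₑ ^ 4) ∂P ≤
        ENNReal.ofReal (C / ((n + 1 : ℕ) : ℝ) ^ 2) := fun n => by
      refine le_trans (le_of_eq ?_) (H (n + 1) (Nat.succ_ne_zero n))
      rw [← (hlaw' (n + 1)).2, lintegral_map' (hFm (n + 1)).aemeasurable (hlaw' (n + 1)).1]
    refine ne_top_of_le_ne_top ?_ (ENNReal.tsum_le_tsum hb)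
    have hs : Summable fun n : ℕ => C / ((n + 1 : ℕ) : ℝ) ^ 2 := by
      have h1 : Summable fun n : ℕ => 1 / (n : ℝ) ^ 2 :=
        Real.summable_one_div_nat_pow.2 (by norm_num)
      have h2 := ((summable_nat_add_iff 1).2 h1).mul_left C
      simpa [div_eq_mul_inv] using h2
    exact hs.tsum_ofReal_ne_top
  filter_upwards [ae_lt_top' (AEMeasurable.tsum hm) hsum] with ω hω
  exact ENNReal.tendsto_atTop_zero_of_tsum_ne_top hω.ne

theorem mainTheorem2 {Ω : Type*} [MeasurableSpace Ω] (P : Measure Ω) [IsProbabilityMeasure P]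
    (G : ℕ → ℕ → Ω → ℂ)
    (hlaw : ∀ i j : ℕ, HasLaw (G i j) complexGaussian P)
    (hindep : iIndepFun (fun p : ℕ × ℕ => G p.1 p.2) P) :
    ∀ᵐ ω ∂P, Tendsto
      (fun n : ℕ => empiricalSpectralDistribution
        (((1 / Real.sqrt ((n + 1 : ℕ) : ℝ) : ℝ) : ℂ) • cornerMatrix G (n + 1) ω))
      atTop (𝓝 circularLaw) := by
  -- A single null set serves all centres and radii: the L⁴ convergence on the whole unit disc
  -- controls every smaller disc at once.
  filter_upwards [ae_tendsto_lintegral_logDetDeviation hlaw hindep] with ω hω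
  refine tendsto_circularLaw_of_discBump fun c s₁ s₂ h₁ h hball => ?_
  have := isFiniteMeasure_restrict_ball 0 1
  have hint : ∀ s, s ≤ s₂ → Tendsto (fun n : ℕ => ∫ z in Metric.ball c s,
      logDetDeviation (fun i j : Fin (n + 1) => G i j ω) z) atTop (𝓝 0) := by
    intro s hs
    have h1 := tendsto_setIntegral_of_lintegral_pow_four
      (fun n => (((measurable_logDetDeviation (n + 1)).comp
        (measurable_prodMk_left (x := fun i j : Fin (n + 1) => G i j ω))).aestronglyMeasurable))
      hω (Metric.ball c s)
    have h2 : Metric.ball c s ∩ Metric.ball 0 1 = Metric.ball c s :=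
      Set.inter_eq_left.2 ((Metric.ball_subset_ball hs).trans hball)
    simpa only [Measure.restrict_restrict measurableSet_ball, h2, Function.comp_apply] using h1
  have hlim : Tendsto (fun n : ℕ =>
      ((((1 / √((n + 1 : ℕ) : ℝ) : ℝ) : ℂ) •
        Matrix.of (fun i j : Fin (n + 1) => G i j ω)).charpoly.roots.map
        fun a => discBump s₁ s₂ ‖a - c‖).sum / ((n + 1 : ℕ) : ℝ)) atTop
      (𝓝 ((s₂ ^ 2 - s₁ ^ 2) / 4)) := by
    have h1 := ((hint s₂ le_rfl).const_mul (Real.pi * s₂ ^ 2)⁻¹).const_add ((s₂ ^ 2 - s₁ ^ 2) / 4)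
    have h2 := h1.sub ((hint s₁ h.le).const_mul (Real.pi * s₁ ^ 2)⁻¹)
    rw [mul_zero, mul_zero, add_zero, sub_zero] at h2
    exact h2.congr fun n =>
      (sum_discBump_eq_average_sub (Nat.succ_ne_zero n) _ c h₁ (h₁.trans h)).symm
  refine ((ENNReal.continuous_ofReal.tendsto _).comp hlim).congr fun n => ?_
  exact (lintegral_empiricalSpectralDistribution _
    fun w => discBump_nonneg h₁ h.le (norm_nonneg _)).symm
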